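/- **Theorem (Discrete Korn inequality).** Let $d\in\{2,3\}$, let $\Omega\subset\mathbb R^d$ be a bounded connected polytopal domain (the interior of a finite union of closed $d$-simplices) and let $\rho\in(0,1)$. There is a constant $C>0$, depending only on $d$, $\Omega$ and $\rho$, such that the following holds. Consider any polytopal mesh of $\Omega$, with finite sets $\mathcal M$ of cells (disjoint open polytopes whose closures cover $\overline\Omega$), $\mathcal F$ of faces (disjoint, connected, relatively open flat sets of dimension $d-1$ partitioning the mesh skeleton, each cell lying on one side of each of its faces; each face is contained either in $\partial K\cap\partial L$ for two distinct cells $K,L$ or in $\partial K\cap\partial\Omega$ for a cell $K$), of edges (the open straight sides of the faces; the faces themselves if $d=2$) and $\mathcal V$ of nodes $\mathbf x_s$ (the endpoints of the edges). Assume that the mesh is regular with parameter $\rho$: there is a matching simplicial submesh (each open simplex lies in a unique cell, each open simplicial facet is contained in or disjoint from each face) such that every simplex $\tau$, of diameter $h_\tau$ and inradius $r_\tau$, satisfies $\rho h_\tau\le r_\tau$, and $\rho h_K\le h_\tau$ whenever $\tau\subset K\in\mathcal M$, where $h_K$ is the diameter of $K$. Denote by $\mathcal F_K$ the faces of $K$,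 by $\mathcal V_K,\mathcal V_\sigma$ the nodes of $K$ and $\sigma$, by $\mathbf n_{K\sigma}$ the outer unit normal to $K$ on $\sigma\in\mathcal F_K$, by $\mathbf n_\sigma$ a fixed unit normal to $\sigma$, by $|K|,|\sigma|$ the $d$- and $(d-1)$-dimensional measures and by $\overline{\mathbf x}_K,\overline{\mathbf x}_\sigma$ the centres of mass. For $X\in\mathcal M\cup\mathcal F$ let $(\omega_s^X)_{s\in\mathcal V_X}$ be any nonnegative weights with $\sum_{s\in\mathcal V_X}\omega_s^X=1$ and $\overline{\mathbf x}_X=\sum_{s\in\mathcal V_X}\omega_s^X\mathbf x_s$. For $\mathbf v_{\mathcal D}=((\mathbf v_s)_{s\in\mathcal V},(v_\sigma)_{\sigma\in\mathcal F})$ with $\mathbf v_s\in\mathbb R^d$ and $v_\sigma\in\mathbb R$, set $\overline{\mathbf v}_X=\sum_{s\in\mathcal V_X}\omega_s^X\mathbf v_s$ and, for $K\in\mathcal M$, $$\nabla^K\mathbf v_{\mathcal D}=\frac1{|K|}\sum_{\sigma\in\mathcal F_K}|\sigma|\,\overline{\mathbf v}_\sigma\otimes\mathbf n_{K\sigma}+\frac1{|K|}\sum_{\sigma\in\mathcal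 F_K}|\sigma|\,v_\sigma\,\mathbf n_\sigma\otimes\mathbf n_{K\sigma},\qquad \Pi^K\mathbf v_{\mathcal D}(\mathbf x)=\nabla^K\mathbf v_{\mathcal D}(\mathbf x-\overline{\mathbf x}_K)+\overline{\mathbf v}_K,$$ $$S_K(\mathbf u_{\mathcal D},\mathbf v_{\mathcal D})=h_K^{d-2}\sum_{s\in\mathcal V_K}(\mathbf u_s-\Pi^K\mathbf u_{\mathcal D}(\mathbf x_s))\cdot(\mathbf v_s-\Pi^K\mathbf v_{\mathcal D}(\mathbf x_s))+h_K^{d-2}\sum_{\sigma\in\mathcal F_K}u_\sigma v_\sigma .$$ Let $S_{\mathcal D}=\sum_{K\in\mathcal M}S_K$, let $\nabla^{\mathcal D}\mathbf v_{\mathcal D}$ be the piecewise constant function equal to $\nabla^K\mathbf v_{\mathcal D}$ on each $K\in\mathcal M$, let $\boldsymbol\varepsilon_{\mathcal D}(\mathbf v_{\mathcal D})=\frac12(\nabla^{\mathcal D}\mathbf v_{\mathcal D}+(\nabla^{\mathcal D}\mathbf v_{\mathcal D})^{T})$, and let $$\|\mathbf v_{\mathcal D}\|_{1,\mathcal D}=\Big(\sum_{K\in\mathcal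 M}\big(\|\nabla^K\mathbf v_{\mathcal D}\|_{L^2(K)}^2+S_K(\mathbf v_{\mathcal D},\mathbf v_{\mathcal D})\big)\Big)^{1/2},$$ where matrices carry the Frobenius norm. Then, for every $\mathbf v_{\mathcal D}$ in $\mathbf U_{0,\mathcal D}$, i.e. such that $\mathbf v_s=\mathbf 0$ for all nodes $\mathbf x_s\in\partial\Omega$ and $v_\sigma=0$ for all faces $\sigma\subset\partial\Omega$, $$\|\mathbf v_{\mathcal D}\|_{1,\mathcal D}^2\le C\left(\|\boldsymbol\varepsilon_{\mathcal D}(\mathbf v_{\mathcal D})\|_{L^2(\Omega)}^2+S_{\mathcal D}(\mathbf v_{\mathcal D},\mathbf v_{\mathcal D})\right).$$ -/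

import Mathlib

open MeasureTheory
open scoped Topology

noncomputable section

namespace DDR

/-- The Euclidean space `ℝ^d`. -/
abbrev Pt (d : ℕ) := EuclideanSpace ℝ (Fin d)

/-! ### Polytopes, simplicial meshes -/

/-- The vertex set of a nondegenerate `d`-simplex of `ℝ^d`. -/
def IsSimplexVertexSet {d : ℕ} (τ : Finset (Pt d)) : Prop :=
  τ.card = d + 1 ∧ AffineIndependent ℝ (fun p : {p // p ∈ τ} => (p : Pt d))

/-- The closed simplex with vertex set `τ`. -/
def closedSimplex {d : ℕ} (τ : Finset (Pt d)) : Set (Pt d) :=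
  convexHull ℝ (τ : Set (Pt d))

/-- The open simplex with vertex set `τ`. -/
def openSimplex {d : ℕ} (τ : Finset (Pt d)) : Set (Pt d) :=
  interior (closedSimplex τ)

/-- A polytope (or polytopal domain) of `ℝ^d`: a nonempty connected set which is the interior of a
finite union of closed `d`-simplices. It is in particular open, bounded, and has no cracks. -/
def IsPolytope {d : ℕ} (P : Set (Pt d)) : Prop :=
  IsConnected P ∧ ∃ T : Finset (Finset (Pt d)),
    (∀ τ ∈ T, IsSimplexVertexSet τ) ∧ P = interior (⋃ τ ∈ T, closedSimplex τ)

/-- `T` (a finite set of `d`-simplices, given by their vertices) is a matching simplicial mesh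
of `Ω`: the closed simplices cover the closure of `Ω`, and two of them intersect exactly along the
convex hull of their common vertices. -/
structure IsMatchingSimplicialMesh {d : ℕ} (Ω : Set (Pt d)) (T : Finset (Finset (Pt d))) :
    Prop where
  isSimplex : ∀ τ ∈ T, IsSimplexVertexSet τ
  cover : closure Ω = ⋃ τ ∈ T, closedSimplex τ
  inter : ∀ τ ∈ T, ∀ τ' ∈ T, closedSimplex τ ∩ closedSimplex τ' =
    convexHull ℝ ((τ : Set (Pt d)) ∩ (τ' : Set (Pt d)))

/-- The inradius of a set: the supremum of the radii of the balls that it contains. -/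
def inradius {d : ℕ} (S : Set (Pt d)) : ℝ :=
  sSup {r : ℝ | 0 ≤ r ∧ ∃ c : Pt d, Metric.ball c r ⊆ S}

/-! ### Polytopal meshes -/

/-- `n` is the unit normal to the flat set `σ` which, at each point of `σ`, points out of `K`
(with `K` lying on the other side). -/
def IsOuterNormal {d : ℕ} (K σ : Set (Pt d)) (n : Pt d) : Prop :=
  ‖n‖ = 1 ∧ (∀ x ∈ σ, ∀ y ∈ σ, inner ℝ (x - y) n = 0) ∧
    ∀ x ∈ σ, ∀ᶠ t : ℝ in 𝓝[>] 0, x + t • n ∉ closure K ∧ x - t • n ∈ K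

/-- A polytopal mesh of `Ω ⊆ ℝ^d` (`d = 2, 3`), made of cells (open polytopes), faces (flat,
relatively open sets of dimension `d - 1`), edges (open segments) and nodes. For `d = 2` the edges
are the faces; for `d = 3` the edges are the open sides of the polygonal faces. -/
structure PolytopalMesh (d : ℕ) (Ω : Set (Pt d)) where
  cells : Finset (Set (Pt d))
  faces : Finset (Set (Pt d))
  edges : Finset (Set (Pt d))
  nodes : Finset (Pt d)
  cell_polytope : ∀ K ∈ cells, IsPolytope K
  cells_disjoint : (cells : Set (Set (Pt d))).PairwiseDisjoint id
  cells_cover : closure Ω = ⋃ K ∈ cells, closure K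
  face_connected : ∀ σ ∈ faces, IsConnected σ
  face_flat : ∀ σ ∈ faces, ∃ H : AffineSubspace ℝ (Pt d),
    Module.finrank ℝ H.direction + 1 = d ∧ ∃ U : Set (Pt d), IsOpen U ∧ σ = U ∩ (H : Set (Pt d))
  faces_disjoint : (faces : Set (Set (Pt d))).PairwiseDisjoint id
  /-- Each face is an interface between two cells, or a boundary face. -/
  face_interface_or_boundary : ∀ σ ∈ faces,
    (∃ K ∈ cells, ∃ L ∈ cells, K ≠ L ∧ σ ⊆ frontier K ∩ frontier L) ∨
      (∃ K ∈ cells, σ ⊆ frontier K ∩ frontier Ω)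
  skeleton : (⋃ K ∈ cells, frontier K) = ⋃ σ ∈ faces, closure σ
  /-- Each cell lies on one side of each of its faces. -/
  exists_outerNormal : ∀ K ∈ cells, ∀ σ ∈ faces, σ ⊆ frontier K → ∃ n, IsOuterNormal K σ n
  edge_segment : ∀ e ∈ edges, ∃ a ∈ nodes, ∃ b ∈ nodes, a ≠ b ∧ e = openSegment ℝ a b
  edges_disjoint : (edges : Set (Set (Pt d))).PairwiseDisjoint id
  node_not_mem_edge : ∀ s ∈ nodes, ∀ e ∈ edges, s ∉ e
  node_of_edge : ∀ s ∈ nodes, ∃ e ∈ edges, s ∈ closure e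
  edges_eq_faces : d = 2 → edges = faces
  /-- In dimension 3, the relative boundary of a face is the union of its closed edges. -/
  face_boundary : d = 3 → ∀ σ ∈ faces,
    closure σ \ σ = ⋃ e ∈ {e | e ∈ edges ∧ e ⊆ closure σ \ σ}, closure e
  edge_of_face : d = 3 → ∀ e ∈ edges, ∃ σ ∈ faces, e ⊆ closure σ \ σ

namespace PolytopalMesh

variable {d : ℕ} {Ω : Set (Pt d)}

/-- `T` is a matching simplicial submesh of the polytopal mesh `M`: each open simplex is contained
in a unique cell, and each open simplicial facet is contained in or disjoint from each face. -/
structure IsMatchingSubmesh (M : PolytopalMesh d Ω) (T : Finset (Finset (Pt d))) : Prop where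
  isMesh : IsMatchingSimplicialMesh Ω T
  simplex_subset_cell : ∀ τ ∈ T, ∃! K : Set (Pt d), K ∈ M.cells ∧ openSimplex τ ⊆ K
  facet_subset_face : ∀ τ ∈ T, ∀ x ∈ τ, ∀ σ ∈ M.faces,
    intrinsicInterior ℝ (convexHull ℝ ((τ : Set (Pt d)) \ {x})) ⊆ σ ∨
      Disjoint (intrinsicInterior ℝ (convexHull ℝ ((τ : Set (Pt d)) \ {x}))) σ

/-- Mesh regularity with parameter `ρ`: there is a matching simplicial submesh which is shape
regular and whose simplices have diameters comparable to those of the cells containing them. -/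
def IsRegular (M : PolytopalMesh d Ω) (ρ : ℝ) : Prop :=
  ∃ T : Finset (Finset (Pt d)), M.IsMatchingSubmesh T ∧
    (∀ τ ∈ T, ρ * Metric.diam (openSimplex τ) ≤ inradius (openSimplex τ)) ∧
    ∀ τ ∈ T, ∀ K ∈ M.cells, openSimplex τ ⊆ K →
      ρ * Metric.diam K ≤ Metric.diam (openSimplex τ)

variable (M : PolytopalMesh d Ω)

open Classical in
/-- The faces of the cell `K`. -/
def facesOf (K : M.cells) : Finset M.faces :=
  Finset.univ.filter fun σ => (σ : Set (Pt d)) ⊆ frontier (K : Set (Pt d))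

open Classical in
/-- The nodes (vertices) of the face `σ`. -/
def nodesOfFace (σ : M.faces) : Finset M.nodes :=
  Finset.univ.filter fun s => (s : Pt d) ∈ closure (σ : Set (Pt d)) \ (σ : Set (Pt d))

open Classical in
/-- The nodes (vertices) of the cell `K`. -/
def nodesOfCell (K : M.cells) : Finset M.nodes :=
  (M.facesOf K).biUnion M.nodesOfFace

open Classical in
/-- The outer unit normal to `K` on its face `σ`. -/
def outerNormal (K : M.cells) (σ : M.faces) : Pt d :=
  if h : ∃ n, IsOuterNormal (K : Set (Pt d)) (σ : Set (Pt d)) n then h.choose else 0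

/-- The measure `|K|` of a cell. -/
def cellMeasure (K : M.cells) : ℝ := volume.real (K : Set (Pt d))

/-- The `(d-1)`-dimensional measure `|σ|` of a face. -/
def faceMeasure (σ : M.faces) : ℝ := (μHE[d - 1]).real (σ : Set (Pt d))

/-- The centre of mass of a cell. -/
def cellCenter (K : M.cells) : Pt d := ⨍ x in (K : Set (Pt d)), x

/-- The centre of mass of a face. -/
def faceCenter (σ : M.faces) : Pt d := ⨍ x in (σ : Set (Pt d)), x ∂μHE[d - 1]

/-- The choices entering the discretisation: a unit normal `n_σ` to each face (its orientation),
and nonnegative weights expressing the centres of mass of the faces and cells as convex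
combinations of their nodes. -/
structure Choices where
  normal : M.faces → Pt d
  norm_normal : ∀ σ, ‖normal σ‖ = 1
  normal_orthogonal : ∀ σ : M.faces, ∀ x ∈ (σ : Set (Pt d)), ∀ y ∈ (σ : Set (Pt d)),
    inner ℝ (x - y) (normal σ) = 0
  faceWeight : M.faces → M.nodes → ℝ
  faceWeight_nonneg : ∀ σ, ∀ s ∈ M.nodesOfFace σ, 0 ≤ faceWeight σ s
  faceWeight_sum : ∀ σ, ∑ s ∈ M.nodesOfFace σ, faceWeight σ s = 1
  faceWeight_center : ∀ σ,
    M.faceCenter σ = ∑ s ∈ M.nodesOfFace σ, faceWeight σ s • (s : Pt d)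
  cellWeight : M.cells → M.nodes → ℝ
  cellWeight_nonneg : ∀ K, ∀ s ∈ M.nodesOfCell K, 0 ≤ cellWeight K s
  cellWeight_sum : ∀ K, ∑ s ∈ M.nodesOfCell K, cellWeight K s = 1
  cellWeight_center : ∀ K,
    M.cellCenter K = ∑ s ∈ M.nodesOfCell K, cellWeight K s • (s : Pt d)

/-- The discrete space `U_D`: a vector for each node and a scalar for each face. -/
abbrev Dofs := (M.nodes → Pt d) × (M.faces → ℝ)

/-- The subspace `U_{0,D}`: the unknowns vanish at the nodes and faces on the boundary of `Ω`. -/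
def dofsZero : Submodule ℝ M.Dofs where
  carrier := {v | (∀ s : M.nodes, (s : Pt d) ∈ frontier Ω → v.1 s = 0) ∧
    ∀ σ : M.faces, (σ : Set (Pt d)) ⊆ frontier Ω → v.2 σ = 0}
  zero_mem' := by simp
  add_mem' := by
    rintro u v ⟨hu, hu'⟩ ⟨hv, hv'⟩
    exact ⟨fun s hs => by simp [hu s hs, hv s hs], fun σ hσ => by simp [hu' σ hσ, hv' σ hσ]⟩
  smul_mem' := by
    rintro c v ⟨hv, hv'⟩
    exact ⟨fun s hs => by simp [hv s hs], fun σ hσ => by simp [hv' σ hσ]⟩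

variable {M}

namespace Choices

variable (D : M.Choices)

/-- The face average `v̄_σ` of the nodal values. -/
def faceAvg (v : M.Dofs) (σ : M.faces) : Pt d :=
  ∑ s ∈ M.nodesOfFace σ, D.faceWeight σ s • v.1 s

/-- The cell average `v̄_K` of the nodal values. -/
def cellAvg (v : M.Dofs) (K : M.cells) : Pt d :=
  ∑ s ∈ M.nodesOfCell K, D.cellWeight K s • v.1 s

/-- The cell gradient reconstruction `∇^K`; `Matrix.vecMulVec a b` is the tensor product `a ⊗ b`. -/
def gradCell (v : M.Dofs) (K : M.cells) : Matrix (Fin d) (Fin d) ℝ :=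
  (M.cellMeasure K)⁻¹ • (∑ σ ∈ M.facesOf K,
      M.faceMeasure σ • Matrix.vecMulVec (D.faceAvg v σ).ofLp (M.outerNormal K σ).ofLp) +
    (M.cellMeasure K)⁻¹ • (∑ σ ∈ M.facesOf K,
      (M.faceMeasure σ * v.2 σ) • Matrix.vecMulVec (D.normal σ).ofLp (M.outerNormal K σ).ofLp)

/-- The cell displacement reconstruction `Π^K`. -/
def dispCell (v : M.Dofs) (K : M.cells) (x : Pt d) : Pt d :=
  WithLp.toLp 2 ((D.gradCell v K).mulVec (x - M.cellCenter K).ofLp) + D.cellAvg v K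

/-- The global (piecewise constant) gradient reconstruction `∇^D`. -/
def grad (v : M.Dofs) (x : Pt d) : Matrix (Fin d) (Fin d) ℝ :=
  ∑ K : M.cells, (K : Set (Pt d)).indicator (fun _ => D.gradCell v K) x

/-- The discrete symmetric gradient `ε_D`. -/
def symGrad (v : M.Dofs) (x : Pt d) : Matrix (Fin d) (Fin d) ℝ :=
  (1 / 2 : ℝ) • (D.grad v x + (D.grad v x).transpose)

/-- The local stabilisation bilinear form `S_K`. -/
def stabCell (K : M.cells) (u v : M.Dofs) : ℝ :=
  Metric.diam (K : Set (Pt d)) ^ (d - 2) * (∑ s ∈ M.nodesOfCell K,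
      inner ℝ (u.1 s - D.dispCell u K s) (v.1 s - D.dispCell v K s)) +
    Metric.diam (K : Set (Pt d)) ^ (d - 2) * ∑ σ ∈ M.facesOf K, u.2 σ * v.2 σ

/-- The stabilisation bilinear form `S_D`. -/
def stab (u v : M.Dofs) : ℝ := ∑ K : M.cells, D.stabCell K u v

end Choices

end PolytopalMesh

/-- The `L²(X)`-norm of a matrix-valued function (with the Frobenius norm on matrices). -/
def l2Norm {d : ℕ} (X : Set (Pt d)) (A : Pt d → Matrix (Fin d) (Fin d) ℝ) : ℝ :=
  Real.sqrt (∫ x in X, ∑ i, ∑ j, A x i j ^ 2)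

namespace PolytopalMesh.Choices

variable {d : ℕ} {Ω : Set (Pt d)} {M : PolytopalMesh d Ω} (D : M.Choices)

/-- The local discrete `H¹`-like seminorm. -/
def normCell (v : M.Dofs) (K : M.cells) : ℝ :=
  Real.sqrt (l2Norm (K : Set (Pt d)) (fun _ => D.gradCell v K) ^ 2 + D.stabCell K v v)

/-- The discrete `H¹`-like seminorm `‖·‖_{1,D}`. -/
def normOne (v : M.Dofs) : ℝ := Real.sqrt (∑ K : M.cells, D.normCell v K ^ 2)

end PolytopalMesh.Choices

end DDR

end

/-! On the simplicial submesh a discrete field is read as the broken affine field Π^K. Of ∇^K the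
proof uses only that it is the linear part of Π^K; no consistency of the reconstruction is needed.
The claim is thus a Korn inequality for a discontinuous piecewise affine field whose jumps are
controlled by the stabilisation, and it follows by comparison with a continuous field.

Conforming Korn inequality (`korn_interp`). A continuous piecewise affine w vanishing outside Ω is
Lipschitz with compact support, so ∫ ∂_j w_i ∂_i w_j = ∫ ∂_i w_i ∂_j w_j. Hence ∫ |∇w|² = 2 ∫
|ε(w)|² - ∫ (div w)², and the constant is 2 on any domain.

Approximation (`exists_conforming`). At an interior vertex p of the submesh, w(p) is the value at p
of Π^K for one cell around p; at a boundary vertex it is 0. Across an interface σ the two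
reconstructions are close to the same values v_s at the nodes of σ; since σ lies in the convex hull
of its nodes, their affine difference is small on all of σ. On a boundary face v_s = 0 and Π^K
itself is small. Chaining through adjacent simplices around p (`norm_sub_le_of_chain`) compares any
two cells at p, or any cell with 0 if p is on the boundary.

Such chains exist because a generic segment avoids all carriers of codimension two and so crosses
only open facets (`mem_of_adjacent_closed`). Shape regularity bounds their length by a packing
argument, and makes neighbours comparable in size since they share an edge.

An inverse estimate (`volume_mul_sum_interpDeriv_sq_le`) turns the nodal bounds into ‖∇w - ∇^D v‖² ≤
C S_D(v, v), and triangle inequalities conclude. The constant depends on d and ρ only. -/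

namespace DDR

/-! ### Barycentric coordinates of a simplex -/

section Bary

variable {d : ℕ}

/-- The affine basis of `ℝ^d` given by the vertices of a simplex. -/
noncomputable def IsSimplexVertexSet.affineBasis {τ : Finset (Pt d)} (h : IsSimplexVertexSet τ) :
    AffineBasis {p // p ∈ τ} ℝ (Pt d) where
  toFun p := p
  ind' := h.2
  tot' := by
    rw [h.2.affineSpan_eq_top_iff_card_eq_finrank_add_one]
    simp [h.1]

open Classical in
/-- The barycentric coordinate of the simplex `τ` at its vertex `p`. -/
noncomputable def bary (τ : Finset (Pt d)) (p : Pt d) : Pt d →ᵃ[ℝ] ℝ :=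
  if h : IsSimplexVertexSet τ ∧ p ∈ τ then h.1.affineBasis.coord ⟨p, h.2⟩ else 0

lemma bary_of_notMem {τ : Finset (Pt d)} {p : Pt d} (hp : p ∉ τ) : bary τ p = 0 := by
  simp [bary, hp]

lemma bary_eq_coord {τ : Finset (Pt d)} (h : IsSimplexVertexSet τ) (p : {p // p ∈ τ}) :
    bary τ p = h.affineBasis.coord p := by
  simp [bary, h]

lemma continuous_bary (τ : Finset (Pt d)) (p : Pt d) : Continuous (bary τ p) :=
  AffineMap.continuous_of_finiteDimensional _

variable {τ : Finset (Pt d)} (h : IsSimplexVertexSet τ)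
include h

lemma bary_self {p : Pt d} (hp : p ∈ τ) : bary τ p p = 1 := by
  rw [bary_eq_coord h ⟨p, hp⟩]; exact h.affineBasis.coord_apply_eq ⟨p, hp⟩

lemma bary_ne {p q : Pt d} (hq : q ∈ τ) (hpq : p ≠ q) : bary τ p q = 0 := by
  by_cases hp : p ∈ τ
  · rw [bary_eq_coord h ⟨p, hp⟩]
    exact h.affineBasis.coord_apply_ne (i := ⟨p, hp⟩) (j := ⟨q, hq⟩) (by simpa using hpq)
  · simp [bary_of_notMem hp]

lemma sum_bary (x : Pt d) : ∑ p ∈ τ, bary τ p x = 1 := by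
  rw [← Finset.sum_coe_sort, ← h.affineBasis.sum_coord_apply_eq_one x]
  exact Finset.sum_congr rfl fun p _ => by rw [bary_eq_coord h]

lemma sum_bary_smul (x : Pt d) : ∑ p ∈ τ, bary τ p x • p = x := by
  rw [← Finset.sum_coe_sort τ (fun p => bary τ p x • p)]
  conv_rhs => rw [← h.affineBasis.linear_combination_coord_eq_self x]
  exact Finset.sum_congr rfl fun p _ => by rw [bary_eq_coord h]; rfl

lemma sum_bary_linear (u : Pt d) : ∑ p ∈ τ, (bary τ p).linear u = 0 := by
  have h0 := sum_bary h 0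
  have h1 := sum_bary h u
  rw [← sub_eq_zero.2 (h1.trans h0.symm), ← Finset.sum_sub_distrib]
  refine Finset.sum_congr rfl fun p _ => ?_
  rw [← vsub_eq_sub, ← AffineMap.linearMap_vsub]; simp

lemma sum_bary_linear_smul (u : Pt d) : ∑ p ∈ τ, (bary τ p).linear u • p = u := by
  have h0 := sum_bary_smul h 0
  have h1 := sum_bary_smul h u
  calc ∑ p ∈ τ, (bary τ p).linear u • p
      = ∑ p ∈ τ, bary τ p u • p - ∑ p ∈ τ, bary τ p 0 • p := by
        rw [← Finset.sum_sub_distrib]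
        refine Finset.sum_congr rfl fun p _ => ?_
        rw [← sub_smul, ← vsub_eq_sub (bary τ p u), ← AffineMap.linearMap_vsub]; simp
    _ = u := by rw [h0, h1, sub_zero]

lemma range_affineBasis : Set.range h.affineBasis = (τ : Set (Pt d)) := by
  ext x
  constructor
  · rintro ⟨p, rfl⟩; exact p.2
  · intro hx; exact ⟨⟨x, hx⟩, rfl⟩

lemma mem_closedSimplex_iff {x : Pt d} : x ∈ closedSimplex τ ↔ ∀ p ∈ τ, 0 ≤ bary τ p x := by
  rw [closedSimplex, ← range_affineBasis h, h.affineBasis.convexHull_eq_nonneg_coord]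
  constructor
  · intro hx p hp
    rw [bary_eq_coord h ⟨p, hp⟩]; exact hx _
  · intro hx p
    rw [← bary_eq_coord h]; exact hx _ p.2

lemma mem_openSimplex_iff {x : Pt d} : x ∈ openSimplex τ ↔ ∀ p ∈ τ, 0 < bary τ p x := by
  rw [openSimplex, closedSimplex, ← range_affineBasis h, h.affineBasis.interior_convexHull]
  constructor
  · intro hx p hp
    rw [bary_eq_coord h ⟨p, hp⟩]; exact hx _
  · intro hx p
    rw [← bary_eq_coord h]; exact hx _ p.2

lemma bary_nonneg {x : Pt d} (hx : x ∈ closedSimplex τ) (p : Pt d) : 0 ≤ bary τ p x := by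
  by_cases hp : p ∈ τ
  · exact (mem_closedSimplex_iff h).1 hx p hp
  · simp [bary_of_notMem hp]

lemma bary_le_one {x : Pt d} (hx : x ∈ closedSimplex τ) (p : Pt d) : bary τ p x ≤ 1 := by
  by_cases hp : p ∈ τ
  · rw [← sum_bary h x]
    exact Finset.single_le_sum (f := fun p => bary τ p x) (fun q _ => bary_nonneg h hx q) hp
  · simp [bary_of_notMem hp]

omit h in
lemma isClosed_closedSimplex (τ : Finset (Pt d)) : IsClosed (closedSimplex τ) :=
  (τ.finite_toSet.isCompact_convexHull (𝕜 := ℝ)).isClosed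

omit h in
lemma isCompact_closedSimplex (τ : Finset (Pt d)) : IsCompact (closedSimplex τ) :=
  τ.finite_toSet.isCompact_convexHull (𝕜 := ℝ)

omit h in
lemma convex_closedSimplex (τ : Finset (Pt d)) : Convex ℝ (closedSimplex τ) :=
  convex_convexHull ℝ _

omit h in
lemma mem_closedSimplex_of_mem {τ : Finset (Pt d)} {p : Pt d} (hp : p ∈ τ) :
    p ∈ closedSimplex τ := subset_convexHull ℝ _ hp

omit h in
lemma openSimplex_subset (τ : Finset (Pt d)) : openSimplex τ ⊆ closedSimplex τ := interior_subset

/-- A face of a simplex is the set of its points whose other barycentric coordinates vanish. -/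
lemma mem_convexHull_of_bary {S : Set (Pt d)} {x : Pt d} (hx : x ∈ closedSimplex τ)
    (h0 : ∀ p ∈ τ, p ∉ S → bary τ p x = 0) : x ∈ convexHull ℝ S := by
  classical
  have hs : ∑ p ∈ τ.filter (· ∈ S), bary τ p x = 1 := by
    rw [← sum_bary h x, Finset.sum_filter]
    refine Finset.sum_congr rfl fun p hp => ?_
    split_ifs with hS
    · rfl
    · exact (h0 p hp hS).symm
  have hs' : ∑ p ∈ τ.filter (· ∈ S), bary τ p x • p = x := by
    conv_rhs => rw [← sum_bary_smul h x]
    rw [Finset.sum_filter]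
    refine Finset.sum_congr rfl fun p hp => ?_
    split_ifs with hS
    · rfl
    · simp [h0 p hp hS]
  rw [← hs']
  refine (convex_convexHull ℝ S).sum_mem (fun p _ => bary_nonneg h hx p) hs fun p hp => ?_
  exact subset_convexHull ℝ _ (Finset.mem_filter.1 hp).2

/-- A barycentric coordinate vanishes on the convex hull of other vertices. -/
lemma bary_eq_zero_of_mem_affineSpan {S : Set (Pt d)} (hS : S ⊆ τ) {p : Pt d} (hp : p ∉ S)
    {x : Pt d} (hx : x ∈ affineSpan ℝ S) : bary τ p x = 0 := by
  have : Set.EqOn (bary τ p) (0 : Pt d →ᵃ[ℝ] ℝ) S := fun q hq =>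
    bary_ne h (hS hq) (fun e => hp (e ▸ hq))
  exact AffineMap.eqOn_affineSpan this hx

/-- An affine function is determined by its values at the vertices of a simplex. -/
lemma affineMap_eq_sum {E : Type*} [AddCommGroup E] [Module ℝ E] (f : Pt d →ᵃ[ℝ] E) (x : Pt d) :
    f x = ∑ p ∈ τ, bary τ p x • f p := by
  have hf : ∀ y, f y = f.linear y + f 0 := fun y => by
    simpa using f.map_vadd 0 y
  calc f x = f.linear (∑ p ∈ τ, bary τ p x • p) + (∑ p ∈ τ, bary τ p x) • f 0 := by
        rw [sum_bary_smul h, sum_bary h, one_smul, hf]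
    _ = _ := by
        rw [map_sum, Finset.sum_smul, ← Finset.sum_add_distrib]
        refine Finset.sum_congr rfl fun p _ => ?_
        rw [hf p, smul_add, map_smul]

omit h in
lemma affineMap_add_sub (f : Pt d →ᵃ[ℝ] ℝ) (a x y : Pt d) :
    f (a + (y - x)) = f a + (f y - f x) := by
  have h1 : f (a + (y - x)) = f.linear (y - x) + f a := by
    simpa [add_comm] using f.map_vadd a (y - x)
  have h2 := f.linearMap_vsub y x
  simp only [vsub_eq_sub] at h2
  rw [h1, h2]; ring

omit h in
lemma affineMap_add_smul (f : Pt d →ᵃ[ℝ] ℝ) (a u : Pt d) (t : ℝ) :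
    f (a + t • u) = f a + t * f.linear u := by
  simpa [add_comm] using f.map_vadd a (t • u)

omit h in
lemma affineMap_lineMap (f : Pt d →ᵃ[ℝ] ℝ) (a b : Pt d) (t : ℝ) :
    f (AffineMap.lineMap a b t) = (1 - t) * f a + t * f b := by
  rw [AffineMap.apply_lineMap, AffineMap.lineMap_apply]; simp; ring

/-- Near a point of a simplex, only the coordinates vanishing at that point matter. -/
lemma eventually_mem_closedSimplex {x : Pt d} (hx : x ∈ closedSimplex τ) :
    ∀ᶠ y in 𝓝 x, (∀ p ∈ τ, bary τ p x = 0 → 0 ≤ bary τ p y) → y ∈ closedSimplex τ := by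
  have : ∀ᶠ y in 𝓝 x, ∀ p ∈ τ, bary τ p x ≠ 0 → 0 < bary τ p y := by
    rw [Filter.eventually_all_finset]
    intro p hp
    by_cases h0 : bary τ p x = 0
    · simp [h0]
    · filter_upwards [(continuous_bary τ p).continuousAt.eventually_const_lt
        (lt_of_le_of_ne (bary_nonneg h hx p) (Ne.symm h0))] with y hy _ using hy
  filter_upwards [this] with y hy h0
  rw [mem_closedSimplex_iff h]
  intro p hp
  by_cases hxp : bary τ p x = 0
  · exact h0 p hp hxp
  · exact (hy p hp hxp).le

/-- Moving from a point of a simplex towards an interior point enters the interior. -/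
lemma lineMap_mem_openSimplex {x z : Pt d} (hx : x ∈ closedSimplex τ) (hz : z ∈ openSimplex τ)
    {t : ℝ} (ht : t ∈ Set.Ioc (0 : ℝ) 1) : AffineMap.lineMap x z t ∈ openSimplex τ := by
  rw [mem_openSimplex_iff h] at hz ⊢
  intro p hp
  rw [affineMap_lineMap]
  have h1 := mul_nonneg (sub_nonneg.2 ht.2) (bary_nonneg h hx p)
  have h2 := mul_pos ht.1 (hz p hp)
  linarith

lemma openSimplex_nonempty : (openSimplex τ).Nonempty := by
  have h1 := h.affineBasis.centroid_mem_interior_convexHull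
  rw [range_affineBasis h] at h1
  exact ⟨_, h1⟩

lemma closure_openSimplex : closure (openSimplex τ) = closedSimplex τ := by
  rw [openSimplex, (convex_closedSimplex τ).closure_interior_eq_closure_of_nonempty_interior
    (openSimplex_nonempty h), (isClosed_closedSimplex τ).closure_eq]

end Bary

/-! ### Local structure of a matching simplicial mesh -/

section Mesh

variable {d : ℕ} {Ω : Set (Pt d)} {T : Finset (Finset (Pt d))}

lemma isClosed_iUnion_closedSimplex (T : Finset (Finset (Pt d))) :
    IsClosed (⋃ τ ∈ T, closedSimplex τ) :=
  T.finite_toSet.isClosed_biUnion fun τ _ => isClosed_closedSimplex τ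

lemma IsPolytope.isOpen (hΩ : IsPolytope Ω) : IsOpen Ω := by
  obtain ⟨-, S, -, rfl⟩ := hΩ
  exact isOpen_interior

lemma IsPolytope.interior_closure_subset (hΩ : IsPolytope Ω) : interior (closure Ω) ⊆ Ω := by
  obtain ⟨-, S, -, rfl⟩ := hΩ
  exact interior_mono ((isClosed_iUnion_closedSimplex S).closure_subset_iff.2 interior_subset)

lemma IsPolytope.isBounded (hΩ : IsPolytope Ω) : Bornology.IsBounded Ω := by
  obtain ⟨-, S, -, rfl⟩ := hΩ
  refine Bornology.IsBounded.subset ?_ interior_subset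
  exact (S.finite_toSet.isCompact_biUnion fun τ _ => isCompact_closedSimplex τ).isBounded

lemma tendsto_lineMap_nhdsWithin (x z : Pt d) (s : Set ℝ) :
    Filter.Tendsto (fun t : ℝ => AffineMap.lineMap x z t) (𝓝[s] 0) (𝓝 x) := by
  have : Continuous (fun t : ℝ => (AffineMap.lineMap x z t : Pt d)) :=
    AffineMap.lineMap_continuous
  have := (this.tendsto 0).mono_left (nhdsWithin_le_nhds (s := s))
  simpa using this

/-- The facet of `τ` opposite to `x₀` is shared with another simplex of the mesh. -/
def IsSharedFacet (T : Finset (Finset (Pt d))) (τ : Finset (Pt d)) (x₀ : Pt d) : Prop :=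
  ∃ τ' ∈ T, τ' ≠ τ ∧ ∀ p ∈ τ, p ≠ x₀ → p ∈ τ'

/-- The relative interior of the facet of `τ` opposite to `x₀`. -/
def openFacet (τ : Finset (Pt d)) (x₀ : Pt d) : Set (Pt d) :=
  {y | bary τ x₀ y = 0 ∧ ∀ p ∈ τ, p ≠ x₀ → 0 < bary τ p y}

lemma eventually_mem_of_mem_closedSimplex (T : Finset (Finset (Pt d))) (x : Pt d) :
    ∀ᶠ y in 𝓝 x, ∀ τ ∈ T, y ∈ closedSimplex τ → x ∈ closedSimplex τ := by
  rw [Filter.eventually_all_finset]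
  intro τ _
  by_cases hx : x ∈ closedSimplex τ
  · simp [hx]
  · filter_upwards [(isClosed_closedSimplex τ).isOpen_compl.mem_nhds hx] with y hy h
    exact absurd h hy

lemma eq_of_subset_simplex {τ τ' : Finset (Pt d)} (h : IsSimplexVertexSet τ)
    (h' : IsSimplexVertexSet τ') (hs : ∀ p ∈ τ, p ∈ τ') : τ' = τ :=
  (Finset.eq_of_subset_of_card_le hs (by rw [h.1, h'.1])).symm

namespace IsMatchingSimplicialMesh

variable (hT : IsMatchingSimplicialMesh Ω T)
include hT

lemma exists_mem {x : Pt d} (hx : x ∈ closure Ω) : ∃ τ ∈ T, x ∈ closedSimplex τ := by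
  rw [hT.cover] at hx; simpa using hx

lemma closedSimplex_subset {τ : Finset (Pt d)} (hτ : τ ∈ T) : closedSimplex τ ⊆ closure Ω := by
  rw [hT.cover]; exact Set.subset_biUnion_of_mem (u := fun τ => closedSimplex τ) hτ

/-- Both coordinates are affine and agree at the common vertices, hence on their hull, which by
matching is the whole intersection. As `bary` is zero off the vertices, no condition on `p` is
needed, and the carrier of a point does not depend on the simplex. -/
lemma bary_eq {τ τ' : Finset (Pt d)} (hτ : τ ∈ T) (hτ' : τ' ∈ T) {x : Pt d}
    (hx : x ∈ closedSimplex τ) (hx' : x ∈ closedSimplex τ') (p : Pt d) :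
    bary τ p x = bary τ' p x := by
  have hm : x ∈ convexHull ℝ ((τ : Set (Pt d)) ∩ (τ' : Set (Pt d))) := by
    rw [← hT.inter τ hτ τ' hτ']; exact ⟨hx, hx'⟩
  have : Set.EqOn (bary τ p) (bary τ' p) ((τ : Set (Pt d)) ∩ (τ' : Set (Pt d))) := by
    intro q hq
    by_cases hpq : p = q
    · subst hpq
      rw [bary_self (hT.isSimplex τ hτ) hq.1, bary_self (hT.isSimplex τ' hτ') hq.2]
    · rw [bary_ne (hT.isSimplex τ hτ) hq.1 hpq, bary_ne (hT.isSimplex τ' hτ') hq.2 hpq]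
  exact AffineMap.eqOn_affineSpan this (convexHull_subset_affineSpan _ hm)

lemma mem_of_bary_ne_zero {τ τ' : Finset (Pt d)} (hτ : τ ∈ T) (hτ' : τ' ∈ T) {x : Pt d}
    (hx : x ∈ closedSimplex τ) (hx' : x ∈ closedSimplex τ') {p : Pt d} (hp : bary τ p x ≠ 0) :
    p ∈ τ' := by
  by_contra h
  rw [hT.bary_eq hτ hτ' hx hx', bary_of_notMem h] at hp
  exact hp rfl

lemma eq_of_mem_openSimplex {τ τ' : Finset (Pt d)} (hτ : τ ∈ T) (hτ' : τ' ∈ T) {x : Pt d}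
    (hx : x ∈ openSimplex τ) (hx' : x ∈ closedSimplex τ') : τ' = τ := by
  refine eq_of_subset_simplex (hT.isSimplex τ hτ) (hT.isSimplex τ' hτ') fun p hp => ?_
  exact hT.mem_of_bary_ne_zero hτ hτ' (openSimplex_subset _ hx) hx'
    ((mem_openSimplex_iff (hT.isSimplex τ hτ)).1 hx p hp).ne'

lemma openSimplex_subset_of_isPolytope (hΩ : IsPolytope Ω) {τ : Finset (Pt d)} (hτ : τ ∈ T) :
    openSimplex τ ⊆ Ω :=
  (interior_mono (hT.closedSimplex_subset hτ)).trans hΩ.interior_closure_subset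

lemma mem_of_eventually (hΩ : IsPolytope Ω) {x : Pt d}
    (h : ∀ᶠ y in 𝓝 x, ∃ τ ∈ T, y ∈ closedSimplex τ) : x ∈ Ω := by
  apply hΩ.interior_closure_subset
  rw [mem_interior_iff_mem_nhds]
  filter_upwards [h] with y hy
  obtain ⟨τ, hτ, hy⟩ := hy
  exact hT.closedSimplex_subset hτ hy

/-- If a point of a simplex lies in `Ω`, so do all the points of the simplex whose carrier
contains that of the given point. -/
lemma mem_of_carrier (hΩ : IsPolytope Ω) {τ : Finset (Pt d)} (hτ : τ ∈ T) {x z : Pt d}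
    (hz : z ∈ Ω) (hzτ : z ∈ closedSimplex τ) (hx : x ∈ closedSimplex τ)
    (hs : ∀ p ∈ τ, bary τ p x = 0 → bary τ p z = 0) : x ∈ Ω := by
  have hsim := hT.isSimplex τ hτ
  -- Slide `z` slightly towards `x`: the new point stays in the open set `Ω` and has exactly the
  -- carrier of `x`, so every simplex containing it also contains `x`.
  obtain ⟨z', hz', hz'τ, hc⟩ : ∃ z' ∈ Ω, z' ∈ closedSimplex τ ∧
      ∀ p, bary τ p z' = 0 ↔ bary τ p x = 0 := by
    have hc := tendsto_lineMap_nhdsWithin z x (Set.Ioi 0)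
    obtain ⟨t, ht, ht1⟩ := ((hc.eventually_mem (hΩ.isOpen.mem_nhds hz)).and
      (Ioo_mem_nhdsGT (zero_lt_one (α := ℝ)))).exists
    refine ⟨_, ht, (convex_closedSimplex τ).segment_subset hzτ hx ?_, fun p => ?_⟩
    · rw [segment_eq_image_lineMap]
      exact ⟨t, ⟨ht1.1.le, ht1.2.le⟩, rfl⟩
    · rw [affineMap_lineMap]
      have h1 := bary_nonneg hsim hzτ p
      have h2 := bary_nonneg hsim hx p
      have h3 : 0 < 1 - t := by linarith [ht1.2]
      constructor
      · intro h
        have h4 := mul_nonneg h3.le h1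
        have h5 := mul_nonneg ht1.1.le h2
        have h6 : t * bary τ p x = 0 := by linarith
        exact (mul_eq_zero.1 h6).resolve_left ht1.1.ne'
      · intro h
        by_cases hp : p ∈ τ
        · rw [h, hs p hp h]; simp
        · simp [bary_of_notMem hp]
  have hev : ∀ᶠ y in 𝓝 x, z' + (y - x) ∈ Ω ∧
      ∀ τ ∈ T, z' + (y - x) ∈ closedSimplex τ → z' ∈ closedSimplex τ := by
    have hc : Filter.Tendsto (fun y => z' + (y - x)) (𝓝 x) (𝓝 z') := by
      have : Continuous fun y => z' + (y - x) := by fun_prop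
      simpa using this.tendsto x
    exact (hc.eventually_mem (hΩ.isOpen.mem_nhds hz')).and
      (hc.eventually (eventually_mem_of_mem_closedSimplex T z'))
  have hmem : ∀ τ' ∈ T, z' ∈ closedSimplex τ' → x ∈ closedSimplex τ' := by
    intro τ' hτ' hz1
    refine mem_convexHull_of_bary hsim hx fun p hp hpτ' => ?_
    by_contra h0
    exact hpτ' (hT.mem_of_bary_ne_zero hτ hτ' hz'τ hz1 (fun h => h0 ((hc p).1 h)))
  have hev2 : ∀ᶠ y in 𝓝 x, ∀ τ' ∈ T, x ∈ closedSimplex τ' →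
      (∀ p ∈ τ', bary τ' p x = 0 → 0 ≤ bary τ' p y) → y ∈ closedSimplex τ' := by
    rw [Filter.eventually_all_finset]
    intro τ' hτ'
    by_cases hx' : x ∈ closedSimplex τ'
    · filter_upwards [eventually_mem_closedSimplex (hT.isSimplex τ' hτ') hx'] with y hy _ using hy
    · simp [hx']
  refine hT.mem_of_eventually hΩ ?_
  filter_upwards [hev, hev2] with y hy hy2
  -- A simplex containing the translate `z' + (y - x)` contains `y` as well: the coordinates
  -- vanishing at `x` vanish at `z'`, hence take equal values at `y` and at the translate.
  obtain ⟨τ', hτ', hy'⟩ := hT.exists_mem (subset_closure hy.1)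
  have hz1 := hy.2 τ' hτ' hy'
  have hx1 := hmem τ' hτ' hz1
  refine ⟨τ', hτ', hy2 τ' hτ' hx1 fun p hp h0 => ?_⟩
  have h1 := bary_nonneg (hT.isSimplex τ' hτ') hy' p
  rw [affineMap_add_sub, h0] at h1
  rw [← hT.bary_eq hτ hτ' hx hx1 p, ← hc, hT.bary_eq hτ hτ' hz'τ hz1 p] at h0
  linarith

omit hT in
lemma openFacet_subset_closedSimplex {τ : Finset (Pt d)} (h : IsSimplexVertexSet τ) {x₀ : Pt d} :
    openFacet τ x₀ ⊆ closedSimplex τ := by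
  intro y hy
  rw [mem_closedSimplex_iff h]
  intro p hp
  by_cases hpx : p = x₀
  · rw [hpx, hy.1]
  · exact (hy.2 p hp hpx).le

omit hT in
/-- Two distinct simplices sharing the facet opposite to `x₀`: the opposite vertex on the other
side. -/
lemma exists_opposite_vertex {τ τ' : Finset (Pt d)} (h : IsSimplexVertexSet τ)
    (h' : IsSimplexVertexSet τ') (hne : τ' ≠ τ) {x₀ : Pt d} (hx₀ : x₀ ∈ τ)
    (hsub : ∀ p ∈ τ, p ≠ x₀ → p ∈ τ') :
    x₀ ∉ τ' ∧ ∃ x₁ ∈ τ', x₁ ∉ τ ∧ ∀ p ∈ τ', p ≠ x₁ → p ∈ τ ∧ p ≠ x₀ := by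
  classical
  have hx0 : x₀ ∉ τ' := by
    intro hx
    refine hne (eq_of_subset_simplex h h' fun p hp => ?_)
    by_cases hpx : p = x₀
    · rwa [hpx]
    · exact hsub p hp hpx
  obtain ⟨x₁, hx₁⟩ : ∃ x₁, τ' \ τ.erase x₀ = {x₁} := by
    rw [← Finset.card_eq_one, Finset.card_sdiff_of_subset, Finset.card_erase_of_mem hx₀, h.1, h'.1]
    · simp
    · intro p hp
      exact hsub p (Finset.mem_of_mem_erase hp) (Finset.ne_of_mem_erase hp)
  have hmem : x₁ ∈ τ' \ τ.erase x₀ := by rw [hx₁]; simp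
  rw [Finset.mem_sdiff] at hmem
  refine ⟨hx0, x₁, hmem.1, fun hx => hmem.2 (Finset.mem_erase.2 ⟨?_, hx⟩), ?_⟩
  · rintro rfl
    exact hx0 hmem.1
  · intro p hp hpx
    have : p ∉ τ' \ τ.erase x₀ := by rw [hx₁]; simpa using hpx
    simp only [Finset.mem_sdiff, hp, true_and, not_not, Finset.mem_erase] at this
    exact ⟨this.2, this.1⟩

lemma mem_closedSimplex_of_facet {τ τ' : Finset (Pt d)} (hτ : τ ∈ T) {x₀ : Pt d}
    (hsub : ∀ p ∈ τ, p ≠ x₀ → p ∈ τ') {y : Pt d} (hy : y ∈ closedSimplex τ)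
    (hy0 : bary τ x₀ y = 0) : y ∈ closedSimplex τ' := by
  refine mem_convexHull_of_bary (hT.isSimplex τ hτ) hy fun p hp hp' => ?_
  by_cases hpx : p = x₀
  · rw [hpx, hy0]
  · exact absurd (hsub p hp hpx) hp'

/-- The coordinate of `τ'` at its extra vertex `x₁` is a multiple of that of `τ` at `x₀`. The factor
is negative: otherwise points slightly off the facet towards `x₀` would lie in both simplices,
although `x₀` is not a vertex of `τ'`. So the two simplices fill both sides of the facet. -/
lemma openFacet_subset_of_isSharedFacet (hΩ : IsPolytope Ω) {τ : Finset (Pt d)} (hτ : τ ∈ T)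
    {x₀ : Pt d} (hx₀ : x₀ ∈ τ) (hs : IsSharedFacet T τ x₀) : openFacet τ x₀ ⊆ Ω := by
  intro y hy
  obtain ⟨τ', hτ', hne, hsub⟩ := hs
  have h := hT.isSimplex τ hτ
  have h' := hT.isSimplex τ' hτ'
  obtain ⟨hx0, x₁, hx₁τ', hx₁τ, hother⟩ := exists_opposite_vertex h h' hne hx₀ hsub
  have hyτ := openFacet_subset_closedSimplex h hy
  have hyτ' : y ∈ closedSimplex τ' := hT.mem_closedSimplex_of_facet hτ hsub hyτ hy.1
  have hlin : ∀ z, bary τ' x₁ z = bary τ x₀ z * bary τ' x₁ x₀ := by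
    intro z
    rw [affineMap_eq_sum h (bary τ' x₁) z, Finset.sum_eq_single x₀]
    · rfl
    · intro p hp hpx
      rw [bary_ne h' (hsub p hp hpx), smul_zero]
      rintro rfl
      exact hx₁τ hp
    · exact fun hn => absurd hx₀ hn
  have hpos : ∀ p ∈ τ', bary τ' p y = 0 → p = x₁ := by
    intro p hp h0
    by_contra hpx
    obtain ⟨hpτ, hpx0⟩ := hother p hp hpx
    rw [← hT.bary_eq hτ hτ' hyτ hyτ'] at h0
    exact (hy.2 p hpτ hpx0).ne' h0
  have hpos' : ∀ p ∈ τ, bary τ p y = 0 → p = x₀ := by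
    intro p hp h0
    by_contra hpx
    exact (hy.2 p hp hpx).ne' h0
  have hneg : bary τ' x₁ x₀ < 0 := by
    by_contra! hc
    have hcont := tendsto_lineMap_nhdsWithin y x₀ (Set.Ioi 0)
    obtain ⟨t, ⟨ht1, ht2⟩, ht0⟩ := ((hcont.eventually ((eventually_mem_closedSimplex h hyτ).and
      (eventually_mem_closedSimplex h' hyτ'))).and self_mem_nhdsWithin).exists
    have hb : bary τ x₀ (AffineMap.lineMap y x₀ t) = t := by
      rw [affineMap_lineMap, hy.1, bary_self h hx₀]; ring
    have ht0' : 0 < t := ht0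
    have hm1 := ht1 fun p hp h0 => by rw [hpos' p hp h0, hb]; exact ht0'.le
    have hm2 := ht2 fun p hp h0 => by
      rw [hpos p hp h0, hlin, hb]; exact mul_nonneg ht0'.le hc
    rw [hT.bary_eq hτ hτ' hm1 hm2, bary_of_notMem hx0] at hb
    exact ht0'.ne hb
  refine hT.mem_of_eventually hΩ ?_
  filter_upwards [eventually_mem_closedSimplex h hyτ, eventually_mem_closedSimplex h' hyτ']
    with z hz hz'
  rcases le_total 0 (bary τ x₀ z) with hb | hb
  · exact ⟨τ, hτ, hz fun p hp h0 => by rwa [hpos' p hp h0]⟩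
  · refine ⟨τ', hτ', hz' fun p hp h0 => ?_⟩
    rw [hpos p hp h0, hlin]
    exact mul_nonneg_of_nonpos_of_nonpos hb hneg.le

/-- A facet is shared as soon as the closure of the domain is met on its other side. -/
lemma isSharedFacet_of_frequently {τ : Finset (Pt d)} (hτ : τ ∈ T)
    {x₀ y : Pt d} (hy : y ∈ openFacet τ x₀)
    (hf : ∃ᶠ z in 𝓝 y, z ∈ closure Ω ∧ bary τ x₀ z < 0) : IsSharedFacet T τ x₀ := by
  obtain ⟨z, ⟨hz, hneg⟩, hz2⟩ := (hf.and_eventually (eventually_mem_of_mem_closedSimplex T y)).exists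
  obtain ⟨τ', hτ', hzτ'⟩ := hT.exists_mem hz
  refine ⟨τ', hτ', ?_, fun p hp hpx => ?_⟩
  · rintro rfl
    exact absurd (bary_nonneg (hT.isSimplex τ' hτ') hzτ' x₀) (not_le.2 hneg)
  · exact hT.mem_of_bary_ne_zero hτ hτ' (openFacet_subset_closedSimplex (hT.isSimplex τ hτ) hy)
      (hz2 τ' hτ' hzτ') (hy.2 p hp hpx).ne'

/-- If such a point were in the open set `Ω`, prolonging the segment from `x₀` slightly beyond it
would stay in `Ω` on the other side of the facet, which forces a neighbour. -/
lemma notMem_of_not_isSharedFacet (hΩ : IsPolytope Ω) {τ : Finset (Pt d)} (hτ : τ ∈ T)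
    {x₀ y : Pt d} (hx₀ : x₀ ∈ τ) (hy : y ∈ openFacet τ x₀) (hs : ¬ IsSharedFacet T τ x₀) :
    y ∉ Ω := by
  intro hyΩ
  refine hs (hT.isSharedFacet_of_frequently hτ hy ?_)
  have hcont := tendsto_lineMap_nhdsWithin y x₀ (Set.Iio 0)
  refine hcont.frequently (Filter.Eventually.frequently ?_)
  filter_upwards [hcont.eventually_mem (hΩ.isOpen.mem_nhds hyΩ), self_mem_nhdsWithin] with t ht ht0
  refine ⟨subset_closure ht, ?_⟩
  rw [affineMap_lineMap, hy.1, bary_self (hT.isSimplex τ hτ) hx₀]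
  simpa using ht0

end IsMatchingSimplicialMesh

end Mesh

/-! ### Facet-connectedness of the simplices around a point -/

section Connectivity

variable {d : ℕ} {Ω : Set (Pt d)} {T : Finset (Finset (Pt d))}

lemma volume_affineSpan_eq_zero {S : Finset (Pt d)} (hS : S.card ≤ d) :
    volume (affineSpan ℝ (S : Set (Pt d)) : Set (Pt d)) = 0 := by
  classical
  refine Measure.addHaar_affineSubspace _ _ fun htop => ?_
  rcases S.eq_empty_or_nonempty with rfl | hne
  · simp only [Finset.coe_empty, AffineSubspace.span_empty] at htop
    exact absurd htop (AffineSubspace.bot_ne_top ℝ (Pt d) (Pt d))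
  · obtain ⟨n, hn⟩ : ∃ n, S.card = n + 1 := ⟨S.card - 1, by have := hne.card_pos; omega⟩
    have h1 := finrank_vectorSpan_image_finset_le ℝ (id : Pt d → Pt d) S hn
    rw [Finset.image_id, ← direction_affineSpan, htop, AffineSubspace.direction_top, finrank_top,
      finrank_euclideanSpace_fin] at h1
    omega

/-- An open nonempty set is not covered by finitely many affine subspaces spanned by at most `d`
points. -/
lemma exists_mem_notMem_affineSpan {O : Set (Pt d)} (hO : IsOpen O) (hne : O.Nonempty)
    (𝒮 : Finset (Finset (Pt d))) (h𝒮 : ∀ S ∈ 𝒮, S.card ≤ d) :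
    ∃ q ∈ O, ∀ S ∈ 𝒮, q ∉ affineSpan ℝ (S : Set (Pt d)) := by
  by_contra! hc
  have hsub : O ⊆ ⋃ S ∈ 𝒮, (affineSpan ℝ (S : Set (Pt d)) : Set (Pt d)) := by
    intro q hq
    obtain ⟨S, hS, hm⟩ := hc q hq
    exact Set.mem_biUnion hS hm
  have h0 : volume (⋃ S ∈ 𝒮, (affineSpan ℝ (S : Set (Pt d)) : Set (Pt d))) = 0 :=
    (measure_biUnion_null_iff 𝒮.countable_toSet).2 fun S hS =>
      volume_affineSpan_eq_zero (h𝒮 S hS)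
  exact (hO.measure_pos volume hne).ne' (measure_mono_null hsub h0)

/-- Around a point, a nonempty family of simplices which is closed under adjacency through the
facets containing that point, and has no boundary facet there, fills a neighbourhood. -/
lemma IsMatchingSimplicialMesh.eventually_mem_of_adjacent_closed
    (hT : IsMatchingSimplicialMesh Ω T) (hΩ : IsPolytope Ω) {x : Pt d}
    {𝒰 : Finset (Finset (Pt d))} (h𝒰 : 𝒰 ⊆ T) (hne : 𝒰.Nonempty)
    (hx : ∀ τ ∈ 𝒰, x ∈ closedSimplex τ)
    (hadj : ∀ τ ∈ 𝒰, ∀ x₀ ∈ τ, bary τ x₀ x = 0 → IsSharedFacet T τ x₀ ∧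
      ∀ τ' ∈ T, (∀ p ∈ τ, p ≠ x₀ → p ∈ τ') → τ' ∈ 𝒰) :
    ∀ᶠ y in 𝓝 x, ∃ τ ∈ 𝒰, y ∈ closedSimplex τ := by
  classical
  by_contra hcon
  have hev : ∀ᶠ y in 𝓝 x, (∀ τ ∈ T, y ∈ closedSimplex τ → x ∈ closedSimplex τ) ∧
      ∀ τ ∈ T, ∀ p ∈ τ, bary τ p x ≠ 0 → bary τ p y ≠ 0 := by
    refine (eventually_mem_of_mem_closedSimplex T x).and ?_
    rw [Filter.eventually_all_finset]
    intro τ _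
    rw [Filter.eventually_all_finset]
    intro p _
    by_cases h0 : bary τ p x = 0
    · simp [h0]
    · filter_upwards [(continuous_bary τ p).continuousAt.eventually_ne h0] with y hy _ using hy
  obtain ⟨r, hr, hB⟩ := Metric.eventually_nhds_iff_ball.1 hev
  obtain ⟨q₀, hq₀U, hq₀B⟩ := ((Filter.not_eventually.1 hcon).and_eventually
    (Metric.ball_mem_nhds x hr)).exists
  set U : Set (Pt d) := ⋃ τ ∈ 𝒰, closedSimplex τ with hU
  have hUc : IsClosed U := isClosed_iUnion_closedSimplex 𝒰
  obtain ⟨τ₀, hτ₀⟩ := hne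
  have hs₀ := hT.isSimplex τ₀ (h𝒰 hτ₀)
  obtain ⟨p, hpo, hpB⟩ : ∃ p ∈ openSimplex τ₀, p ∈ Metric.ball x r := by
    obtain ⟨c, hc⟩ := openSimplex_nonempty hs₀
    obtain ⟨t, ht, ht1⟩ := (((tendsto_lineMap_nhdsWithin x c (Set.Ioi 0)).eventually_mem
      (Metric.ball_mem_nhds x hr)).and (Ioo_mem_nhdsGT (zero_lt_one (α := ℝ)))).exists
    exact ⟨_, lineMap_mem_openSimplex hs₀ (hx τ₀ hτ₀) hc ⟨ht1.1, ht1.2.le⟩, ht⟩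
  -- Carriers with at most `d - 1` vertices, joined to `p`: the spans of at most `d` points are null
  -- sets. A point `q` avoiding them all keeps the segment from `p` to `q` away from every carrier
  -- of codimension at least two.
  set 𝒮 : Finset (Finset (Pt d)) :=
    ((𝒰.biUnion Finset.powerset).filter fun S => S.card + 1 ≤ d).image (insert p) with h𝒮
  obtain ⟨q, ⟨hqB, hqU⟩, hq⟩ := exists_mem_notMem_affineSpan
    (O := Metric.ball x r \ U) (Metric.isOpen_ball.sdiff hUc)
    ⟨q₀, hq₀B, by simpa [hU] using hq₀U⟩ 𝒮 (by
      intro S hS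
      obtain ⟨S', hS', rfl⟩ := Finset.mem_image.1 hS
      exact (Finset.card_insert_le _ _).trans (Finset.mem_filter.1 hS').2)
  -- `U` and `V` are closed and cover the space, so the connected segment from `p ∈ U` to `q ∈ V`
  -- meets `U ∩ V`.
  set V : Set (Pt d) := (⋃ τ ∈ T \ 𝒰, closedSimplex τ) ∪ Ωᶜ with hV
  have hVc : IsClosed V :=
    (isClosed_iUnion_closedSimplex _).union hΩ.isOpen.isClosed_compl
  have hUV : ∀ y, y ∈ U ∪ V := by
    intro y
    by_cases hy : y ∈ Ω
    · obtain ⟨τ, hτ, hyτ⟩ := hT.exists_mem (subset_closure hy)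
      by_cases hτU : τ ∈ 𝒰
      · exact Or.inl (Set.mem_biUnion hτU hyτ)
      · exact Or.inr (Or.inl (Set.mem_biUnion (Finset.mem_sdiff.2 ⟨hτ, hτU⟩) hyτ))
    · exact Or.inr (Or.inr hy)
  have hpU : p ∈ U := Set.mem_biUnion hτ₀ (openSimplex_subset _ hpo)
  obtain ⟨y, hyseg, hyU, hyV⟩ := (isPreconnected_closed_iff.1 (convex_segment p q).isPreconnected)
    U V hUc hVc (fun y _ => hUV y) ⟨p, left_mem_segment ℝ p q, hpU⟩
    ⟨q, right_mem_segment ℝ p q, (hUV q).resolve_left hqU⟩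
  have hyB : y ∈ Metric.ball x r := (convex_ball x r).segment_subset hpB hqB hyseg
  obtain ⟨τ, hτ, hyτ⟩ : ∃ τ ∈ 𝒰, y ∈ closedSimplex τ := by simpa [hU] using hyU
  have hτT := h𝒰 hτ
  have hs := hT.isSimplex τ hτT
  set S := τ.filter fun p => bary τ p y ≠ 0 with hS
  have hyS : y ∈ convexHull ℝ (S : Set (Pt d)) := by
    refine mem_convexHull_of_bary hs hyτ fun p hp hpS => ?_
    by_contra h0
    exact hpS (Finset.mem_coe.2 (Finset.mem_filter.2 ⟨hp, h0⟩))
  have hyV' : ∀ τ' ∈ T, y ∈ closedSimplex τ' → S ⊆ τ' := by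
    intro τ' hτ' hy' p hp
    exact hT.mem_of_bary_ne_zero hτT hτ' hyτ hy' (Finset.mem_filter.1 hp).2
  have key : y ∈ Ω → ∃ τ' ∈ T, τ' ∉ 𝒰 ∧ S ⊆ τ' := by
    intro hyΩ
    rcases hyV with hyV | hyV
    · obtain ⟨τ', hτ', hy'⟩ : ∃ τ' ∈ T \ 𝒰, y ∈ closedSimplex τ' := by
        simpa only [Set.mem_iUnion, exists_prop] using hyV
      rw [Finset.mem_sdiff] at hτ'
      exact ⟨τ', hτ'.1, hτ'.2, hyV' τ' hτ'.1 hy'⟩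
    · exact absurd hyΩ hyV
  by_cases hcard : S.card + 1 ≤ d
  · have hmem : insert p S ∈ 𝒮 := by
      refine Finset.mem_image.2 ⟨S, Finset.mem_filter.2 ⟨?_, hcard⟩, rfl⟩
      exact Finset.mem_biUnion.2 ⟨τ, hτ, Finset.mem_powerset.2 (Finset.filter_subset _ _)⟩
    rw [segment_eq_image_lineMap] at hyseg
    obtain ⟨t, ht, rfl⟩ := hyseg
    have hp' : p ∈ affineSpan ℝ ((insert p S : Finset (Pt d)) : Set (Pt d)) :=
      subset_affineSpan ℝ _ (by simp)
    have hy' : AffineMap.lineMap p q t ∈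
        affineSpan ℝ ((insert p S : Finset (Pt d)) : Set (Pt d)) :=
      affineSpan_mono ℝ (by simp) (convexHull_subset_affineSpan _ hyS)
    -- For `t = 0` the point is `p`, interior to a simplex, and its carrier has `d + 1` vertices.
    -- Otherwise `q` lies on the line through `p` and `y`, inside an excluded span.
    rcases eq_or_ne t 0 with rfl | ht0
    · rw [AffineMap.lineMap_apply_zero] at hyτ
      have := hT.eq_of_mem_openSimplex (h𝒰 hτ₀) hτT hpo hyτ
      subst this
      have hSτ : S = τ := by
        refine Finset.filter_true_of_mem fun a ha => ?_
        rw [AffineMap.lineMap_apply_zero]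
        exact ((mem_openSimplex_iff hs).1 hpo a ha).ne'
      rw [hSτ, hs.1] at hcard
      omega
    · refine hq _ hmem ?_
      have : q = AffineMap.lineMap p (AffineMap.lineMap p q t : Pt d) t⁻¹ := by
        simp only [AffineMap.lineMap_apply, vsub_eq_sub, vadd_eq_add, add_sub_cancel_right,
          smul_smul, inv_mul_cancel₀ ht0, one_smul, sub_add_cancel]
      rw [this]
      exact AffineMap.lineMap_mem _ hp' hy'
  -- A carrier with `d + 1` vertices puts `y` in an open simplex; one with `d` vertices puts it in
  -- an open facet. In both cases `y ∈ Ω`, so `y` belongs to a simplex outside `𝒰` having these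
  -- vertices.
  · by_cases hSτ : S = τ
    · have hyo : y ∈ openSimplex τ := by
        rw [mem_openSimplex_iff hs]
        intro a ha
        rw [← hSτ] at ha
        exact lt_of_le_of_ne (bary_nonneg hs hyτ a) (Finset.mem_filter.1 ha).2.symm
      obtain ⟨τ', hτ', hn, hsub⟩ := key (hT.openSimplex_subset_of_isPolytope hΩ hτT hyo)
      rw [hSτ] at hsub
      exact hn (eq_of_subset_simplex hs (hT.isSimplex τ' hτ') hsub ▸ hτ)
    · have hsub : S ⊆ τ := Finset.filter_subset _ _
      have hlt := Finset.card_lt_card (Finset.ssubset_iff_subset_ne.2 ⟨hsub, hSτ⟩)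
      rw [hs.1] at hlt
      obtain ⟨x₀, hx₀⟩ : ∃ x₀, τ \ S = {x₀} := by
        rw [← Finset.card_eq_one, Finset.card_sdiff_of_subset hsub, hs.1]
        omega
      have hx₀' : x₀ ∈ τ \ S := by rw [hx₀]; simp
      rw [Finset.mem_sdiff] at hx₀'
      have hb0 : bary τ x₀ y = 0 := by
        by_contra h0
        exact hx₀'.2 (Finset.mem_filter.2 ⟨hx₀'.1, h0⟩)
      have hS2 : ∀ a ∈ τ, a ≠ x₀ → a ∈ S := by
        intro a ha hax
        by_contra haS
        have : a ∈ τ \ S := Finset.mem_sdiff.2 ⟨ha, haS⟩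
        rw [hx₀, Finset.mem_singleton] at this
        exact hax this
      have hyF : y ∈ openFacet τ x₀ := ⟨hb0, fun a ha hax =>
        lt_of_le_of_ne (bary_nonneg hs hyτ a) (Finset.mem_filter.1 (hS2 a ha hax)).2.symm⟩
      -- In the chosen ball no coordinate that is nonzero at `x` vanishes; hence the facet carrying
      -- `y` contains `x`, and closedness under adjacency applies to it.
      have hx0 : bary τ x₀ x = 0 := by
        by_contra h0
        exact (hB y hyB).2 τ hτT x₀ hx₀'.1 h0 hb0
      obtain ⟨hsh, hall⟩ := hadj τ hτ x₀ hx₀'.1 hx0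
      obtain ⟨τ', hτ', hn, hsub'⟩ :=
        key (hT.openFacet_subset_of_isSharedFacet hΩ hτT hx₀'.1 hsh hyF)
      exact hn (hall τ' hτ' fun a ha hax => hsub' (hS2 a ha hax))

/-- Around a point, a nonempty family of simplices which is closed under adjacency through the
facets containing that point, and has no boundary facet there, consists of all the simplices
containing the point, which is then interior to the domain. -/
lemma IsMatchingSimplicialMesh.mem_of_adjacent_closed
    (hT : IsMatchingSimplicialMesh Ω T) (hΩ : IsPolytope Ω) {x : Pt d}
    {𝒰 : Finset (Finset (Pt d))} (h𝒰 : 𝒰 ⊆ T) (hne : 𝒰.Nonempty)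
    (hx : ∀ τ ∈ 𝒰, x ∈ closedSimplex τ)
    (hadj : ∀ τ ∈ 𝒰, ∀ x₀ ∈ τ, bary τ x₀ x = 0 → IsSharedFacet T τ x₀ ∧
      ∀ τ' ∈ T, (∀ p ∈ τ, p ≠ x₀ → p ∈ τ') → τ' ∈ 𝒰) :
    x ∈ Ω ∧ ∀ τ ∈ T, x ∈ closedSimplex τ → τ ∈ 𝒰 := by
  have hev := hT.eventually_mem_of_adjacent_closed hΩ h𝒰 hne hx hadj
  refine ⟨hT.mem_of_eventually hΩ ?_, fun τ hτ hxτ => ?_⟩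
  · filter_upwards [hev] with y hy
    obtain ⟨τ, hτ, hy⟩ := hy
    exact ⟨τ, h𝒰 hτ, hy⟩
  -- Points of the open simplex close to `x` are covered by `𝒰`, and no other simplex contains them.
  · obtain ⟨c, hc⟩ := openSimplex_nonempty (hT.isSimplex τ hτ)
    obtain ⟨t, ⟨τ', hτ', ht⟩, ht1⟩ := (((tendsto_lineMap_nhdsWithin x c (Set.Ioi 0)).eventually
      hev).and (Ioo_mem_nhdsGT (zero_lt_one (α := ℝ)))).exists
    have := lineMap_mem_openSimplex (hT.isSimplex τ hτ) hxτ hc ⟨ht1.1, ht1.2.le⟩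
    exact hT.eq_of_mem_openSimplex hτ (h𝒰 hτ') this ht ▸ hτ'

end Connectivity

/-! ### Faces of the polytopal mesh and facets of the simplicial submesh -/

lemma exists_mem_frontier_of_isPreconnected {X : Type*} [TopologicalSpace X] {s A : Set X}
    (hs : IsPreconnected s) (hA : IsOpen A) (h1 : (s ∩ A).Nonempty) (h2 : (s ∩ Aᶜ).Nonempty) :
    (s ∩ frontier A).Nonempty := by
  by_contra hne
  have hsub : s ⊆ A ∪ (closure A)ᶜ := by
    intro x hx
    by_cases hxA : x ∈ A
    · exact Or.inl hxA
    · refine Or.inr fun hcl => hne ⟨x, hx, ?_⟩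
      rw [hA.frontier_eq]
      exact ⟨hcl, hxA⟩
  obtain ⟨x, hx, hxA⟩ := h2
  exact hxA (hs.subset_left_of_subset_union hA isClosed_closure.isOpen_compl
    (Set.disjoint_compl_right_iff_subset.2 subset_closure) hsub h1 hx)

/-! ### Open facets of a simplex and their normals -/

section Facet

variable {d : ℕ} {τ : Finset (Pt d)} (h : IsSimplexVertexSet τ)
include h

/-- Every point of an open simplex lies on a segment from a vertex to the opposite open facet. -/
lemma exists_mem_openFacet_lineMap (hd : 1 ≤ d) {x₀ z : Pt d} (hx₀ : x₀ ∈ τ)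
    (hz : z ∈ openSimplex τ) : ∃ y ∈ openFacet τ x₀, ∃ t : ℝ, z = AffineMap.lineMap x₀ y t := by
  rw [mem_openSimplex_iff h] at hz
  obtain ⟨p, hp, hpx⟩ : ∃ p ∈ τ, p ≠ x₀ :=
    Finset.exists_mem_ne (by rw [h.1]; omega) x₀
  have hlt : bary τ x₀ z < 1 := by
    rw [← sum_bary h z]
    exact Finset.single_lt_sum hpx hx₀ hp (hz p hp) fun q hq _ => (hz q hq).le
  have h1 : 0 < 1 - bary τ x₀ z := by linarith
  refine ⟨AffineMap.lineMap x₀ z (1 - bary τ x₀ z)⁻¹, ⟨?_, fun q hq hqx => ?_⟩,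
    1 - bary τ x₀ z, ?_⟩
  · rw [affineMap_lineMap, bary_self h hx₀]
    field_simp; ring
  · rw [affineMap_lineMap, bary_ne h hx₀ hqx]
    have := mul_pos (inv_pos.2 h1) (hz q hq)
    linarith
  · simp only [AffineMap.lineMap_apply, vsub_eq_sub, vadd_eq_add, add_sub_cancel_right,
      smul_smul, mul_inv_cancel₀ h1.ne', one_smul, sub_add_cancel]

lemma openFacet_nonempty (hd : 1 ≤ d) {x₀ : Pt d} (hx₀ : x₀ ∈ τ) : (openFacet τ x₀).Nonempty := by
  obtain ⟨z, hz⟩ := openSimplex_nonempty h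
  obtain ⟨y, hy, -⟩ := exists_mem_openFacet_lineMap h hd hx₀ hz
  exact ⟨y, hy⟩

lemma mem_closure_openFacet (hd : 1 ≤ d) {x₀ x : Pt d} (hx₀ : x₀ ∈ τ) (hx : x ∈ closedSimplex τ)
    (hx0 : bary τ x₀ x = 0) : x ∈ closure (openFacet τ x₀) := by
  obtain ⟨c, hc⟩ := openFacet_nonempty h hd hx₀
  refine mem_closure_of_tendsto (tendsto_lineMap_nhdsWithin x c (Set.Ioi 0)) ?_
  filter_upwards [Ioo_mem_nhdsGT (zero_lt_one (α := ℝ))] with t ht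
  refine ⟨by rw [affineMap_lineMap, hx0, hc.1]; ring, fun p hp hpx => ?_⟩
  rw [affineMap_lineMap]
  have h1 := mul_nonneg (sub_nonneg.2 ht.2.le) (bary_nonneg h hx p)
  have h2 := mul_pos ht.1 (hc.2 p hp hpx)
  linarith

/-- Link between the coordinate description of a facet and the intrinsic interior used in
`facet_subset_face`. On the span of the facet the coordinate of `x₀` vanishes, so there positivity
of the others is an open condition sufficient for membership. -/
lemma openFacet_subset_intrinsicInterior {x₀ : Pt d} :
    openFacet τ x₀ ⊆ intrinsicInterior ℝ (convexHull ℝ ((τ : Set (Pt d)) \ {x₀})) := by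
  intro y hy
  have hconv : ∀ z, bary τ x₀ z = 0 → (∀ p ∈ τ, p ≠ x₀ → 0 ≤ bary τ p z) →
      z ∈ convexHull ℝ ((τ : Set (Pt d)) \ {x₀}) := by
    intro z hz hz'
    refine mem_convexHull_of_bary h ?_ fun p hp hpS => ?_
    · rw [mem_closedSimplex_iff h]
      intro p hp
      by_cases hpx : p = x₀
      · rw [hpx, hz]
      · exact hz' p hp hpx
    · by_cases hpx : p = x₀
      · rw [hpx, hz]
      · exact absurd ⟨hp, hpx⟩ hpS
  have hy1 := hconv y hy.1 fun p hp hpx => (hy.2 p hp hpx).le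
  refine mem_intrinsicInterior.2 ⟨⟨y, subset_affineSpan ℝ _ hy1⟩, ?_, rfl⟩
  rw [mem_interior_iff_mem_nhds]
  have hev : ∀ᶠ z in 𝓝 y, ∀ p ∈ τ, p ≠ x₀ → 0 ≤ bary τ p z := by
    rw [Filter.eventually_all_finset]
    intro p hp
    by_cases hpx : p = x₀
    · simp [hpx]
    · filter_upwards [(continuous_bary τ p).continuousAt.eventually_const_lt (hy.2 p hp hpx)]
        with z hz _ using hz.le
  have hev' := (continuous_subtype_val
    (p := fun z => z ∈ affineSpan ℝ (convexHull ℝ ((τ : Set (Pt d)) \ {x₀})))).continuousAt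
    (x := ⟨y, subset_affineSpan ℝ _ hy1⟩) |>.eventually hev
  filter_upwards [hev'] with z hz
  refine hconv z ?_ hz
  have hz2 : (z : Pt d) ∈ affineSpan ℝ ((τ : Set (Pt d)) \ {x₀}) :=
    affineSpan_convexHull (𝕜 := ℝ) ((τ : Set (Pt d)) \ {x₀}) ▸ z.2
  exact bary_eq_zero_of_mem_affineSpan h Set.sdiff_subset (by simp) hz2

lemma eventually_add_smul_mem_openSimplex {x₀ y u : Pt d} (hy : y ∈ openFacet τ x₀)
    (hu : 0 < (bary τ x₀).linear u) : ∀ᶠ t : ℝ in 𝓝[>] 0, y + t • u ∈ openSimplex τ := by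
  have hev : ∀ᶠ t : ℝ in 𝓝[>] 0, ∀ p ∈ τ, p ≠ x₀ → 0 < bary τ p (y + t • u) := by
    rw [Filter.eventually_all_finset]
    intro p hp
    by_cases hpx : p = x₀
    · simp [hpx]
    · have hc : Continuous fun t : ℝ => bary τ p (y + t • u) :=
        (continuous_bary τ p).comp (by fun_prop)
      have h0 : 0 < bary τ p (y + (0 : ℝ) • u) := by simpa using hy.2 p hp hpx
      filter_upwards [nhdsWithin_le_nhds (hc.continuousAt.eventually_const_lt h0)] with t ht _
        using ht
  filter_upwards [hev, self_mem_nhdsWithin] with t ht ht0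
  rw [mem_openSimplex_iff h]
  intro p hp
  by_cases hpx : p = x₀
  · rw [hpx, affineMap_add_smul, hy.1, zero_add]
    exact mul_pos ht0 hu
  · exact ht p hp hpx

/-- A vector orthogonal to a facet is proportional to the gradient of the corresponding
barycentric coordinate. -/
lemma exists_inner_eq_bary_linear (hd : 1 ≤ d) {x₀ n : Pt d} (hx₀ : x₀ ∈ τ) {σ : Set (Pt d)}
    (hσ : openFacet τ x₀ ⊆ σ) (hn : ∀ x ∈ σ, ∀ y ∈ σ, inner ℝ (x - y) n = 0) :
    ∃ c : ℝ, ∀ u, inner ℝ u n = (bary τ x₀).linear u * c := by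
  obtain ⟨q, hq⟩ := openFacet_nonempty h hd hx₀
  refine ⟨inner ℝ (x₀ - q) n, fun u => ?_⟩
  have hcl : ∀ p ∈ τ, p ≠ x₀ → inner ℝ (p - q) n = 0 := by
    intro p hp hpx
    have hp1 := mem_closure_openFacet h hd hx₀ (mem_closedSimplex_of_mem hp)
      (bary_ne h hp hpx.symm)
    have hclosed : IsClosed {z : Pt d | inner ℝ (z - q) n = 0} :=
      isClosed_eq (by fun_prop) continuous_const
    exact hclosed.closure_subset_iff.2 (fun z hz => hn z (hσ hz) q (hσ hq)) hp1
  -- The linear parts of the coordinates sum to zero, so a base point `q` of the facet can be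
  -- subtracted; `n` then annihilates every term except that of `x₀`.
  have hu : u = ∑ p ∈ τ, (bary τ p).linear u • (p - q) := by
    simp_rw [smul_sub]
    rw [Finset.sum_sub_distrib, ← Finset.sum_smul, sum_bary_linear h, sum_bary_linear_smul h]
    simp
  conv_lhs => rw [hu]
  rw [sum_inner, Finset.sum_eq_single x₀]
  · rw [inner_smul_left]; simp
  · intro p hp hpx
    rw [inner_smul_left, hcl p hp hpx, mul_zero]
  · exact fun hn => absurd hx₀ hn

end Facet

/-! ### Faces, their relative boundaries and their nodes -/

namespace PolytopalMesh

variable {d : ℕ} {Ω : Set (Pt d)} (M : PolytopalMesh d Ω)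

lemma isOpen_cell {K : Set (Pt d)} (hK : K ∈ M.cells) : IsOpen K := (M.cell_polytope K hK).isOpen

lemma closure_cell_subset {K : Set (Pt d)} (hK : K ∈ M.cells) : closure K ⊆ closure Ω := by
  rw [M.cells_cover]; exact Set.subset_biUnion_of_mem (u := fun K => closure K) hK

lemma cell_subset (hΩ : IsPolytope Ω) {K : Set (Pt d)} (hK : K ∈ M.cells) : K ⊆ Ω :=
  (interior_maximal (subset_closure.trans (M.closure_cell_subset hK)) (M.isOpen_cell hK)).trans
    hΩ.interior_closure_subset

lemma eq_of_mem_cell {K L : Set (Pt d)} (hK : K ∈ M.cells) (hL : L ∈ M.cells) {x : Pt d}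
    (hxK : x ∈ K) (hxL : x ∈ L) : K = L := by
  by_contra hne
  exact Set.disjoint_left.1 (M.cells_disjoint hK hL hne) hxK hxL

lemma exists_cell_of_face {σ : Set (Pt d)} (hσ : σ ∈ M.faces) : ∃ K ∈ M.cells, σ ⊆ frontier K := by
  rcases M.face_interface_or_boundary σ hσ with ⟨K, hK, L, -, -, h⟩ | ⟨K, hK, h⟩
  · exact ⟨K, hK, h.trans Set.inter_subset_left⟩
  · exact ⟨K, hK, h.trans Set.inter_subset_left⟩

lemma isBounded_face (hΩ : IsPolytope Ω) {σ : Set (Pt d)} (hσ : σ ∈ M.faces) :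
    Bornology.IsBounded σ := by
  obtain ⟨K, hK, h⟩ := M.exists_cell_of_face hσ
  exact hΩ.isBounded.closure.subset
    ((h.trans frontier_subset_closure).trans (M.closure_cell_subset hK))

/-- The relative boundary of a face is contained in finitely many affine subspaces of
codimension two. -/
lemma exists_finset_relBoundary_subset (hd : d = 2 ∨ d = 3) {σ : Set (Pt d)} (hσ : σ ∈ M.faces) :
    ∃ 𝒮 : Finset (Finset (Pt d)), (∀ S ∈ 𝒮, S.card + 1 ≤ d) ∧
      ∀ x ∈ closure σ \ σ, ∃ S ∈ 𝒮, x ∈ affineSpan ℝ (S : Set (Pt d)) := by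
  classical
  rcases hd with hd | hd
  · obtain ⟨a, -, b, -, -, rfl⟩ := M.edge_segment σ (by rw [M.edges_eq_faces hd]; exact hσ)
    refine ⟨{{a}, {b}}, by simp [hd], fun x hx => ?_⟩
    rw [closure_openSegment, ← insert_endpoints_openSegment] at hx
    rcases hx with ⟨rfl | rfl | hx, hx'⟩
    · exact ⟨{x}, by simp, subset_affineSpan ℝ _ (by simp)⟩
    · exact ⟨{x}, by simp, subset_affineSpan ℝ _ (by simp)⟩
    · exact absurd hx hx'
  · choose! a _ b _ _ he using M.edge_segment
    refine ⟨M.edges.image fun e => {a e, b e}, ?_, fun x hx => ?_⟩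
    · intro S hS
      obtain ⟨e, -, rfl⟩ := Finset.mem_image.1 hS
      exact (Nat.add_le_add_right Finset.card_le_two 1).trans hd.ge
    · rw [M.face_boundary hd σ hσ] at hx
      simp only [Set.mem_iUnion, exists_prop] at hx
      obtain ⟨e, ⟨heM, -⟩, hxe⟩ := hx
      refine ⟨_, Finset.mem_image_of_mem _ heM, ?_⟩
      rw [he e heM, closure_openSegment] at hxe
      rw [← convexHull_pair] at hxe
      simpa using convexHull_subset_affineSpan _ hxe

/-- For `d = 2` the relative boundary consists of the endpoints of a segment. For `d = 3` it is a
union of closed edges, whose endpoints therefore belong to it and count as nodes of the face. -/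
lemma relBoundary_subset_convexHull (hd : d = 2 ∨ d = 3) {σ : Set (Pt d)} (hσ : σ ∈ M.faces) :
    closure σ \ σ ⊆ convexHull ℝ {s | s ∈ M.nodes ∧ s ∈ closure σ \ σ} := by
  rcases hd with hd | hd
  · obtain ⟨a, ha, b, hb, hab, rfl⟩ := M.edge_segment σ (by rw [M.edges_eq_faces hd]; exact hσ)
    rw [closure_openSegment, ← convexHull_pair]
    refine Set.sdiff_subset.trans (convexHull_mono ?_)
    rw [convexHull_pair]
    rintro x (rfl | rfl)
    · exact ⟨ha, left_mem_segment ℝ _ _, by rw [left_mem_openSegment_iff]; exact hab⟩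
    · exact ⟨hb, right_mem_segment ℝ _ _, by rw [right_mem_openSegment_iff]; exact hab⟩
  · intro x hx
    have hx' := hx
    rw [M.face_boundary hd σ hσ] at hx'
    simp only [Set.mem_iUnion, exists_prop] at hx'
    obtain ⟨e, heM, hxe⟩ := hx'
    have hsub : closure e ⊆ closure σ \ σ := by
      rw [M.face_boundary hd σ hσ]
      exact Set.subset_biUnion_of_mem (u := fun e => closure e) heM
    obtain ⟨a, ha, b, hb, -, rfl⟩ := M.edge_segment e heM.1
    rw [closure_openSegment] at hxe hsub
    rw [← convexHull_pair] at hxe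
    refine convexHull_mono ?_ hxe
    rintro y (rfl | rfl)
    · exact ⟨ha, hsub (left_mem_segment ℝ _ _)⟩
    · exact ⟨hb, hsub (right_mem_segment ℝ _ _)⟩

/-- A face is contained in the convex hull of its nodes. -/
lemma closure_face_subset_convexHull (hd : d = 2 ∨ d = 3) (hΩ : IsPolytope Ω) {σ : Set (Pt d)}
    (hσ : σ ∈ M.faces) :
    closure σ ⊆ convexHull ℝ {s | s ∈ M.nodes ∧ s ∈ closure σ \ σ} := by
  intro y hy
  by_cases hyσ : y ∈ σ
  swap
  · exact M.relBoundary_subset_convexHull hd hσ ⟨hy, hyσ⟩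
  obtain ⟨H, hH, U, hU, hUσ⟩ := M.face_flat σ hσ
  -- Cut the face by a line through `y` inside its hyperplane. The trace is open and bounded, so
  -- both half-lines leave it, at points of the relative boundary, and `y` is a convex combination
  -- of two such points.
  obtain ⟨u, hu, hu0⟩ : ∃ u ∈ H.direction, u ≠ 0 := by
    apply Submodule.exists_mem_ne_zero_of_ne_bot
    rintro hbot
    rw [hbot, finrank_bot] at hH
    omega
  have hyH : y ∈ H := by rw [hUσ] at hyσ; exact hyσ.2
  have hline : ∀ t : ℝ, y + t • u ∈ H := fun t => by
    rw [add_comm]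
    exact AffineSubspace.vadd_mem_of_mem_direction (H.direction.smul_mem t hu) hyH
  have hc : Continuous fun t : ℝ => y + t • u := by fun_prop
  set A : Set ℝ := {t | y + t • u ∈ σ} with hA
  have hAo : IsOpen A := by
    have : A = (fun t : ℝ => y + t • u) ⁻¹' U := by
      ext t
      simp only [hA, hUσ, Set.mem_preimage]
      exact ⟨fun ht => ht.1, fun ht => ⟨ht, hline t⟩⟩
    rw [this]; exact hU.preimage hc
  obtain ⟨R, hR⟩ := (M.isBounded_face hΩ hσ).exists_norm_le
  have hfar : ∀ t : ℝ, R + ‖y‖ < |t| * ‖u‖ → t ∉ A := by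
    intro t ht htA
    have h1 := hR _ htA
    have h2 : ‖t • u‖ ≤ ‖y + t • u‖ + ‖y‖ := by
      simpa using norm_sub_le (y + t • u) y
    rw [norm_smul, Real.norm_eq_abs] at h2
    linarith
  have hu' : 0 < ‖u‖ := norm_pos_iff.2 hu0
  have hfront : ∀ t ∈ frontier A, y + t • u ∈ closure σ \ σ := by
    intro t ht
    rw [hAo.frontier_eq] at ht
    exact ⟨map_mem_closure (f := fun t : ℝ => y + t • u) hc ht.1 fun s hs => hs, ht.2⟩
  have h0A : (0 : ℝ) ∈ A := by simpa [hA] using hyσ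
  have hRy : 0 ≤ R + ‖y‖ := by linarith [norm_nonneg y, hR y hyσ]
  -- At the parameters `m` and `-m` the point is at distance `R + ‖y‖ + 1` from `y`, hence outside
  -- the ball of radius `R` containing the face.
  set m := (R + ‖y‖ + 1) / ‖u‖ with hm
  have hmu : m * ‖u‖ = R + ‖y‖ + 1 := by rw [hm]; field_simp
  have hm0 : 0 < m := by rw [hm]; positivity
  obtain ⟨t₁, ht₁, hf₁⟩ := exists_mem_frontier_of_isPreconnected isPreconnected_Ici hAo
    ⟨0, Set.self_mem_Ici, h0A⟩
    ⟨m, hm0.le, hfar m (by rw [abs_of_pos hm0, hmu]; linarith)⟩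
  obtain ⟨t₂, ht₂, hf₂⟩ := exists_mem_frontier_of_isPreconnected isPreconnected_Iic hAo
    ⟨0, Set.self_mem_Iic, h0A⟩
    ⟨-m, by simpa using hm0.le, hfar (-m) (by rw [abs_neg, abs_of_pos hm0, hmu]; linarith)⟩
  have hp₁ := M.relBoundary_subset_convexHull hd hσ (hfront t₁ hf₁)
  have hp₂ := M.relBoundary_subset_convexHull hd hσ (hfront t₂ hf₂)
  have hne : t₁ ≠ 0 := by
    rintro rfl
    rw [hAo.frontier_eq] at hf₁
    exact hf₁.2 h0A
  have hpos : 0 < t₁ - t₂ := by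
    have h1 : 0 < t₁ := lt_of_le_of_ne ht₁ hne.symm
    have h2 : t₂ ≤ 0 := ht₂
    linarith
  have hcomb := convex_convexHull ℝ _ hp₁ hp₂ (a := -t₂ / (t₁ - t₂)) (b := t₁ / (t₁ - t₂))
    (div_nonneg (neg_nonneg.2 ht₂) hpos.le) (div_nonneg ht₁ hpos.le) (by field_simp; ring)
  convert hcomb using 1
  have e1 : -t₂ / (t₁ - t₂) + t₁ / (t₁ - t₂) = 1 := by field_simp; ring
  have e2 : -t₂ / (t₁ - t₂) * t₁ + t₁ / (t₁ - t₂) * t₂ = 0 := by ring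
  rw [smul_add, smul_add, smul_smul, smul_smul, add_add_add_comm, ← add_smul, ← add_smul, e1, e2]
  simp

end PolytopalMesh

namespace PolytopalMesh

variable {d : ℕ} {Ω : Set (Pt d)} {M : PolytopalMesh d Ω} {T : Finset (Finset (Pt d))}

lemma IsMatchingSubmesh.openFacet_subset_or_disjoint (hT : M.IsMatchingSubmesh T)
    {τ : Finset (Pt d)} (hτ : τ ∈ T) {x₀ : Pt d} (hx₀ : x₀ ∈ τ) {σ : Set (Pt d)}
    (hσ : σ ∈ M.faces) : openFacet τ x₀ ⊆ σ ∨ Disjoint (openFacet τ x₀) σ := by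
  have hsub := openFacet_subset_intrinsicInterior (hT.isMesh.isSimplex τ hτ) (x₀ := x₀)
  rcases hT.facet_subset_face τ hτ x₀ hx₀ σ hσ with h | h
  · exact Or.inl (hsub.trans h)
  · exact Or.inr (h.mono_left hsub)

/-- An open facet in the skeleton is contained in a face. -/
lemma IsMatchingSubmesh.exists_face (hT : M.IsMatchingSubmesh T) (hd : d = 2 ∨ d = 3)
    {τ : Finset (Pt d)} (hτ : τ ∈ T) {x₀ : Pt d} (hx₀ : x₀ ∈ τ)
    (hsub : openFacet τ x₀ ⊆ ⋃ K ∈ M.cells, frontier K) :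
    ∃ σ ∈ M.faces, openFacet τ x₀ ⊆ σ := by
  classical
  by_contra! hno
  have hs := hT.isMesh.isSimplex τ hτ
  choose! 𝒮 h𝒮card h𝒮 using fun σ => M.exists_finset_relBoundary_subset hd (σ := σ)
  -- Take a point of the open simplex avoiding all spans of `x₀` with the low-dimensional subspaces
  -- carrying the face boundaries. Its projection from `x₀` to the facet avoids these subspaces, so
  -- it lies in a face and not just in its closure.
  obtain ⟨z, hz, hz'⟩ := exists_mem_notMem_affineSpan (O := openSimplex τ) isOpen_interior
    (openSimplex_nonempty hs) ((M.faces.biUnion 𝒮).image (insert x₀)) (by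
      intro S hS
      obtain ⟨S', hS', rfl⟩ := Finset.mem_image.1 hS
      obtain ⟨σ, hσ, hS'⟩ := Finset.mem_biUnion.1 hS'
      exact (Finset.card_insert_le _ _).trans (h𝒮card σ hσ S' hS'))
  obtain ⟨y, hy, t, rfl⟩ := exists_mem_openFacet_lineMap hs (by omega) hx₀ hz
  have hyσ := hsub hy
  rw [M.skeleton] at hyσ
  simp only [Set.mem_iUnion, exists_prop] at hyσ
  obtain ⟨σ, hσ, hyσ⟩ := hyσ
  have hyn : y ∉ σ := Set.disjoint_left.1
    ((hT.openFacet_subset_or_disjoint hτ hx₀ hσ).resolve_left (hno σ hσ)) hy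
  obtain ⟨S, hS, hyS⟩ := h𝒮 σ hσ y ⟨hyσ, hyn⟩
  refine hz' (insert x₀ S) (Finset.mem_image_of_mem _ (Finset.mem_biUnion.2 ⟨σ, hσ, hS⟩)) ?_
  exact AffineMap.lineMap_mem _ (subset_affineSpan ℝ _ (by simp))
    (affineSpan_mono ℝ (by simp) hyS)

/-- The side of a face on which a cell lies, seen from a simplex having a facet in that face:
either the simplex lies in the cell, or the other side of the facet does. -/
lemma IsMatchingSubmesh.cell_eq_or_isSharedFacet (hT : M.IsMatchingSubmesh T) (hd : d = 2 ∨ d = 3)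
    {τ : Finset (Pt d)} (hτ : τ ∈ T) {x₀ : Pt d} (hx₀ : x₀ ∈ τ) {σ K K' : Set (Pt d)}
    (hK : K ∈ M.cells) (hτK : openSimplex τ ⊆ K) (hF : openFacet τ x₀ ⊆ σ) (hK' : K' ∈ M.cells)
    {n : Pt d} (hn : IsOuterNormal K' σ n) :
    ∃ c : ℝ, (∀ u, inner ℝ u n = (bary τ x₀).linear u * c) ∧
      (c < 0 ∧ K' = K ∨ 0 < c ∧ IsSharedFacet T τ x₀) := by
  have hs := hT.isMesh.isSimplex τ hτ
  obtain ⟨c, hc⟩ := exists_inner_eq_bary_linear hs (by omega) hx₀ hF hn.2.1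
  obtain ⟨y, hy⟩ := openFacet_nonempty hs (by omega) hx₀
  -- Thus `c` has the sign of the slope of the coordinate along `n`. If `c < 0`, then `-n` points
  -- into `τ` and `K'` meets `τ`; if `c > 0`, then `K'` lies across the facet, which is therefore
  -- shared.
  have hn1 : (bary τ x₀).linear n * c = 1 := by
    rw [← hc n, real_inner_self_eq_norm_sq, hn.1, one_pow]
  have hev := hn.2.2 y (hF hy)
  refine ⟨c, hc, ?_⟩
  rcases lt_or_ge c 0 with hc0 | hc0
  · refine Or.inl ⟨hc0, ?_⟩
    have hL : 0 < (bary τ x₀).linear (-n) := by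
      rw [map_neg]; nlinarith
    obtain ⟨t, ht, ht'⟩ := (hev.and (eventually_add_smul_mem_openSimplex hs hy hL)).exists
    rw [smul_neg, ← sub_eq_add_neg] at ht'
    exact M.eq_of_mem_cell hK' hK ht.2 (hτK ht')
  · have hL : 0 < (bary τ x₀).linear n := by
      by_contra! hle
      nlinarith
    refine Or.inr ⟨lt_of_le_of_ne hc0 (by rintro rfl; simp at hn1),
      hT.isMesh.isSharedFacet_of_frequently hτ hy ?_⟩
    have htend : Filter.Tendsto (fun t : ℝ => y - t • n) (𝓝[>] 0) (𝓝 y) := by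
      have : Continuous fun t : ℝ => y - t • n := by fun_prop
      have := (this.tendsto 0).mono_left (nhdsWithin_le_nhds (s := Set.Ioi 0))
      simpa using this
    refine htend.frequently (Filter.Eventually.frequently ?_)
    filter_upwards [hev, self_mem_nhdsWithin] with t ht ht0
    refine ⟨M.closure_cell_subset hK' (subset_closure ht.2), ?_⟩
    rw [sub_eq_add_neg, ← smul_neg, affineMap_add_smul, hy.1, map_neg]
    have : 0 < t * (bary τ x₀).linear n := mul_pos ht0 hL
    linarith

/-- A face containing a facet of a simplex is a face of the cell containing the simplex, and it is
a boundary face if the facet is not shared. -/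
lemma IsMatchingSubmesh.face_subset_frontier (hT : M.IsMatchingSubmesh T) (hd : d = 2 ∨ d = 3)
    (hΩ : IsPolytope Ω) {τ : Finset (Pt d)} (hτ : τ ∈ T) {x₀ : Pt d} (hx₀ : x₀ ∈ τ)
    {σ K : Set (Pt d)} (hσ : σ ∈ M.faces) (hK : K ∈ M.cells) (hτK : openSimplex τ ⊆ K)
    (hF : openFacet τ x₀ ⊆ σ) :
    σ ⊆ frontier K ∧ (¬ IsSharedFacet T τ x₀ → σ ⊆ frontier Ω) := by
  have hs := hT.isMesh.isSimplex τ hτ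
  obtain ⟨y, hy⟩ := openFacet_nonempty hs (by omega) hx₀
  rcases M.face_interface_or_boundary σ hσ with ⟨K', hK', L', hL', hne, hKL⟩ | ⟨K', hK', hKΩ⟩
  · have hσK : σ ⊆ frontier K' := hKL.trans Set.inter_subset_left
    have hσL : σ ⊆ frontier L' := hKL.trans Set.inter_subset_right
    obtain ⟨n, hn⟩ := M.exists_outerNormal K' hK' σ hσ hσK
    obtain ⟨n', hn'⟩ := M.exists_outerNormal L' hL' σ hσ hσL
    obtain ⟨c, hc, hc1⟩ := hT.cell_eq_or_isSharedFacet hd hτ hx₀ hK hτK hF hK' hn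
    obtain ⟨c', hc', hc1'⟩ := hT.cell_eq_or_isSharedFacet hd hτ hx₀ hK hτK hF hL' hn'
    -- With equal signs the two unit normals would coincide, and points just behind the face would
    -- lie in two disjoint cells. This excludes that both cells lie across the facet, so one of them
    -- is `K`.
    have hsign : ¬ (0 < c * c') := by
      intro hcc
      have hv : c' • n = c • n' := by
        refine ext_inner_left ℝ fun u => ?_
        rw [inner_smul_right, inner_smul_right, hc, hc']; ring
      have habs : |c'| = |c| := by
        have := congrArg norm hv
        simpa [norm_smul, hn.1, hn'.1] using this
      have hcc' : c' = c := by
        rcases abs_eq_abs.1 habs with h | h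
        · exact h
        · rw [h] at hcc; nlinarith [sq_nonneg c]
      have hnn : n = n' := by
        rw [hcc'] at hv
        have hc0 : c ≠ 0 := by
          rintro rfl
          simp at hcc
        exact smul_right_injective _ hc0 hv
      obtain ⟨t, ht, ht'⟩ := ((hn.2.2 y (hF hy)).and (hn'.2.2 y (hF hy))).exists
      rw [← hnn] at ht'
      exact hne (M.eq_of_mem_cell hK' hL' ht.2 ht'.2)
    rcases hc1 with ⟨hc1, rfl⟩ | ⟨hc1, hsh⟩ <;> rcases hc1' with ⟨hc1', rfl⟩ | ⟨hc1', hsh'⟩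
    · exact absurd rfl hne
    · exact ⟨hσK, fun hns => absurd hsh' hns⟩
    · exact ⟨hσL, fun hns => absurd hsh hns⟩
    · exact absurd (mul_pos hc1 hc1') hsign
  · have hσK : σ ⊆ frontier K' := hKΩ.trans Set.inter_subset_left
    have hσΩ : σ ⊆ frontier Ω := hKΩ.trans Set.inter_subset_right
    obtain ⟨n, hn⟩ := M.exists_outerNormal K' hK' σ hσ hσK
    obtain ⟨c, hc, ⟨-, rfl⟩ | ⟨-, hsh⟩⟩ := hT.cell_eq_or_isSharedFacet hd hτ hx₀ hK hτK hF hK' hn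
    · exact ⟨hσK, fun _ => hσΩ⟩
    · have hyΩ := hσΩ (hF hy)
      rw [hΩ.isOpen.frontier_eq] at hyΩ
      exact absurd (hT.isMesh.openFacet_subset_of_isSharedFacet hΩ hτ hx₀ hsh hy) hyΩ.2

/-- A facet shared by two simplices lying in different cells is contained in a common face of
these cells. -/
lemma IsMatchingSubmesh.exists_interface (hT : M.IsMatchingSubmesh T) (hd : d = 2 ∨ d = 3)
    (hΩ : IsPolytope Ω) {τ τ' : Finset (Pt d)} (hτ : τ ∈ T) (hτ' : τ' ∈ T) {x₀ : Pt d}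
    (hx₀ : x₀ ∈ τ) (hsub : ∀ p ∈ τ, p ≠ x₀ → p ∈ τ') {K K' : Set (Pt d)} (hK : K ∈ M.cells)
    (hK' : K' ∈ M.cells) (hne : K ≠ K') (hτK : openSimplex τ ⊆ K) (hτK' : openSimplex τ' ⊆ K') :
    ∃ σ ∈ M.faces, σ ⊆ frontier K ∧ σ ⊆ frontier K' ∧
      ∀ x ∈ closedSimplex τ, bary τ x₀ x = 0 → x ∈ closure σ := by
  have hs := hT.isMesh.isSimplex τ hτ
  have hs' := hT.isMesh.isSimplex τ' hτ'
  have hττ' : τ' ≠ τ := by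
    rintro rfl
    obtain ⟨z, hz⟩ := openSimplex_nonempty hs
    exact hne (M.eq_of_mem_cell hK hK' (hτK hz) (hτK' hz))
  have hcl : ∀ y ∈ openFacet τ x₀, y ∈ closedSimplex τ' := fun y hy =>
    hT.isMesh.mem_closedSimplex_of_facet hτ hsub
      (IsMatchingSimplicialMesh.openFacet_subset_closedSimplex hs hy) hy.1
  have hfr : openFacet τ x₀ ⊆ frontier K := by
    intro y hy
    have hy1 := IsMatchingSimplicialMesh.openFacet_subset_closedSimplex hs hy
    have hy2 := hcl y hy
    rw [← closure_openSimplex hs] at hy1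
    rw [← closure_openSimplex hs'] at hy2
    rw [(M.isOpen_cell hK).frontier_eq]
    refine ⟨closure_mono hτK hy1, fun hyK => ?_⟩
    obtain ⟨z, hzK, hz⟩ := mem_closure_iff.1 hy2 K (M.isOpen_cell hK) hyK
    exact hne (M.eq_of_mem_cell hK hK' hzK (hτK' hz))
  obtain ⟨σ, hσ, hF⟩ := hT.exists_face hd hτ hx₀
    (hfr.trans (Set.subset_biUnion_of_mem (u := fun K => frontier K) hK))
  obtain ⟨-, x₁, hx₁, hx₁τ, hx₁'⟩ :=
    IsMatchingSimplicialMesh.exists_opposite_vertex hs hs' hττ' hx₀ hsub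
  obtain ⟨y, hy⟩ := openFacet_nonempty hs (by omega) hx₀
  have hyb := hT.isMesh.bary_eq hτ hτ'
    (IsMatchingSimplicialMesh.openFacet_subset_closedSimplex hs hy) (hcl y hy)
  have hy' : y ∈ openFacet τ' x₁ := by
    refine ⟨by rw [← hyb, bary_of_notMem hx₁τ]; rfl, fun p hp hpx => ?_⟩
    rw [← hyb]
    exact hy.2 p (hx₁' p hp hpx).1 (hx₁' p hp hpx).2
  have hF' : openFacet τ' x₁ ⊆ σ :=
    (hT.openFacet_subset_or_disjoint hτ' hx₁ hσ).resolve_right fun hdisj =>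
      Set.disjoint_left.1 hdisj hy' (hF hy)
  refine ⟨σ, hσ, (hT.face_subset_frontier hd hΩ hτ hx₀ hσ hK hτK hF).1,
    (hT.face_subset_frontier hd hΩ hτ' hx₁ hσ hK' hτK' hF').1, fun x hx hx0 => ?_⟩
  exact closure_mono hF (mem_closure_openFacet hs (by omega) hx₀ hx hx0)

/-- A facet which is not shared is contained in a boundary face of the cell. -/
lemma IsMatchingSubmesh.exists_boundary_face (hT : M.IsMatchingSubmesh T) (hd : d = 2 ∨ d = 3)
    (hΩ : IsPolytope Ω) {τ : Finset (Pt d)} (hτ : τ ∈ T) {x₀ : Pt d}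
    (hx₀ : x₀ ∈ τ) (hns : ¬ IsSharedFacet T τ x₀) {K : Set (Pt d)} (hK : K ∈ M.cells)
    (hτK : openSimplex τ ⊆ K) :
    ∃ σ ∈ M.faces, σ ⊆ frontier K ∧ σ ⊆ frontier Ω ∧
      ∀ x ∈ closedSimplex τ, bary τ x₀ x = 0 → x ∈ closure σ := by
  have hs := hT.isMesh.isSimplex τ hτ
  have hfr : openFacet τ x₀ ⊆ frontier K := by
    intro y hy
    have hy1 := IsMatchingSimplicialMesh.openFacet_subset_closedSimplex hs hy
    rw [← closure_openSimplex hs] at hy1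
    rw [(M.isOpen_cell hK).frontier_eq]
    exact ⟨closure_mono hτK hy1, fun hyK =>
      hT.isMesh.notMem_of_not_isSharedFacet hΩ hτ hx₀ hy hns (M.cell_subset hΩ hK hyK)⟩
  obtain ⟨σ, hσ, hF⟩ := hT.exists_face hd hτ hx₀
    (hfr.trans (Set.subset_biUnion_of_mem (u := fun K => frontier K) hK))
  obtain ⟨h1, h2⟩ := hT.face_subset_frontier hd hΩ hτ hx₀ hσ hK hτK hF
  exact ⟨σ, hσ, h1, h2 hns, fun x hx hx0 =>
    closure_mono hF (mem_closure_openFacet hs (by omega) hx₀ hx hx0)⟩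

end PolytopalMesh

/-! ### Integration by parts for Lipschitz functions -/

section Lipschitz

variable {E : Type*} [NormedAddCommGroup E] [NormedSpace ℝ E]

/-- A function which is Lipschitz at each point, with a uniform constant, is Lipschitz. -/
lemma lipschitzWith_of_eventually {f : E → ℝ} {C : NNReal}
    (h : ∀ x, ∀ᶠ y in 𝓝 x, |f y - f x| ≤ C * ‖y - x‖) : LipschitzWith C f := by
  have hcont : Continuous f := by
    rw [continuous_iff_continuousAt]
    intro x
    rw [ContinuousAt, tendsto_iff_norm_sub_tendsto_zero]
    have h0 : Filter.Tendsto (fun y => (C : ℝ) * ‖y - x‖) (𝓝 x) (𝓝 0) := by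
      have : Continuous fun y => (C : ℝ) * ‖y - x‖ := by fun_prop
      simpa using this.tendsto x
    exact squeeze_zero' (Filter.Eventually.of_forall fun y => norm_nonneg _) (h x) h0
  refine LipschitzWith.of_dist_le_mul fun b a => ?_
  rw [Real.dist_eq, dist_eq_norm]
  set γ : ℝ → E := fun t => a + t • (b - a) with hγ
  have hγc : Continuous γ := by fun_prop
  -- Continuous induction along the segment: this set is closed, contains 0, and the local estimate
  -- extends it to the right of each of its points.
  set s : Set ℝ := {t | |f (γ t) - f a| ≤ C * (t * ‖b - a‖)} with hs
  have hsc : IsClosed s := isClosed_le (by fun_prop) (by fun_prop)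
  have hsub : Set.Icc (0 : ℝ) 1 ⊆ s := by
    refine (hsc.inter isClosed_Icc).Icc_subset_of_forall_exists_gt (by simp [hs, hγ]) ?_
    rintro t ⟨ht, -⟩ y hy
    have hev := hγc.continuousAt.eventually (h (γ t))
    obtain ⟨u, hu, hu'⟩ := ((hev.filter_mono (nhdsWithin_le_nhds (s := Set.Ioi t))).and
      (Ioc_mem_nhdsGT hy)).exists
    refine ⟨u, ?_, hu'⟩
    have hu1 : |f (γ u) - f (γ t)| ≤ C * ‖γ u - γ t‖ := hu
    have e : γ u - γ t = (u - t) • (b - a) := by simp only [hγ]; rw [sub_smul]; abel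
    rw [e, norm_smul, Real.norm_eq_abs, abs_of_pos (sub_pos.2 hu'.1)] at hu1
    have ht' : |f (γ t) - f a| ≤ C * (t * ‖b - a‖) := ht
    have := abs_sub_le (f (γ u)) (f (γ t)) (f a)
    change |f (γ u) - f a| ≤ C * (u * ‖b - a‖)
    nlinarith
  have := hsub (Set.right_mem_Icc.2 zero_le_one)
  simpa [hs, hγ] using this

variable [MeasurableSpace E] [BorelSpace E] [FiniteDimensional ℝ E] {μ : Measure E}
  [μ.IsAddHaarMeasure] {C D : NNReal} {f g : E → ℝ}

lemma integrable_lineDeriv_of_hasCompactSupport (hf : LipschitzWith C f)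
    (hfc : HasCompactSupport f) (v : E) : Integrable (fun x => lineDeriv ℝ f x v) μ := by
  have hsupp : Function.support (fun x => lineDeriv ℝ f x v) ⊆ tsupport f := by
    intro x hx
    by_contra hxf
    apply hx
    have h0 : ∀ᶠ y in 𝓝 x, f y = 0 := by
      filter_upwards [(isClosed_tsupport f).isOpen_compl.mem_nhds hxf] with y hy
      exact image_eq_zero_of_notMem_tsupport hy
    have hc : Continuous fun t : ℝ => x + t • v := by fun_prop
    have hev : ∀ᶠ t : ℝ in 𝓝 0, f (x + t • v) = 0 := by
      have := hc.tendsto 0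
      simp only [zero_smul, add_zero] at this
      exact this.eventually h0
    change deriv (fun t : ℝ => f (x + t • v)) 0 = 0
    rw [Filter.EventuallyEq.deriv_eq (f := fun _ => (0 : ℝ)) hev]
    simp
  rw [← integrableOn_iff_integrable_of_support_subset hsupp]
  exact (hf.locallyIntegrable_lineDeriv v).integrableOn_isCompact hfc

/-- The integral of `∂_v f ∂_u g` is symmetric in the two directions of derivation. -/
lemma integral_lineDeriv_mul_lineDeriv_comm (hf : LipschitzWith C f) (hfc : HasCompactSupport f)
    (hg : LipschitzWith D g) (hgc : HasCompactSupport g) (u v : E) :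
    ∫ x, lineDeriv ℝ f x v * lineDeriv ℝ g x u ∂μ =
      ∫ x, lineDeriv ℝ g x v * lineDeriv ℝ f x u ∂μ := by
  -- Second derivatives are avoided by difference quotients in the direction `v`. For fixed `t`, one
  -- integration by parts in `u` and a translation exchange the roles of `f` and `g`; then `t` tends
  -- to 0. The quotient of `g` is taken along `-v`, and the sign is compensated by `-u`.
  have hA := hf.integral_inv_smul_sub_mul_tendsto_integral_lineDeriv_mul
    (integrable_lineDeriv_of_hasCompactSupport (μ := μ) hg hgc u) v
  have hB := hg.integral_inv_smul_sub_mul_tendsto_integral_lineDeriv_mul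
    (integrable_lineDeriv_of_hasCompactSupport (μ := μ) hf hfc (-u)) (-v)
  simp only [lineDeriv_neg] at hB
  simp only [neg_mul_neg] at hB
  refine tendsto_nhds_unique hA (hB.congr fun t => ?_)
  simp only [smul_eq_mul, mul_assoc]
  rw [integral_const_mul, integral_const_mul]
  congr 1
  have hint : ∀ {φ ψ : E → ℝ} {c : NNReal} (_ : LipschitzWith c φ)
      (_ : HasCompactSupport φ) (_ : Continuous ψ) (_ : HasCompactSupport ψ) (w : E),
      Integrable (fun x => ψ x * lineDeriv ℝ φ x w) μ := fun hφ hφc hψ hψc w =>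
    (hφ.locallyIntegrable_lineDeriv w).integrable_smul_left_of_hasCompactSupport hψ hψc
  have htrans : ∀ {φ : E → ℝ} (a : E), HasCompactSupport φ →
      HasCompactSupport fun x => φ (x + a) := fun a hφ =>
    hφ.comp_homeomorph (Homeomorph.addRight a)
  have hgt : LipschitzWith D fun x => g (x + t • -v) := by
    have : LipschitzWith 1 fun x : E => x + t • -v :=
      LipschitzWith.of_dist_le_mul fun x y => by simp
    simpa [Function.comp_def] using hg.comp this
  have hder : ∀ x w, lineDeriv ℝ (fun y => g (y + t • -v)) x w = lineDeriv ℝ g (x + t • -v) w := by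
    intro x w
    simp only [lineDeriv]
    congr 1
    ext s
    congr 1
    abel
  calc ∫ x, (g (x + t • -v) - g x) * -lineDeriv ℝ f x u ∂μ
      = ∫ x, g (x + t • -v) * lineDeriv ℝ f x (-u) ∂μ - ∫ x, g x * lineDeriv ℝ f x (-u) ∂μ := by
        rw [← integral_sub (hint hf hfc hgt.continuous (htrans _ hgc) _)
          (hint hf hfc hg.continuous hgc _)]
        simp only [lineDeriv_neg]
        congr 1; ext x; ring
    _ = ∫ x, f x * lineDeriv ℝ g (x + t • -v) u ∂μ - ∫ x, f x * lineDeriv ℝ g x u ∂μ := by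
        congr 1
        · simp only [mul_comm _ (lineDeriv ℝ f _ _)]
          rw [← (hgt.integral_lineDeriv_mul_eq hf hfc u)]
          simp only [hder, mul_comm]
        · simp only [mul_comm _ (lineDeriv ℝ f _ _)]
          rw [← hg.integral_lineDeriv_mul_eq hf hfc u]
          simp only [mul_comm]
    _ = ∫ x, f (x + t • v) * lineDeriv ℝ g x u ∂μ - ∫ x, f x * lineDeriv ℝ g x u ∂μ := by
        congr 1
        rw [← integral_add_right_eq_self _ (t • v)]
        simp
    _ = _ := by
        rw [← integral_sub (hint hg hgc (by have := hf.continuous; fun_prop) (htrans _ hfc) _)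
          (hint hg hgc hf.continuous hfc _)]
        congr 1; ext x; ring

end Lipschitz

/-! ### Continuous piecewise affine functions and Korn's inequality -/

section Interp

variable {d : ℕ} {Ω : Set (Pt d)} {T : Finset (Finset (Pt d))}

open Classical in
/-- The continuous piecewise affine function with nodal values `g`, extended by zero. -/
noncomputable def interp (T : Finset (Finset (Pt d))) (g : Pt d → ℝ) (x : Pt d) : ℝ :=
  if h : ∃ τ ∈ T, x ∈ closedSimplex τ then ∑ p ∈ h.choose, bary h.choose p x * g p else 0

/-- The derivative in the direction `u` of the affine function with nodal values `g`. -/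
noncomputable def interpDeriv (τ : Finset (Pt d)) (g : Pt d → ℝ) (u : Pt d) : ℝ :=
  ∑ p ∈ τ, (bary τ p).linear u * g p

lemma interp_of_forall_notMem {g : Pt d → ℝ} {x : Pt d} (h : ∀ τ ∈ T, x ∉ closedSimplex τ) :
    interp T g x = 0 := by
  rw [interp, dif_neg]
  push Not
  exact h

namespace IsMatchingSimplicialMesh

variable (hT : IsMatchingSimplicialMesh Ω T)
include hT

lemma interp_eq (g : Pt d → ℝ) {τ : Finset (Pt d)} (hτ : τ ∈ T) {x : Pt d}
    (hx : x ∈ closedSimplex τ) : interp T g x = ∑ p ∈ τ, bary τ p x * g p := by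
  classical
  have h : ∃ τ ∈ T, x ∈ closedSimplex τ := ⟨τ, hτ, hx⟩
  rw [interp, dif_pos h]
  obtain ⟨hτ', hx'⟩ := h.choose_spec
  set τ' := h.choose
  have key : ∀ ρ : Finset (Pt d), ρ ⊆ τ ∪ τ' →
      ∑ p ∈ ρ, bary ρ p x * g p = ∑ p ∈ τ ∪ τ', bary ρ p x * g p := by
    intro ρ hρ
    refine Finset.sum_subset hρ fun p _ hp => ?_
    simp [bary_of_notMem hp]
  rw [key τ Finset.subset_union_left, key τ' Finset.subset_union_right]
  exact Finset.sum_congr rfl fun p _ => by rw [hT.bary_eq hτ hτ' hx hx']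

lemma interp_add_smul (g : Pt d → ℝ) {τ : Finset (Pt d)} (hτ : τ ∈ T) {x u : Pt d} {t : ℝ}
    (hx : x ∈ closedSimplex τ) (hxu : x + t • u ∈ closedSimplex τ) :
    interp T g (x + t • u) = interp T g x + t * interpDeriv τ g u := by
  rw [hT.interp_eq g hτ hx, hT.interp_eq g hτ hxu, interpDeriv, Finset.mul_sum,
    ← Finset.sum_add_distrib]
  refine Finset.sum_congr rfl fun p _ => ?_
  rw [affineMap_add_smul]; ring

/-- By `mem_of_carrier`, a point whose carrier has a vertex in `Ω` is itself in `Ω`. So outside `Ω`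
only vertices with zero nodal value contribute. -/
lemma interp_eq_zero (hΩ : IsPolytope Ω) {g : Pt d → ℝ}
    (hg : ∀ τ ∈ T, ∀ p ∈ τ, p ∉ Ω → g p = 0) {x : Pt d} (hx : x ∉ Ω) : interp T g x = 0 := by
  by_cases h : ∃ τ ∈ T, x ∈ closedSimplex τ
  · obtain ⟨τ, hτ, hxτ⟩ := h
    rw [hT.interp_eq g hτ hxτ]
    refine Finset.sum_eq_zero fun p hp => ?_
    by_cases h0 : bary τ p x = 0
    · rw [h0, zero_mul]
    · rw [hg τ hτ p hp, mul_zero]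
      intro hpΩ
      refine hx (hT.mem_of_carrier hΩ hτ hpΩ (mem_closedSimplex_of_mem hp) hxτ fun q hq hqx => ?_)
      refine bary_ne (hT.isSimplex τ hτ) hp ?_
      rintro rfl
      exact h0 hqx
  · push Not at h
    exact interp_of_forall_notMem h

/-- A point near `x` either shares a simplex with `x`, where the function is affine, or is outside
`Ω`; then `x` is outside too and both values are zero. The sum of the slopes is a common constant.
-/
lemma exists_lipschitzWith_interp (hΩ : IsPolytope Ω) {g : Pt d → ℝ}
    (hg : ∀ τ ∈ T, ∀ p ∈ τ, p ∉ Ω → g p = 0) : ∃ C, LipschitzWith C (interp T g) := by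
  have hτC : ∀ τ ∈ T, ∃ C : ℝ, 0 ≤ C ∧ ∀ u, |interpDeriv τ g u| ≤ C * ‖u‖ := by
    intro τ _
    refine ⟨∑ p ∈ τ, ‖LinearMap.toContinuousLinearMap (bary τ p).linear‖ * |g p|,
      by positivity, fun u => ?_⟩
    rw [interpDeriv, Finset.sum_mul]
    refine (Finset.abs_sum_le_sum_abs _ _).trans (Finset.sum_le_sum fun p _ => ?_)
    rw [abs_mul, mul_right_comm]
    gcongr
    exact (LinearMap.toContinuousLinearMap (bary τ p).linear).le_opNorm u
  choose! C hC0 hC using hτC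
  refine ⟨(∑ τ ∈ T, C τ).toNNReal, lipschitzWith_of_eventually fun x => ?_⟩
  rw [Real.coe_toNNReal _ (Finset.sum_nonneg hC0)]
  have hΩev : ∀ᶠ y in 𝓝 x, x ∈ Ω → y ∈ Ω := by
    by_cases hx : x ∈ Ω
    · filter_upwards [hΩ.isOpen.mem_nhds hx] with y hy _ using hy
    · simp [hx]
  filter_upwards [eventually_mem_of_mem_closedSimplex T x, hΩev] with y hy hyΩ
  by_cases h : ∃ τ ∈ T, y ∈ closedSimplex τ
  · obtain ⟨τ, hτ, hyτ⟩ := h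
    have hxτ := hy τ hτ hyτ
    have e : y = x + (1 : ℝ) • (y - x) := by simp
    have h1 := hT.interp_add_smul g hτ (u := y - x) (t := 1) hxτ (by rwa [← e])
    rw [← e] at h1
    rw [h1, add_sub_cancel_left, one_mul]
    refine (hC τ hτ _).trans ?_
    gcongr
    exact Finset.single_le_sum hC0 hτ
  · have hyn : y ∉ Ω := fun hyΩ => h (hT.exists_mem (subset_closure hyΩ))
    rw [hT.interp_eq_zero hΩ hg hyn, hT.interp_eq_zero hΩ hg fun hx => hyn (hyΩ hx)]
    simp only [sub_zero, abs_zero]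
    exact mul_nonneg (Finset.sum_nonneg hC0) (norm_nonneg _)

lemma hasCompactSupport_interp (hΩ : IsPolytope Ω) (g : Pt d → ℝ) :
    HasCompactSupport (interp T g) := by
  refine HasCompactSupport.intro (hΩ.isBounded.isCompact_closure) fun x hx => ?_
  exact interp_of_forall_notMem fun τ hτ hxτ => hx (hT.closedSimplex_subset hτ hxτ)

lemma lineDeriv_interp (g : Pt d → ℝ) {τ : Finset (Pt d)} (hτ : τ ∈ T) {x : Pt d}
    (hx : x ∈ openSimplex τ) (u : Pt d) :
    lineDeriv ℝ (interp T g) x u = interpDeriv τ g u := by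
  have hc : Continuous fun t : ℝ => x + t • u := by fun_prop
  have hev : ∀ᶠ t : ℝ in 𝓝 0, x + t • u ∈ openSimplex τ := by
    have := hc.tendsto 0
    simp only [zero_smul, add_zero] at this
    exact this.eventually (isOpen_interior.mem_nhds hx)
  have hd : HasDerivAt (fun t : ℝ => interp T g x + t * interpDeriv τ g u)
      (interpDeriv τ g u) 0 := by
    simpa using ((hasDerivAt_id (0 : ℝ)).mul_const (interpDeriv τ g u)).const_add (interp T g x)
  refine (hd.congr_of_eventuallyEq ?_).deriv
  filter_upwards [hev] with t ht
  exact hT.interp_add_smul g hτ (openSimplex_subset _ hx) (openSimplex_subset _ ht)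

omit hT in
lemma lineDeriv_interp_eq_zero {g : Pt d → ℝ} {x : Pt d} (hx : ∀ τ ∈ T, x ∉ closedSimplex τ)
    (u : Pt d) : lineDeriv ℝ (interp T g) x u = 0 := by
  have hc : Continuous fun t : ℝ => x + t • u := by fun_prop
  have hev : ∀ᶠ t : ℝ in 𝓝 0, interp T g (x + t • u) = 0 := by
    have := hc.tendsto 0
    simp only [zero_smul, add_zero] at this
    filter_upwards [this.eventually (eventually_mem_of_mem_closedSimplex T x)] with t ht
    exact interp_of_forall_notMem fun τ hτ h => hx τ hτ (ht τ hτ h)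
  change deriv (fun t : ℝ => interp T g (x + t • u)) 0 = 0
  rw [Filter.EventuallyEq.deriv_eq (f := fun _ => (0 : ℝ)) hev]
  simp

omit hT in
lemma measurableSet_openSimplex (τ : Finset (Pt d)) : MeasurableSet (openSimplex τ) :=
  isOpen_interior.measurableSet

omit hT in
lemma volume_openSimplex_ne_top (τ : Finset (Pt d)) : volume (openSimplex τ) ≠ ⊤ :=
  ((measure_mono (openSimplex_subset τ)).trans_lt (isCompact_closedSimplex τ).measure_lt_top).ne

omit hT in
lemma ae_mem_openSimplex_of_mem (T : Finset (Finset (Pt d))) :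
    ∀ᵐ x : Pt d, ∀ τ ∈ T, x ∈ closedSimplex τ → x ∈ openSimplex τ := by
  refine (Filter.eventually_all_finset T).2 ?_
  intro τ _
  have h0 : volume (frontier (closedSimplex τ)) = 0 :=
    (convex_closedSimplex τ).addHaar_frontier volume
  filter_upwards [measure_eq_zero_iff_ae_notMem.1 h0] with x hx hxτ
  by_contra hn
  refine hx ?_
  rw [(isClosed_closedSimplex τ).frontier_eq]
  exact ⟨hxτ, hn⟩

lemma integral_lineDeriv_interp (f g : Pt d → ℝ) (u v : Pt d) :
    ∫ x, lineDeriv ℝ (interp T f) x u * lineDeriv ℝ (interp T g) x v =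
      ∑ τ ∈ T, volume.real (openSimplex τ) * (interpDeriv τ f u * interpDeriv τ g v) := by
  have hae : (fun x => lineDeriv ℝ (interp T f) x u * lineDeriv ℝ (interp T g) x v) =ᵐ[volume]
      fun x => ∑ τ ∈ T, (openSimplex τ).indicator
        (fun _ => interpDeriv τ f u * interpDeriv τ g v) x := by
    filter_upwards [ae_mem_openSimplex_of_mem T] with x hx
    by_cases h : ∃ τ ∈ T, x ∈ closedSimplex τ
    · obtain ⟨τ, hτ, hxτ⟩ := h
      have hxo := hx τ hτ hxτ
      rw [hT.lineDeriv_interp f hτ hxo, hT.lineDeriv_interp g hτ hxo, Finset.sum_eq_single τ]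
      · rw [Set.indicator_of_mem hxo]
      · intro τ' hτ' hne
        rw [Set.indicator_of_notMem]
        exact fun h' => hne (hT.eq_of_mem_openSimplex hτ hτ' hxo (openSimplex_subset _ h'))
      · exact fun hn => absurd hτ hn
    · push Not at h
      rw [lineDeriv_interp_eq_zero h, zero_mul, Finset.sum_eq_zero]
      intro τ hτ
      rw [Set.indicator_of_notMem fun h' => h τ hτ (openSimplex_subset _ h')]
  rw [integral_congr_ae hae, integral_finsetSum]
  · refine Finset.sum_congr rfl fun τ _ => ?_
    rw [integral_indicator_const _ (measurableSet_openSimplex τ), smul_eq_mul]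
  · intro τ _
    exact (integrable_indicator_iff (measurableSet_openSimplex τ)).2
      (integrableOn_const (volume_openSimplex_ne_top τ))

/-- **Korn's first inequality** for continuous piecewise affine vector fields vanishing on the
boundary. -/
lemma korn_interp (hΩ : IsPolytope Ω) {w : Pt d → Pt d}
    (hw : ∀ τ ∈ T, ∀ p ∈ τ, p ∉ Ω → w p = 0) (A : Finset (Pt d) → Matrix (Fin d) (Fin d) ℝ)
    (hA : ∀ τ ∈ T, ∀ i j,
      A τ i j = interpDeriv τ (fun p => w p i) (EuclideanSpace.single j 1)) :
    ∑ τ ∈ T, volume.real (openSimplex τ) * ∑ i, ∑ j, A τ i j ^ 2 ≤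
      2 * ∑ τ ∈ T, volume.real (openSimplex τ) *
        ∑ i, ∑ j, ((1 / 2 : ℝ) * (A τ i j + A τ j i)) ^ 2 := by
  have hcomm : ∀ i j, ∑ τ ∈ T, volume.real (openSimplex τ) * (A τ i j * A τ j i) =
      ∑ τ ∈ T, volume.real (openSimplex τ) * (A τ i i * A τ j j) := by
    intro i j
    obtain ⟨C, hC⟩ := hT.exists_lipschitzWith_interp hΩ (g := fun p => w p i)
      (fun τ hτ p hp hpΩ => by simp [hw τ hτ p hp hpΩ])
    obtain ⟨D, hD⟩ := hT.exists_lipschitzWith_interp hΩ (g := fun p => w p j)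
      (fun τ hτ p hp hpΩ => by simp [hw τ hτ p hp hpΩ])
    have h := integral_lineDeriv_mul_lineDeriv_comm (μ := volume) hC
      (hT.hasCompactSupport_interp hΩ _) hD (hT.hasCompactSupport_interp hΩ _)
      (EuclideanSpace.single i 1) (EuclideanSpace.single j 1)
    rw [hT.integral_lineDeriv_interp, hT.integral_lineDeriv_interp] at h
    rw [Finset.sum_congr rfl fun τ hτ => by rw [hA τ hτ i j, hA τ hτ j i], h]
    refine Finset.sum_congr rfl fun τ hτ => ?_
    rw [hA τ hτ i i, hA τ hτ j j]; ring
  have hpt : ∀ τ, ∑ i, ∑ j, A τ i j ^ 2 = 2 * ∑ i, ∑ j, ((1 / 2 : ℝ) * (A τ i j + A τ j i)) ^ 2 -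
      ∑ i, ∑ j, A τ i j * A τ j i := by
    intro τ
    have hsw : ∑ i, ∑ j, A τ j i ^ 2 = ∑ i, ∑ j, A τ i j ^ 2 := Finset.sum_comm
    have hex : ∑ i, ∑ j, ((1 / 2 : ℝ) * (A τ i j + A τ j i)) ^ 2 =
        (1 / 4) * ∑ i, ∑ j, A τ i j ^ 2 + (1 / 4) * ∑ i, ∑ j, A τ j i ^ 2 +
          (1 / 2) * ∑ i, ∑ j, A τ i j * A τ j i := by
      simp only [Finset.mul_sum, ← Finset.sum_add_distrib]
      refine Finset.sum_congr rfl fun i _ => Finset.sum_congr rfl fun j _ => ?_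
      ring
    rw [hex, hsw]; ring
  -- After summation the cross term is the integral of the squared divergence, which enters with a
  -- minus sign and can be dropped.
  have hcross : ∑ τ ∈ T, volume.real (openSimplex τ) * ∑ i, ∑ j, A τ i j * A τ j i =
      ∑ τ ∈ T, volume.real (openSimplex τ) * (∑ i, A τ i i) ^ 2 := by
    simp only [sq, Finset.sum_mul_sum]
    simp only [Finset.mul_sum]
    rw [Finset.sum_comm, Finset.sum_comm (s := T)]
    refine Finset.sum_congr rfl fun i _ => ?_
    rw [Finset.sum_comm, Finset.sum_comm (s := T)]
    exact Finset.sum_congr rfl fun j _ => hcomm i j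
  simp only [hpt, mul_sub, Finset.sum_sub_distrib]
  rw [hcross, Finset.mul_sum]
  have hnn : 0 ≤ ∑ τ ∈ T, volume.real (openSimplex τ) * (∑ i, A τ i i) ^ 2 :=
    Finset.sum_nonneg fun τ _ => by positivity
  have he : ∀ τ, volume.real (openSimplex τ) *
      (2 * ∑ i, ∑ j, ((1 / 2 : ℝ) * (A τ i j + A τ j i)) ^ 2) =
      2 * (volume.real (openSimplex τ) *
        ∑ i, ∑ j, ((1 / 2 : ℝ) * (A τ i j + A τ j i)) ^ 2) := fun τ => by ring
  simp only [he]
  linarith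

end IsMatchingSimplicialMesh

end Interp

/-! ### Shape regularity -/

section Shape

variable {d : ℕ}

lemma diam_openSimplex {τ : Finset (Pt d)} (h : IsSimplexVertexSet τ) :
    Metric.diam (openSimplex τ) = Metric.diam (closedSimplex τ) := by
  rw [← closure_openSimplex h, Metric.diam_closure]

lemma dist_le_diam_openSimplex {τ : Finset (Pt d)} (h : IsSimplexVertexSet τ) {x y : Pt d}
    (hx : x ∈ closedSimplex τ) (hy : y ∈ closedSimplex τ) :
    dist x y ≤ Metric.diam (openSimplex τ) := by
  rw [diam_openSimplex h]
  exact Metric.dist_le_diam_of_mem (isCompact_closedSimplex τ).isBounded hx hy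

lemma diam_openSimplex_pos (hd : 1 ≤ d) {τ : Finset (Pt d)} (h : IsSimplexVertexSet τ) :
    0 < Metric.diam (openSimplex τ) := by
  obtain ⟨a, ha, b, hb, hab⟩ := Finset.one_lt_card.1 (show 1 < τ.card by rw [h.1]; omega)
  exact (dist_pos.2 hab).trans_le
    (dist_le_diam_openSimplex h (mem_closedSimplex_of_mem ha) (mem_closedSimplex_of_mem hb))

lemma exists_ball_subset_of_lt_inradius {S : Set (Pt d)} {r : ℝ}
    (hS : r < inradius S) : ∃ c, Metric.ball c r ⊆ S := by
  have hne : {r : ℝ | 0 ≤ r ∧ ∃ c : Pt d, Metric.ball c r ⊆ S}.Nonempty :=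
    ⟨0, le_rfl, 0, by simp⟩
  obtain ⟨r', ⟨-, c, hc⟩, hr'⟩ := exists_lt_of_lt_csSup hne hS
  exact ⟨c, (Metric.ball_subset_ball hr'.le).trans hc⟩

/-- `τ` contains a ball of radius `κ` times its diameter. -/
def HasInnerBall (κ : ℝ) (τ : Finset (Pt d)) : Prop :=
  ∃ c, Metric.ball c (κ * Metric.diam (openSimplex τ)) ⊆ openSimplex τ

/-- The inradius is a supremum, so some ratio below `ρ` is needed to produce an actual ball; one
half is an arbitrary choice. -/
lemma hasInnerBall_of_inradius (hd : 1 ≤ d) {τ : Finset (Pt d)} (h : IsSimplexVertexSet τ) {ρ : ℝ}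
    (hρ : 0 < ρ) (hr : ρ * Metric.diam (openSimplex τ) ≤ inradius (openSimplex τ)) :
    HasInnerBall (ρ / 2) τ := by
  have hpos := diam_openSimplex_pos hd h
  exact exists_ball_subset_of_lt_inradius (lt_of_lt_of_le (by nlinarith) hr)

variable {κ : ℝ} {τ : Finset (Pt d)}

/-- The coordinate stays in [0, 1] on the ball, so it varies by at most 1 between two opposite
points at distance `r / 2` from the centre. -/
lemma abs_bary_linear_le (h : IsSimplexVertexSet τ) {c : Pt d} {r : ℝ} (hr : 0 < r)
    (hball : Metric.ball c r ⊆ closedSimplex τ) (p u : Pt d) :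
    |(bary τ p).linear u| ≤ ‖u‖ / r := by
  rcases eq_or_ne u 0 with rfl | hu
  · simp
  have hu' : 0 < ‖u‖ := norm_pos_iff.2 hu
  set s := r / (2 * ‖u‖) with hs
  have hspos : 0 < s := by positivity
  have hmem : ∀ t : ℝ, |t| = s → c + t • u ∈ closedSimplex τ := by
    intro t ht
    apply hball
    rw [Metric.mem_ball, dist_eq_norm, add_sub_cancel_left, norm_smul, Real.norm_eq_abs, ht, hs]
    field_simp
    norm_num
  have h1 := hmem s (abs_of_pos hspos)
  have h2 := hmem (-s) (by rw [abs_neg, abs_of_pos hspos])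
  have a1 := bary_nonneg h h1 p
  have a2 := bary_le_one h h1 p
  have b1 := bary_nonneg h h2 p
  have b2 := bary_le_one h h2 p
  rw [affineMap_add_smul] at a1 a2 b1 b2
  have hle : |s * (bary τ p).linear u| ≤ 1 / 2 := by
    rw [abs_le]; constructor <;> linarith
  rw [abs_mul, abs_of_pos hspos, hs] at hle
  rw [le_div_iff₀ hr]
  have e : r / (2 * ‖u‖) * |(bary τ p).linear u| = |(bary τ p).linear u| * r / (2 * ‖u‖) := by
    ring
  rw [e, div_le_iff₀ (by positivity)] at hle
  linarith

lemma HasInnerBall.abs_bary_linear_le (hb : HasInnerBall κ τ) (hd : 1 ≤ d) (hκ : 0 < κ)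
    (h : IsSimplexVertexSet τ) (p u : Pt d) :
    |(bary τ p).linear u| ≤ ‖u‖ / (κ * Metric.diam (openSimplex τ)) := by
  obtain ⟨c, hc⟩ := hb
  exact DDR.abs_bary_linear_le h (mul_pos hκ (diam_openSimplex_pos hd h))
    (hc.trans (openSimplex_subset τ)) p u

/-- The edges of a shape regular simplex are not short. -/
lemma HasInnerBall.le_dist (hb : HasInnerBall κ τ) (hd : 1 ≤ d) (hκ : 0 < κ)
    (h : IsSimplexVertexSet τ) {a b : Pt d} (ha : a ∈ τ) (hbτ : b ∈ τ) (hab : a ≠ b) :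
    κ * Metric.diam (openSimplex τ) ≤ dist a b := by
  have hpos := mul_pos hκ (diam_openSimplex_pos hd h)
  have h1 := hb.abs_bary_linear_le hd hκ h a (a - b)
  have h2 := (bary τ a).linearMap_vsub a b
  rw [vsub_eq_sub, vsub_eq_sub, bary_self h ha, bary_ne h hbτ hab] at h2
  rw [h2, sub_zero, abs_one, le_div_iff₀ hpos, one_mul] at h1
  rwa [dist_eq_norm]

/-- Shape regular simplices sharing a facet have comparable diameters. -/
lemma HasInnerBall.diam_le_of_facet (hb : HasInnerBall κ τ) (hd : 2 ≤ d) (hκ : 0 < κ)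
    (h : IsSimplexVertexSet τ) {τ' : Finset (Pt d)} (h' : IsSimplexVertexSet τ') {x₀ : Pt d}
    (hsub : ∀ p ∈ τ, p ≠ x₀ → p ∈ τ') :
    κ * Metric.diam (openSimplex τ) ≤ Metric.diam (openSimplex τ') := by
  classical
  -- For `d ≥ 2` a facet contains an edge, which is short in neither simplex relative to `τ`.
  have hcard : 1 < (τ.erase x₀).card := by
    have := Finset.pred_card_le_card_erase (s := τ) (a := x₀)
    rw [h.1] at this; omega
  obtain ⟨a, ha, b, hb', hab⟩ := Finset.one_lt_card.1 hcard
  rw [Finset.mem_erase] at ha hb'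
  exact (hb.le_dist (by omega) hκ h ha.2 hb'.2 hab).trans
    (dist_le_diam_openSimplex h' (mem_closedSimplex_of_mem (hsub a ha.2 ha.1))
      (mem_closedSimplex_of_mem (hsub b hb'.2 hb'.1)))

/-- Packing: disjoint balls of radius `r` in a ball of radius `R`. -/
lemma card_mul_pow_le {ι : Type*} (s : Finset ι) (c : ι → Pt d) {r R : ℝ} (hr : 0 < r)
    (hR : 0 < R) (x : Pt d) (hsub : ∀ i ∈ s, Metric.ball (c i) r ⊆ Metric.closedBall x R)
    (hdisj : ∀ i ∈ s, ∀ j ∈ s, i ≠ j → Disjoint (Metric.ball (c i) r) (Metric.ball (c j) r)) :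
    s.card * r ^ d ≤ R ^ d := by
  have h1 : volume.real (⋃ i ∈ s, Metric.ball (c i) r) ≤ volume.real (Metric.closedBall x R) :=
    measureReal_mono (Set.iUnion₂_subset hsub) Metric.isBounded_closedBall.measure_lt_top.ne
  rw [measureReal_biUnion_finset (fun i hi j hj hij => hdisj i hi j hj hij)
    fun i _ => measurableSet_ball] at h1
  have hv : 0 < volume.real (Metric.ball (0 : Pt d) 1) :=
    ENNReal.toReal_pos (Metric.measure_ball_pos _ _ one_pos).ne'
      Metric.isBounded_ball.measure_lt_top.ne
  have hball : ∀ y : Pt d, volume.real (Metric.ball y r) =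
      r ^ d * volume.real (Metric.ball (0 : Pt d) 1) := fun y => by
    rw [measureReal_def, Measure.addHaar_ball_of_pos _ _ hr, ENNReal.toReal_mul,
      ENNReal.toReal_ofReal (by positivity), finrank_euclideanSpace_fin, measureReal_def]
  have hcball : volume.real (Metric.closedBall x R) =
      R ^ d * volume.real (Metric.ball (0 : Pt d) 1) := by
    rw [measureReal_def, Measure.addHaar_closedBall _ _ hR.le, ENNReal.toReal_mul,
      ENNReal.toReal_ofReal (by positivity), finrank_euclideanSpace_fin, measureReal_def]
  simp only [hball, hcball, Finset.sum_const, nsmul_eq_mul] at h1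
  rw [← mul_assoc] at h1
  exact le_of_mul_le_mul_right h1 hv

lemma volume_openSimplex_le (h : IsSimplexVertexSet τ) :
    volume.real (openSimplex τ) ≤
      volume.real (Metric.ball (0 : Pt d) 1) * Metric.diam (openSimplex τ) ^ d := by
  obtain ⟨x, hx⟩ := openSimplex_nonempty h
  have hsub : openSimplex τ ⊆ Metric.closedBall x (Metric.diam (openSimplex τ)) := fun y hy =>
    dist_le_diam_openSimplex h (openSimplex_subset _ hy) (openSimplex_subset _ hx)
  refine (measureReal_mono hsub Metric.isBounded_closedBall.measure_lt_top.ne).trans_eq ?_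
  rw [measureReal_def, Measure.addHaar_closedBall _ _ Metric.diam_nonneg, ENNReal.toReal_mul,
    ENNReal.toReal_ofReal (pow_nonneg Metric.diam_nonneg _), finrank_euclideanSpace_fin,
    measureReal_def, mul_comm]

variable {Ω : Set (Pt d)} {T : Finset (Finset (Pt d))}

open Classical in
/-- The number of shape regular simplices around a point is bounded. -/
lemma IsMatchingSimplicialMesh.card_star_mul_le (hT : IsMatchingSimplicialMesh Ω T) (hd : 1 ≤ d)
    (hκ : 0 < κ) (hb : ∀ τ ∈ T, HasInnerBall κ τ) (x : Pt d) :
    ((T.filter fun τ => x ∈ closedSimplex τ).card : ℝ) * κ ^ d ≤ 1 := by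
  set Tx := T.filter fun τ => x ∈ closedSimplex τ with hTx
  rcases Tx.eq_empty_or_nonempty with he | hne
  · simp [he]
  obtain ⟨τ₀, hτ₀, hmin⟩ := Tx.exists_min_image (fun τ => Metric.diam (openSimplex τ)) hne
  have hTxT : ∀ τ ∈ Tx, τ ∈ T ∧ x ∈ closedSimplex τ := fun τ hτ => Finset.mem_filter.1 hτ
  set δ := Metric.diam (openSimplex τ₀) with hδ
  have hδ0 : 0 < δ := diam_openSimplex_pos hd (hT.isSimplex _ (hTxT _ hτ₀).1)
  choose! c hc using hb
  -- Shrink each simplex towards `x` by a homothety to the smallest diameter `δ`. The images of the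
  -- inner balls are disjoint, of radius `κ * δ`, and lie within `δ` of `x`, whatever the original
  -- sizes.
  have hsub : ∀ τ ∈ Tx, Metric.ball (AffineMap.lineMap x (c τ)
      (δ / Metric.diam (openSimplex τ)) : Pt d) (κ * δ) ⊆ openSimplex τ ∩ Metric.closedBall x δ := by
    intro τ hτ y hy
    obtain ⟨hτT, hxτ⟩ := hTxT τ hτ
    have hs := hT.isSimplex τ hτT
    have hpos := diam_openSimplex_pos hd hs
    set h := Metric.diam (openSimplex τ) with hh
    have hle : δ ≤ h := hmin τ hτ
    have ht0 : 0 < δ / h := by positivity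
    have ht1 : δ / h ≤ 1 := (div_le_one hpos).2 hle
    set z : Pt d := x + (h / δ) • (y - x) with hz
    have hyz : y = AffineMap.lineMap x z (δ / h) := by
      rw [AffineMap.lineMap_apply, hz, vsub_eq_sub, vadd_eq_add, add_sub_cancel_left, smul_smul,
        div_mul_div_cancel₀ hpos.ne', div_self hδ0.ne', one_smul, sub_add_cancel]
    have hzball : z ∈ Metric.ball (c τ) (κ * h) := by
      rw [Metric.mem_ball, dist_eq_norm] at hy ⊢
      have e : z - c τ = (h / δ) • (y - AffineMap.lineMap x (c τ) (δ / h)) := by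
        rw [hz, AffineMap.lineMap_apply, vsub_eq_sub, vadd_eq_add, smul_sub, smul_sub, smul_add,
          smul_smul, div_mul_div_cancel₀ hδ0.ne', div_self hpos.ne', one_smul]
        abel
      rw [e, norm_smul, Real.norm_eq_abs, abs_of_pos (by positivity)]
      calc h / δ * _ < h / δ * (κ * δ) := by gcongr
        _ = κ * h := by field_simp
    have hzo := hc τ hτT hzball
    refine ⟨hyz ▸ lineMap_mem_openSimplex hs hxτ hzo ⟨ht0, ht1⟩, ?_⟩
    rw [hyz, Metric.mem_closedBall, dist_lineMap_left, Real.norm_eq_abs, abs_of_pos ht0]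
    have := dist_le_diam_openSimplex hs hxτ (openSimplex_subset _ hzo)
    calc δ / h * dist x z ≤ δ / h * h := by gcongr
      _ = δ := by field_simp
  have hcard := card_mul_pow_le Tx (fun τ => (AffineMap.lineMap x (c τ)
      (δ / Metric.diam (openSimplex τ)) : Pt d)) (mul_pos hκ hδ0) hδ0 x
    (fun τ hτ => (hsub τ hτ).trans Set.inter_subset_right) (fun τ hτ τ' hτ' hne => by
      refine Set.disjoint_left.2 fun y hy hy' => hne ?_
      exact hT.eq_of_mem_openSimplex (hTxT τ' hτ').1 (hTxT τ hτ).1 (hsub τ' hτ' hy').1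
        (openSimplex_subset _ (hsub τ hτ hy).1))
  rw [mul_pow, ← mul_assoc] at hcard
  exact le_of_mul_le_mul_right (by linarith) (pow_pos hδ0 d)

open Classical in
/-- The number of simplices in a cell of comparable size is bounded. -/
lemma IsMatchingSimplicialMesh.card_cell_mul_le (hT : IsMatchingSimplicialMesh Ω T) (hd : 1 ≤ d)
    {κ ρ : ℝ} (hκ : 0 < κ) (hρ : 0 < ρ) (hb : ∀ τ ∈ T, HasInnerBall κ τ) {K : Set (Pt d)}
    (hK : Bornology.IsBounded K) (S : Finset (Finset (Pt d))) (hS : S ⊆ T)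
    (hSK : ∀ τ ∈ S, openSimplex τ ⊆ K ∧ ρ * Metric.diam K ≤ Metric.diam (openSimplex τ)) :
    (S.card : ℝ) * (κ * ρ) ^ d ≤ 1 := by
  rcases S.eq_empty_or_nonempty with he | ⟨τ₀, hτ₀⟩
  · simp [he]
  obtain ⟨x, hx⟩ := openSimplex_nonempty (hT.isSimplex τ₀ (hS hτ₀))
  have hxK := (hSK τ₀ hτ₀).1 hx
  have hpos : 0 < Metric.diam K :=
    (diam_openSimplex_pos hd (hT.isSimplex τ₀ (hS hτ₀))).trans_le
      (Metric.diam_mono (hSK τ₀ hτ₀).1 hK)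
  choose! c hc using hb
  have hsub : ∀ τ ∈ S, Metric.ball (c τ) (κ * ρ * Metric.diam K) ⊆ openSimplex τ := by
    intro τ hτ
    refine (Metric.ball_subset_ball ?_).trans (hc τ (hS hτ))
    rw [mul_assoc]
    gcongr
    exact (hSK τ hτ).2
  have hcard := card_mul_pow_le S c (r := κ * ρ * Metric.diam K) (by positivity) hpos x
    (fun τ hτ y hy => Metric.dist_le_diam_of_mem hK ((hSK τ hτ).1 (hsub τ hτ hy)) hxK)
    (fun τ hτ τ' hτ' hne => by
      refine Set.disjoint_left.2 fun y hy hy' => hne ?_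
      exact hT.eq_of_mem_openSimplex (hS hτ') (hS hτ) (hsub τ' hτ' hy')
        (openSimplex_subset _ (hsub τ hτ hy)))
  rw [mul_pow, ← mul_assoc] at hcard
  exact le_of_mul_le_mul_right (by linarith) (pow_pos hpos d)

end Shape

/-! ### The affine reconstruction in the cells -/

lemma interpDeriv_affineMap {d : ℕ} {τ : Finset (Pt d)}
    (h : IsSimplexVertexSet τ) (f : Pt d →ᵃ[ℝ] ℝ) (u : Pt d) :
    interpDeriv τ f u = f.linear u := by
  have h1 := affineMap_eq_sum h f u
  have h0 := affineMap_eq_sum h f 0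
  have hf : f u = f.linear u + f 0 := by simpa using f.map_vadd 0 u
  have e : f.linear u = f u - f 0 := by linarith
  rw [e, h1, h0, ← Finset.sum_sub_distrib, interpDeriv]
  refine Finset.sum_congr rfl fun p _ => ?_
  have hp : bary τ p u = (bary τ p).linear u + bary τ p 0 := by
    simpa using (bary τ p).map_vadd 0 u
  rw [hp, smul_eq_mul, smul_eq_mul]; ring

namespace PolytopalMesh

variable {d : ℕ} {Ω : Set (Pt d)} {M : PolytopalMesh d Ω}

namespace Choices

variable (D : M.Choices) (v : M.Dofs) (K : M.cells)

/-- The displacement reconstruction as an affine map. -/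
noncomputable def dispAffine : Pt d →ᵃ[ℝ] Pt d where
  toFun := D.dispCell v K
  linear := Matrix.toEuclideanLin (D.gradCell v K)
  map_vadd' x u := by
    simp only [dispCell, vadd_eq_add]
    rw [add_sub_assoc, ← add_assoc]
    congr 1
    ext i
    simp [Matrix.toEuclideanLin, Matrix.mulVec_add]

@[simp]
lemma dispAffine_apply (x : Pt d) : D.dispAffine v K x = D.dispCell v K x := rfl

/-- Interpolation reproduces affine functions. Hence the gradient error of a conforming field is the
interpolated gradient of its nodal difference with the reconstruction. -/
lemma gradCell_eq_interpDeriv {τ : Finset (Pt d)} (h : IsSimplexVertexSet τ) (i j : Fin d) :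
    D.gradCell v K i j =
      interpDeriv τ (fun p => D.dispCell v K p i) (EuclideanSpace.single j 1) := by
  have h1 := interpDeriv_affineMap h
    ((EuclideanSpace.proj i : Pt d →L[ℝ] ℝ).toLinearMap.toAffineMap.comp
      (D.dispAffine v K)) (EuclideanSpace.single j 1)
  have h2 : interpDeriv τ (fun p => D.dispCell v K p i) (EuclideanSpace.single j 1) = _ := h1
  rw [h2]
  simp [dispAffine, Matrix.toEuclideanLin]

/-- A bound for the defect of the reconstruction at the nodes of a cell. -/
noncomputable def nodalDefect : ℝ := √(D.stabCell K v v / Metric.diam (K : Set (Pt d)) ^ (d - 2))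

lemma stabCell_nonneg : 0 ≤ D.stabCell K v v := by
  unfold stabCell
  have h1 : 0 ≤ Metric.diam (K : Set (Pt d)) ^ (d - 2) := pow_nonneg Metric.diam_nonneg _
  refine add_nonneg (mul_nonneg h1 (Finset.sum_nonneg fun s _ => real_inner_self_nonneg))
    (mul_nonneg h1 (Finset.sum_nonneg fun σ _ => mul_self_nonneg _))

variable {D v K}

lemma norm_sub_dispCell_le (hK : 0 < Metric.diam (K : Set (Pt d))) {s : M.nodes}
    (hs : s ∈ M.nodesOfCell K) : ‖v.1 s - D.dispCell v K s‖ ≤ D.nodalDefect v K := by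
  have hpow : 0 < Metric.diam (K : Set (Pt d)) ^ (d - 2) := pow_pos hK _
  refine Real.le_sqrt_of_sq_le ?_
  rw [le_div_iff₀ hpow]
  unfold stabCell
  have h1 : ‖v.1 s - D.dispCell v K s‖ ^ 2 ≤ ∑ s ∈ M.nodesOfCell K,
      inner ℝ (v.1 s - D.dispCell v K s) (v.1 s - D.dispCell v K s) := by
    rw [← real_inner_self_eq_norm_sq]
    exact Finset.single_le_sum (f := fun s : M.nodes =>
      inner ℝ (v.1 s - D.dispCell v K s) (v.1 s - D.dispCell v K s))
      (fun s _ => real_inner_self_nonneg) hs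
  have h2 : 0 ≤ ∑ σ ∈ M.facesOf K, v.2 σ * v.2 σ :=
    Finset.sum_nonneg fun σ _ => mul_self_nonneg _
  have h3 := mul_le_mul_of_nonneg_left h1 hpow.le
  have h4 := mul_nonneg hpow.le h2
  linarith

/-- Lets the scaling by the cell diameter be replaced by the diameter of a simplex inside the cell.
-/
lemma pow_mul_nodalDefect_sq_le {h : ℝ} (h0 : 0 < h) (hle : h ≤ Metric.diam (K : Set (Pt d))) :
    h ^ (d - 2) * D.nodalDefect v K ^ 2 ≤ D.stabCell K v v := by
  have hS := D.stabCell_nonneg v K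
  have hpow : 0 < Metric.diam (K : Set (Pt d)) ^ (d - 2) := pow_pos (h0.trans_le hle) _
  rw [nodalDefect, Real.sq_sqrt (by positivity)]
  have : h ^ (d - 2) ≤ Metric.diam (K : Set (Pt d)) ^ (d - 2) := by gcongr
  calc h ^ (d - 2) * _ ≤ Metric.diam (K : Set (Pt d)) ^ (d - 2) *
        (D.stabCell K v v / Metric.diam (K : Set (Pt d)) ^ (d - 2)) := by gcongr
    _ = D.stabCell K v v := by field_simp

lemma nodesOfFace_subset {σ : M.faces} (hσ : (σ : Set (Pt d)) ⊆ frontier (K : Set (Pt d)))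
    {s : M.nodes} (hs : (s : Pt d) ∈ closure (σ : Set (Pt d)) \ σ) : s ∈ M.nodesOfCell K := by
  classical
  refine Finset.mem_biUnion.2 ⟨σ, Finset.mem_filter.2 ⟨Finset.mem_univ _, hσ⟩, ?_⟩
  exact Finset.mem_filter.2 ⟨Finset.mem_univ _, hs⟩

/-- An affine function is bounded on a face by its values at the nodes of the face. -/
lemma norm_affineMap_le_of_face (hd : d = 2 ∨ d = 3) (hΩ : IsPolytope Ω) {σ : Set (Pt d)}
    (hσ : σ ∈ M.faces) (f : Pt d →ᵃ[ℝ] Pt d) {m : ℝ}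
    (hm : ∀ s : M.nodes, (s : Pt d) ∈ closure σ \ σ → ‖f s‖ ≤ m) {x : Pt d} (hx : x ∈ closure σ) :
    ‖f x‖ ≤ m := by
  have hconv : Convex ℝ {y | ‖f y‖ ≤ m} := by
    have : Convex ℝ (f ⁻¹' Metric.closedBall 0 m) := (convex_closedBall 0 m).affine_preimage f
    simpa [Set.preimage] using this
  exact convexHull_min (fun s hs => hm ⟨s, hs.1⟩ hs.2) hconv
    (M.closure_face_subset_convexHull hd hΩ hσ hx)

/-- At a node of the common face both reconstructions approximate the same nodal value; their
difference is affine, so the nodes control it on the whole closed face. -/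
lemma norm_dispCell_sub_le (hd : d = 2 ∨ d = 3) (hΩ : IsPolytope Ω) {L : M.cells}
    (hK : 0 < Metric.diam (K : Set (Pt d))) (hL : 0 < Metric.diam (L : Set (Pt d)))
    {σ : Set (Pt d)} (hσ : σ ∈ M.faces) (hσK : σ ⊆ frontier (K : Set (Pt d)))
    (hσL : σ ⊆ frontier (L : Set (Pt d))) {x : Pt d} (hx : x ∈ closure σ) :
    ‖D.dispCell v K x - D.dispCell v L x‖ ≤ D.nodalDefect v K + D.nodalDefect v L := by
  refine norm_affineMap_le_of_face hd hΩ hσ (D.dispAffine v K - D.dispAffine v L)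
    (fun s hs => ?_) hx
  have h1 := norm_sub_dispCell_le hK (D := D) (v := v)
    (nodesOfFace_subset (σ := ⟨σ, hσ⟩) hσK hs)
  have h2 := norm_sub_dispCell_le hL (D := D) (v := v)
    (nodesOfFace_subset (σ := ⟨σ, hσ⟩) hσL hs)
  have e : (D.dispAffine v K - D.dispAffine v L) s =
      (v.1 s - D.dispCell v L s) - (v.1 s - D.dispCell v K s) := by
    simp
  rw [e]
  linarith [norm_sub_le (v.1 s - D.dispCell v L s) (v.1 s - D.dispCell v K s)]

/-- The nodes of a boundary face lie on the boundary of `Ω`, where the nodal values vanish. -/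
lemma norm_dispCell_le (hd : d = 2 ∨ d = 3) (hΩ : IsPolytope Ω) (hv : v ∈ M.dofsZero)
    (hK : 0 < Metric.diam (K : Set (Pt d)))
    {σ : Set (Pt d)} (hσ : σ ∈ M.faces) (hσK : σ ⊆ frontier (K : Set (Pt d)))
    (hσΩ : σ ⊆ frontier Ω) {x : Pt d} (hx : x ∈ closure σ) :
    ‖D.dispCell v K x‖ ≤ D.nodalDefect v K := by
  refine norm_affineMap_le_of_face hd hΩ hσ (D.dispAffine v K) (fun s hs => ?_) hx
  have h1 := norm_sub_dispCell_le hK (D := D) (v := v)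
    (nodesOfFace_subset (σ := ⟨σ, hσ⟩) hσK hs)
  rw [hv.1 s (isClosed_frontier.closure_subset_iff.2 hσΩ hs.1), zero_sub, norm_neg] at h1
  exact h1

end Choices

end PolytopalMesh

/-! ### Chains of adjacent simplices around a vertex -/

section Chain

variable {d : ℕ} {Ω : Set (Pt d)} {T : Finset (Finset (Pt d))}

/-- Values attached to the simplices around a point, with controlled jumps through the facets
containing that point, are close to each other if the point is interior, and are small
otherwise. -/
lemma IsMatchingSimplicialMesh.norm_sub_le_of_chain (hT : IsMatchingSimplicialMesh Ω T)
    (hΩ : IsPolytope Ω) (hd : 1 ≤ d) {x : Pt d} {N : ℕ}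
    (hN : ∀ S ⊆ T, (∀ τ ∈ S, x ∈ closedSimplex τ) → S.card ≤ N)
    {E : Type*} [NormedAddCommGroup E] {P : Finset (Pt d) → E} {J h : Finset (Pt d) → ℝ} {κ : ℝ}
    (hJ : ∀ τ ∈ T, 0 ≤ J τ) (hκ : κ ∈ Set.Ioc (0 : ℝ) 1) (hh : ∀ τ ∈ T, 0 < h τ)
    (hadj : ∀ τ ∈ T, ∀ τ' ∈ T, ∀ x₀ ∈ τ, x ∈ closedSimplex τ → bary τ x₀ x = 0 →
      (∀ p ∈ τ, p ≠ x₀ → p ∈ τ') → ‖P τ - P τ'‖ ≤ J τ + J τ' ∧ κ * h τ ≤ h τ')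
    (hbd : ∀ τ ∈ T, ∀ x₀ ∈ τ, x ∈ closedSimplex τ → bary τ x₀ x = 0 → ¬ IsSharedFacet T τ x₀ →
      ‖P τ‖ ≤ J τ)
    {τ₀ : Finset (Pt d)} (hτ₀ : τ₀ ∈ T) (hx : x ∈ closedSimplex τ₀) {m : ℝ}
    (hm : ∀ τ ∈ T, x ∈ closedSimplex τ → κ ^ N * h τ₀ ≤ h τ → J τ ≤ m) :
    (x ∈ Ω ∧ ∀ τ ∈ T, x ∈ closedSimplex τ → ‖P τ₀ - P τ‖ ≤ (2 * N + 1) * m) ∨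
      (x ∉ Ω ∧ ‖P τ₀‖ ≤ (2 * N + 1) * m) := by
  classical
  -- Families around `x` whose cardinality measures the loss: each added simplex costs one factor
  -- `κ` in size and two defects, at most `2 * m`, in distance. A family of maximal cardinality is
  -- closed under adjacency, so no explicit paths are needed.
  set 𝒬 : Finset (Finset (Finset (Pt d))) := T.powerset.filter fun 𝒰 => τ₀ ∈ 𝒰 ∧
    ∀ τ ∈ 𝒰, x ∈ closedSimplex τ ∧ κ ^ 𝒰.card * h τ₀ ≤ h τ ∧
      ‖P τ₀ - P τ‖ ≤ 2 * 𝒰.card * m with h𝒬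
  have hJm : ∀ (n : ℕ), n ≤ N → ∀ τ ∈ T, x ∈ closedSimplex τ → κ ^ n * h τ₀ ≤ h τ → J τ ≤ m := by
    intro n hn τ hτ hxτ hle
    refine hm τ hτ hxτ (le_trans ?_ hle)
    have := pow_le_pow_of_le_one hκ.1.le hκ.2 hn
    have := (hh τ₀ hτ₀).le
    gcongr
  have hN1 : 1 ≤ N := by
    simpa using hN {τ₀} (by simpa using hτ₀) (by simpa using hx)
  have hκh : κ ^ 1 * h τ₀ ≤ h τ₀ := by
    rw [pow_one]; exact mul_le_of_le_one_left (hh τ₀ hτ₀).le hκ.2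
  have hm0 : 0 ≤ m := (hJ τ₀ hτ₀).trans (hJm 1 hN1 τ₀ hτ₀ hx hκh)
  obtain ⟨𝒰, h𝒰, hmax⟩ := 𝒬.exists_max_image Finset.card
    ⟨{τ₀}, Finset.mem_filter.2 ⟨by simpa using hτ₀, by simp, by
      simp only [Finset.mem_singleton, forall_eq, Finset.card_singleton]
      exact ⟨hx, hκh, by simp [hm0]⟩⟩⟩
  obtain ⟨h𝒰T, hτ₀𝒰, hprop⟩ := Finset.mem_filter.1 h𝒰
  rw [Finset.mem_powerset] at h𝒰T
  have hcard : 𝒰.card ≤ N := hN 𝒰 h𝒰T fun τ hτ => (hprop τ hτ).1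
  have hcard' : (𝒰.card : ℝ) ≤ N := by exact_mod_cast hcard
  have hclosed : ∀ τ ∈ 𝒰, ∀ x₀ ∈ τ, bary τ x₀ x = 0 → ∀ τ' ∈ T,
      (∀ p ∈ τ, p ≠ x₀ → p ∈ τ') → τ' ∈ 𝒰 := by
    intro τ hτ x₀ hx₀ hx0 τ' hτ' hsub
    by_contra hn
    have hxτ' := hT.mem_closedSimplex_of_facet (h𝒰T hτ) hsub (hprop τ hτ).1 hx0
    obtain ⟨hP, hκτ⟩ := hadj τ (h𝒰T hτ) τ' hτ' x₀ hx₀ (hprop τ hτ).1 hx0 hsub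
    have hins : (insert τ' 𝒰).card = 𝒰.card + 1 := Finset.card_insert_of_notMem hn
    have hinsN : 𝒰.card + 1 ≤ N := by
      rw [← hins]
      refine hN _ (Finset.insert_subset hτ' h𝒰T) fun ρ hρ => ?_
      rcases Finset.mem_insert.1 hρ with rfl | hρ
      · exact hxτ'
      · exact (hprop ρ hρ).1
    have hτ'h : κ ^ (𝒰.card + 1) * h τ₀ ≤ h τ' := by
      refine le_trans ?_ hκτ
      rw [pow_succ', mul_assoc]
      have := hκ.1
      gcongr
      exact (hprop τ hτ).2.1
    have hJ1 := hJm _ hcard τ (h𝒰T hτ) (hprop τ hτ).1 (hprop τ hτ).2.1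
    have hJ2 := hJm _ hinsN τ' hτ' hxτ' hτ'h
    have hmem : insert τ' 𝒰 ∈ 𝒬 := by
      refine Finset.mem_filter.2 ⟨Finset.mem_powerset.2 (Finset.insert_subset hτ' h𝒰T),
        Finset.mem_insert_of_mem hτ₀𝒰, fun ρ hρ => ?_⟩
      rw [hins]
      push_cast
      rcases Finset.mem_insert.1 hρ with rfl | hρ
      · refine ⟨hxτ', hτ'h, ?_⟩
        have h1 := (hprop τ hτ).2.2
        have h2 := norm_sub_le_norm_sub_add_norm_sub (P τ₀) (P τ) (P ρ)
        linarith
      · obtain ⟨a, b, c⟩ := hprop ρ hρ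
        refine ⟨a, le_trans ?_ b, by linarith⟩
        have h1 := pow_le_pow_of_le_one hκ.1.le hκ.2 (Nat.le_succ 𝒰.card)
        have h2 := (hh τ₀ hτ₀).le
        gcongr
    have := hmax _ hmem
    omega
  have hle : ∀ τ ∈ 𝒰, ‖P τ₀ - P τ‖ ≤ 2 * N * m := fun τ hτ =>
    (hprop τ hτ).2.2.trans (by gcongr)
  -- Without a boundary facet through `x` the family is the whole star of `x`. With one, `x` is
  -- outside `Ω` and the boundary bound adds one more `m`, whence `2 * N + 1`.
  by_cases hall : ∀ τ ∈ 𝒰, ∀ x₀ ∈ τ, bary τ x₀ x = 0 → IsSharedFacet T τ x₀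
  · obtain ⟨hxΩ, hstar⟩ := hT.mem_of_adjacent_closed hΩ h𝒰T ⟨τ₀, hτ₀𝒰⟩
      (fun τ hτ => (hprop τ hτ).1)
      fun τ hτ x₀ hx₀ hx0 => ⟨hall τ hτ x₀ hx₀ hx0, hclosed τ hτ x₀ hx₀ hx0⟩
    refine Or.inl ⟨hxΩ, fun τ hτ hxτ => ?_⟩
    have := hle τ (hstar τ hτ hxτ)
    linarith
  · push Not at hall
    obtain ⟨τ, hτ, x₀, hx₀, hx0, hns⟩ := hall
    have hxτ := (hprop τ hτ).1
    refine Or.inr ⟨fun hxΩ => ?_, ?_⟩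
    · have hcl := mem_closure_openFacet (hT.isSimplex τ (h𝒰T hτ)) hd hx₀ hxτ hx0
      exact hΩ.isOpen.isClosed_compl.closure_subset_iff.2 (fun y hy =>
        hT.notMem_of_not_isSharedFacet hΩ (h𝒰T hτ) hx₀ hy hns) hcl hxΩ
    · have h1 := hbd τ (h𝒰T hτ) x₀ hx₀ hxτ hx0 hns
      have h2 := hJm _ hcard τ (h𝒰T hτ) hxτ (hprop τ hτ).2.1
      have h3 := hle τ hτ
      have h4 : ‖P τ₀‖ ≤ ‖P τ₀ - P τ‖ + ‖P τ‖ := by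
        simpa using norm_add_le (P τ₀ - P τ) (P τ)
      linarith

end Chain

/-! ### Conforming approximation of the piecewise affine reconstruction -/

section Approx

variable {d : ℕ}

/-- Inverse estimate for affine functions on a shape regular simplex. -/
lemma HasInnerBall.volume_mul_sum_interpDeriv_sq_le {κ : ℝ} {τ : Finset (Pt d)}
    (hb : HasInnerBall κ τ) (hd : 2 ≤ d) (hκ : 0 < κ) (h : IsSimplexVertexSet τ)
    (δ : Pt d → Pt d) :
    volume.real (openSimplex τ) *
      ∑ i, ∑ j, interpDeriv τ (fun p => δ p i) (EuclideanSpace.single j 1) ^ 2 ≤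
      volume.real (Metric.ball (0 : Pt d) 1) * (d * (d + 1)) / κ ^ 2 *
        (Metric.diam (openSimplex τ) ^ (d - 2) * ∑ p ∈ τ, ‖δ p‖ ^ 2) := by
  set η := Metric.diam (openSimplex τ) with hη
  have hη0 : 0 < η := diam_openSimplex_pos (by omega) h
  have h1 : ∀ i j, interpDeriv τ (fun p => δ p i) (EuclideanSpace.single j 1) ^ 2 ≤
      (d + 1) / (κ * η) ^ 2 * ∑ p ∈ τ, δ p i ^ 2 := by
    intro i j
    -- Cauchy–Schwarz over the `d + 1` vertices; each coordinate has slope at most `1 / (κ * η)`.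
    have h2 := sq_sum_le_card_mul_sum_sq (s := τ)
      (f := fun p => (bary τ p).linear (EuclideanSpace.single j 1) * δ p i)
    rw [h.1] at h2
    refine h2.trans ?_
    push_cast
    rw [div_mul_eq_mul_div, mul_div_assoc]
    gcongr
    rw [Finset.sum_div]
    refine Finset.sum_le_sum fun p _ => ?_
    have h3 := hb.abs_bary_linear_le (by omega) hκ h p (EuclideanSpace.single j (1 : ℝ))
    rw [show ‖EuclideanSpace.single j (1 : ℝ)‖ = 1 by simp] at h3
    have h4 := sq_le_sq' (by linarith [neg_abs_le ((bary τ p).linear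
      (EuclideanSpace.single j (1 : ℝ))), h3]) ((le_abs_self _).trans h3)
    rw [mul_pow, div_eq_inv_mul, ← one_div]
    rw [div_pow, one_pow] at h4
    gcongr
  have h5 : ∑ i, ∑ j, interpDeriv τ (fun p => δ p i) (EuclideanSpace.single j 1) ^ 2 ≤
      d * (d + 1) / (κ * η) ^ 2 * ∑ p ∈ τ, ‖δ p‖ ^ 2 := by
    calc _ ≤ ∑ i : Fin d, ∑ _j : Fin d, (d + 1) / (κ * η) ^ 2 * ∑ p ∈ τ, δ p i ^ 2 :=
          Finset.sum_le_sum fun i _ => Finset.sum_le_sum fun j _ => h1 i j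
      _ = _ := by
          simp only [Finset.sum_const, Finset.card_univ, Fintype.card_fin, nsmul_eq_mul,
            EuclideanSpace.real_norm_sq_eq]
          rw [← Finset.mul_sum, ← Finset.mul_sum, Finset.sum_comm]
          ring
  calc _ ≤ volume.real (Metric.ball (0 : Pt d) 1) * η ^ d *
        (d * (d + 1) / (κ * η) ^ 2 * ∑ p ∈ τ, ‖δ p‖ ^ 2) := by
        gcongr
        exact volume_openSimplex_le h
    _ = _ := by
        obtain ⟨k, rfl⟩ := Nat.exists_eq_add_of_le hd
        rw [Nat.add_sub_cancel_left]
        field_simp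
        ring

variable {Ω : Set (Pt d)} {M : PolytopalMesh d Ω} {T : Finset (Finset (Pt d))}

namespace PolytopalMesh

open Classical in
/-- The sum of the local stabilisations over the simplices having `p` as a vertex. -/
noncomputable def Choices.starStab (D : M.Choices) (v : M.Dofs) (T : Finset (Finset (Pt d)))
    (cell : Finset (Pt d) → M.cells) (p : Pt d) : ℝ :=
  ∑ τ ∈ T.filter fun τ => p ∈ τ, D.stabCell (cell τ) v v

/-- The nodal values of a conforming approximation of the piecewise affine reconstruction. -/
lemma IsMatchingSubmesh.exists_conforming (hT : M.IsMatchingSubmesh T) (hd : d = 2 ∨ d = 3)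
    (hΩ : IsPolytope Ω) {κ : ℝ} (hκ : κ ∈ Set.Ioc (0 : ℝ) 1) (hb : ∀ τ ∈ T, HasInnerBall κ τ)
    {N : ℕ} (hN : (κ ^ d)⁻¹ ≤ N) {cell : Finset (Pt d) → M.cells}
    (hcell : ∀ τ ∈ T, openSimplex τ ⊆ cell τ) (D : M.Choices) {v : M.Dofs} (hv : v ∈ M.dofsZero) :
    ∃ w : Pt d → Pt d, (∀ p, p ∉ Ω → w p = 0) ∧ ∀ τ ∈ T, ∀ p ∈ τ,
      Metric.diam (openSimplex τ) ^ (d - 2) * ‖w p - D.dispCell v (cell τ) p‖ ^ 2 ≤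
        (2 * N + 1) ^ 2 / (κ ^ N) ^ (d - 2) * D.starStab v T cell p := by
  classical
  have hd2 : 2 ≤ d := by omega
  have hsim := hT.isMesh.isSimplex
  have hdiam : ∀ τ ∈ T, 0 < Metric.diam (openSimplex τ) := fun τ hτ =>
    diam_openSimplex_pos (by omega) (hsim τ hτ)
  have hKb : ∀ τ, Bornology.IsBounded (cell τ : Set (Pt d)) := fun τ =>
    hΩ.isBounded.subset (M.cell_subset hΩ (cell τ).2)
  have hle : ∀ τ ∈ T, Metric.diam (openSimplex τ) ≤ Metric.diam (cell τ : Set (Pt d)) :=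
    fun τ hτ => Metric.diam_mono (hcell τ hτ) (hKb τ)
  have hKpos : ∀ τ ∈ T, 0 < Metric.diam (cell τ : Set (Pt d)) := fun τ hτ =>
    (hdiam τ hτ).trans_le (hle τ hτ)
  have hcard : ∀ x, ∀ S ⊆ T, (∀ τ ∈ S, x ∈ closedSimplex τ) → S.card ≤ N := by
    intro x S hS hSx
    have h1 := hT.isMesh.card_star_mul_le (by omega) hκ.1 hb x
    have h2 : S.card ≤ (T.filter fun τ => x ∈ closedSimplex τ).card :=
      Finset.card_le_card fun τ hτ => Finset.mem_filter.2 ⟨hS hτ, hSx τ hτ⟩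
    have h3 := (le_div_iff₀ (pow_pos hκ.1 d)).2 h1
    rw [one_div] at h3
    exact h2.trans (by exact_mod_cast h3.trans hN)
  have key : ∀ τ₀ ∈ T, ∀ p ∈ τ₀, ∃ m : ℝ,
      Metric.diam (openSimplex τ₀) ^ (d - 2) * m ^ 2 =
        (2 * N + 1) ^ 2 / (κ ^ N) ^ (d - 2) * D.starStab v T cell p ∧
      ((p ∈ Ω ∧ ∀ τ ∈ T, p ∈ closedSimplex τ →
          ‖D.dispCell v (cell τ₀) p - D.dispCell v (cell τ) p‖ ≤ m) ∨
        (p ∉ Ω ∧ ‖D.dispCell v (cell τ₀) p‖ ≤ m)) := by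
    intro τ₀ hτ₀ p hp
    set F := D.starStab v T cell p with hF
    have hF0 : 0 ≤ F := Finset.sum_nonneg fun τ _ => D.stabCell_nonneg v _
    have hκN : 0 < κ ^ N := pow_pos hκ.1 N
    have h0 := hdiam τ₀ hτ₀
    have hpow : 0 < (κ ^ N * Metric.diam (openSimplex τ₀)) ^ (d - 2) := by positivity
    -- The square root bounds the defect of every cell met by the chain: its simplices have diameter
    -- at least `κ ^ N` times that of `τ₀`, and their stabilisations are summands of `F`.
    refine ⟨(2 * N + 1) * √(F / (κ ^ N * Metric.diam (openSimplex τ₀)) ^ (d - 2)), ?_, ?_⟩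
    · rw [mul_pow, Real.sq_sqrt (by positivity), mul_pow]
      field_simp
    · refine hT.isMesh.norm_sub_le_of_chain hΩ (by omega) (hcard p)
        (P := fun τ => D.dispCell v (cell τ) p) (J := fun τ => D.nodalDefect v (cell τ))
        (h := fun τ => Metric.diam (openSimplex τ)) (fun τ _ => Real.sqrt_nonneg _) hκ hdiam
        ?_ ?_ hτ₀ (mem_closedSimplex_of_mem hp) ?_
      · intro τ hτ τ' hτ' x₀ hx₀ hx hx0 hsub
        refine ⟨?_, (hb τ hτ).diam_le_of_facet hd2 hκ.1 (hsim τ hτ) (hsim τ' hτ') hsub⟩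
        by_cases hc : cell τ = cell τ'
        · rw [hc, sub_self, norm_zero]
          exact add_nonneg (Real.sqrt_nonneg _) (Real.sqrt_nonneg _)
        · obtain ⟨σ, hσ, h1, h2, h3⟩ := hT.exists_interface hd hΩ hτ hτ' hx₀ hsub (cell τ).2
            (cell τ').2 (fun h => hc (Subtype.ext h)) (hcell τ hτ) (hcell τ' hτ')
          exact Choices.norm_dispCell_sub_le hd hΩ (hKpos τ hτ) (hKpos τ' hτ') hσ h1 h2
            (h3 p hx hx0)
      · intro τ hτ x₀ hx₀ hx hx0 hns
        obtain ⟨σ, hσ, h1, h2, h3⟩ := hT.exists_boundary_face hd hΩ hτ hx₀ hns (cell τ).2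
          (hcell τ hτ)
        exact Choices.norm_dispCell_le hd hΩ hv (hKpos τ hτ) hσ h1 h2 (h3 p hx hx0)
      · intro τ hτ hpτ hκτ
        refine Real.le_sqrt_of_sq_le ?_
        rw [le_div_iff₀ hpow, mul_comm]
        have hpmem : p ∈ τ := hT.isMesh.mem_of_bary_ne_zero hτ₀ hτ (mem_closedSimplex_of_mem hp)
          hpτ (by rw [bary_self (hsim τ₀ hτ₀) hp]; exact one_ne_zero)
        calc _ ≤ Metric.diam (openSimplex τ) ^ (d - 2) * D.nodalDefect v (cell τ) ^ 2 := by
              gcongr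
          _ ≤ D.stabCell (cell τ) v v := Choices.pow_mul_nodalDefect_sq_le (hdiam τ hτ) (hle τ hτ)
          _ ≤ F := Finset.single_le_sum (f := fun τ => D.stabCell (cell τ) v v)
              (fun τ _ => D.stabCell_nonneg v _) (Finset.mem_filter.2 ⟨hτ, hpmem⟩)
  -- Any simplex around an interior vertex may supply the value, since `key` compares all of them.
  refine ⟨fun p => if h : p ∈ Ω ∧ ∃ τ ∈ T, p ∈ closedSimplex τ then
    D.dispCell v (cell h.2.choose) p else 0, fun p hp => dif_neg fun h => hp h.1, ?_⟩
  intro τ hτ p hp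
  obtain ⟨m, hm, hbound⟩ := key τ hτ p hp
  rw [← hm]
  gcongr
  rcases hbound with ⟨hpΩ, hall⟩ | ⟨hpΩ, hle⟩
  · have h : p ∈ Ω ∧ ∃ τ ∈ T, p ∈ closedSimplex τ := ⟨hpΩ, τ, hτ, mem_closedSimplex_of_mem hp⟩
    beta_reduce
    rw [dif_pos h, norm_sub_rev]
    exact hall _ h.2.choose_spec.1 h.2.choose_spec.2
  · beta_reduce
    rw [dif_neg fun h => hpΩ h.1, zero_sub, norm_neg]
    exact hle

-- Double counting: each star sum is repeated at most `N` times, each simplex occurs in the stars of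
-- its `d + 1` vertices, and each cell contains at most `N'` simplices.
open Classical in
lemma Choices.sum_starStab_le (D : M.Choices) (v : M.Dofs) (cell : Finset (Pt d) → M.cells)
    (hT : ∀ τ ∈ T, τ.card = d + 1) {N N' : ℕ} (hN : ∀ p, (T.filter fun τ => p ∈ τ).card ≤ N)
    (hN' : ∀ K, (T.filter fun τ => cell τ = K).card ≤ N') :
    ∑ τ ∈ T, ∑ p ∈ τ, D.starStab v T cell p ≤ N * (d + 1) * N' * D.stab v v := by
  have hS := D.stabCell_nonneg v
  have h1 : ∑ τ ∈ T, ∑ p ∈ τ, D.starStab v T cell p =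
      ∑ p ∈ T.biUnion id, ∑ _τ ∈ T.filter (fun τ => p ∈ τ), D.starStab v T cell p := by
    refine Finset.sum_comm' fun τ p => ?_
    simp only [Finset.mem_biUnion, Finset.mem_filter, id]
    exact ⟨fun h => ⟨h, τ, h⟩, fun h => h.1⟩
  have h2 : ∑ p ∈ T.biUnion id, D.starStab v T cell p =
      ∑ τ ∈ T, ∑ _p ∈ τ, D.stabCell (cell τ) v v := by
    refine Finset.sum_comm' fun p τ => ?_
    simp only [Finset.mem_biUnion, Finset.mem_filter, id]
    exact ⟨fun h => ⟨h.2.2, h.2.1⟩, fun h => ⟨⟨τ, h.2, h.1⟩, h.2, h.1⟩⟩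
  have h3 : ∑ τ ∈ T, D.stabCell (cell τ) v v ≤ N' * D.stab v v := by
    rw [← Finset.sum_fiberwise T cell, Choices.stab, Finset.mul_sum]
    refine Finset.sum_le_sum fun K _ => ?_
    have e : ∑ τ ∈ T.filter (fun τ => cell τ = K), D.stabCell (cell τ) v v =
        ∑ _τ ∈ T.filter (fun τ => cell τ = K), D.stabCell K v v :=
      Finset.sum_congr rfl fun τ hτ => by rw [(Finset.mem_filter.1 hτ).2]
    rw [e, Finset.sum_const, nsmul_eq_mul]
    have := hS K
    gcongr
    exact_mod_cast hN' K
  calc ∑ τ ∈ T, ∑ p ∈ τ, D.starStab v T cell p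
      ≤ ∑ p ∈ T.biUnion id, N * D.starStab v T cell p := by
        rw [h1]
        refine Finset.sum_le_sum fun p _ => ?_
        rw [Finset.sum_const, nsmul_eq_mul]
        have : 0 ≤ D.starStab v T cell p := Finset.sum_nonneg fun τ _ => hS _
        gcongr
        exact_mod_cast hN p
    _ = N * ((d + 1) * ∑ τ ∈ T, D.stabCell (cell τ) v v) := by
        rw [← Finset.mul_sum, h2]
        congr 1
        rw [Finset.mul_sum]
        refine Finset.sum_congr rfl fun τ hτ => ?_
        rw [Finset.sum_const, hT τ hτ, nsmul_eq_mul]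
        push_cast; rfl
    _ ≤ N * ((d + 1) * (N' * D.stab v v)) := by gcongr
    _ = _ := by ring

end PolytopalMesh

end Approx

/-! ### Norms of the discrete gradients -/

section Norms

variable {d : ℕ} {Ω : Set (Pt d)}

lemma l2Norm_const_sq (X : Set (Pt d)) (A : Matrix (Fin d) (Fin d) ℝ) :
    l2Norm X (fun _ => A) ^ 2 = volume.real X * ∑ i, ∑ j, A i j ^ 2 := by
  rw [l2Norm, setIntegral_const, smul_eq_mul, Real.sq_sqrt]
  exact mul_nonneg measureReal_nonneg
    (Finset.sum_nonneg fun i _ => Finset.sum_nonneg fun j _ => sq_nonneg _)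

namespace PolytopalMesh

variable {M : PolytopalMesh d Ω} {T : Finset (Finset (Pt d))}

namespace Choices

variable (D : M.Choices) (v : M.Dofs)

lemma grad_of_mem {K : M.cells} {x : Pt d} (hx : x ∈ (K : Set (Pt d))) :
    D.grad v x = D.gradCell v K := by
  rw [grad, Finset.sum_eq_single K]
  · rw [Set.indicator_of_mem hx]
  · intro L _ hne
    rw [Set.indicator_of_notMem fun hL => hne (Subtype.ext (M.eq_of_mem_cell L.2 K.2 hL hx))]
  · simp

lemma grad_of_notMem {x : Pt d} (hx : ∀ K : M.cells, x ∉ (K : Set (Pt d))) : D.grad v x = 0 :=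
  Finset.sum_eq_zero fun K _ => Set.indicator_of_notMem (hx K) _

lemma l2Norm_symGrad_sq (hΩ : IsPolytope Ω) :
    l2Norm Ω (D.symGrad v) ^ 2 = ∑ K : M.cells, M.cellMeasure K *
      ∑ i, ∑ j, ((1 / 2 : ℝ) * (D.gradCell v K i j + D.gradCell v K j i)) ^ 2 := by
  have hpt : (fun x => ∑ i, ∑ j, D.symGrad v x i j ^ 2) = fun x => ∑ K : M.cells,
      (K : Set (Pt d)).indicator (fun _ =>
        ∑ i, ∑ j, ((1 / 2 : ℝ) * (D.gradCell v K i j + D.gradCell v K j i)) ^ 2) x := by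
    ext x
    by_cases h : ∃ K : M.cells, x ∈ (K : Set (Pt d))
    · obtain ⟨K, hK⟩ := h
      rw [Finset.sum_eq_single K]
      · rw [Set.indicator_of_mem hK, symGrad, D.grad_of_mem v hK]
        simp
      · intro L _ hne
        rw [Set.indicator_of_notMem fun hL => hne (Subtype.ext (M.eq_of_mem_cell L.2 K.2 hL hK))]
      · simp
    · push Not at h
      rw [Finset.sum_eq_zero fun K _ => Set.indicator_of_notMem (h K) _, symGrad,
        D.grad_of_notMem v h]
      simp
  have hnn : 0 ≤ ∫ x in Ω, ∑ i, ∑ j, D.symGrad v x i j ^ 2 := integral_nonneg fun x =>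
    Finset.sum_nonneg fun i _ => Finset.sum_nonneg fun j _ => sq_nonneg _
  refine (Real.sq_sqrt hnn).trans
    ((congrArg (fun f : Pt d → ℝ => ∫ x in Ω, f x) hpt).trans ?_)
  beta_reduce
  rw [integral_finsetSum]
  · refine Finset.sum_congr rfl fun K _ => ?_
    rw [setIntegral_indicator (M.isOpen_cell K.2).measurableSet,
      Set.inter_eq_self_of_subset_right (M.cell_subset hΩ K.2), setIntegral_const, smul_eq_mul]
    rfl
  · intro K _
    refine (integrable_indicator_iff (M.isOpen_cell K.2).measurableSet).2 (integrableOn_const ?_)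
    exact ((Measure.restrict_apply_le _ _).trans_lt
      (hΩ.isBounded.subset (M.cell_subset hΩ K.2)).measure_lt_top).ne

lemma normOne_sq : D.normOne v ^ 2 =
    ∑ K : M.cells, M.cellMeasure K * ∑ i, ∑ j, D.gradCell v K i j ^ 2 + D.stab v v := by
  rw [normOne, Real.sq_sqrt (Finset.sum_nonneg fun K _ => sq_nonneg _), stab,
    ← Finset.sum_add_distrib]
  refine Finset.sum_congr rfl fun K _ => ?_
  rw [normCell, Real.sq_sqrt (add_nonneg (sq_nonneg _) (D.stabCell_nonneg v K)), l2Norm_const_sq]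
  rfl

end Choices

open Classical in
/-- The submesh splits each cell into simplices. -/
lemma IsMatchingSubmesh.cellMeasure_eq (hT : M.IsMatchingSubmesh T) (hΩ : IsPolytope Ω)
    {cell : Finset (Pt d) → M.cells} (hcell : ∀ τ ∈ T, openSimplex τ ⊆ cell τ) (K : M.cells) :
    M.cellMeasure K = ∑ τ ∈ T.filter (fun τ => cell τ = K), volume.real (openSimplex τ) := by
  have hae : (K : Set (Pt d)) =ᵐ[volume]
      (⋃ τ ∈ T.filter (fun τ => cell τ = K), openSimplex τ : Set (Pt d)) := by
    filter_upwards [IsMatchingSimplicialMesh.ae_mem_openSimplex_of_mem T] with x hx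
    apply propext
    change x ∈ (K : Set (Pt d)) ↔ x ∈ (⋃ τ ∈ T.filter (fun τ => cell τ = K), openSimplex τ)
    simp only [Set.mem_iUnion, Finset.mem_filter, exists_prop]
    constructor
    · intro hxK
      obtain ⟨τ, hτ, hxτ⟩ := hT.isMesh.exists_mem (subset_closure (M.cell_subset hΩ K.2 hxK))
      have hxo := hx τ hτ hxτ
      exact ⟨τ, ⟨hτ, Subtype.ext (M.eq_of_mem_cell (cell τ).2 K.2 (hcell τ hτ hxo) hxK)⟩, hxo⟩
    · rintro ⟨τ, ⟨hτ, rfl⟩, hxo⟩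
      exact hcell τ hτ hxo
  rw [cellMeasure, measureReal_congr hae, measureReal_biUnion_finset
    (h := fun τ _ => IsMatchingSimplicialMesh.volume_openSimplex_ne_top τ)]
  · intro τ hτ τ' hτ' hne
    refine Set.disjoint_left.2 fun x hx hx' => hne ?_
    exact hT.isMesh.eq_of_mem_openSimplex (Finset.mem_filter.1 hτ').1 (Finset.mem_filter.1 hτ).1
      hx' (openSimplex_subset _ hx)
  · exact fun τ _ => IsMatchingSimplicialMesh.measurableSet_openSimplex τ

/-- Transfers the norms, defined cell by cell, to the submesh on which the conforming Korn
inequality is stated. -/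
lemma IsMatchingSubmesh.sum_cellMeasure_mul (hT : M.IsMatchingSubmesh T) (hΩ : IsPolytope Ω)
    {cell : Finset (Pt d) → M.cells} (hcell : ∀ τ ∈ T, openSimplex τ ⊆ cell τ)
    (f : M.cells → ℝ) :
    ∑ K : M.cells, M.cellMeasure K * f K =
      ∑ τ ∈ T, volume.real (openSimplex τ) * f (cell τ) := by
  classical
  rw [← Finset.sum_fiberwise T cell]
  refine Finset.sum_congr rfl fun K _ => ?_
  rw [hT.cellMeasure_eq hΩ hcell, Finset.sum_mul]
  refine Finset.sum_congr ?_ fun τ hτ => by rw [(Finset.mem_filter.1 hτ).2]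
  congr

end PolytopalMesh

end Norms

/-! ### Perturbation of Frobenius norms and of symmetric parts -/

section Matrices

variable {d : ℕ}

lemma sum_sq_le_two_mul_add (A G : Matrix (Fin d) (Fin d) ℝ) :
    ∑ i, ∑ j, G i j ^ 2 ≤ 2 * ∑ i, ∑ j, A i j ^ 2 + 2 * ∑ i, ∑ j, (A i j - G i j) ^ 2 := by
  simp only [Finset.mul_sum, ← Finset.sum_add_distrib]
  refine Finset.sum_le_sum fun i _ => Finset.sum_le_sum fun j _ => ?_
  nlinarith [sq_nonneg (2 * A i j - G i j)]

lemma sum_sym_sq_le (A : Matrix (Fin d) (Fin d) ℝ) :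
    ∑ i, ∑ j, ((1 / 2 : ℝ) * (A i j + A j i)) ^ 2 ≤ ∑ i, ∑ j, A i j ^ 2 := by
  have hsw : ∑ i, ∑ j, A j i ^ 2 = ∑ i, ∑ j, A i j ^ 2 := Finset.sum_comm
  have : ∑ i, ∑ j, ((1 / 2 : ℝ) * (A i j + A j i)) ^ 2 ≤
      (1 / 2) * ∑ i, ∑ j, A i j ^ 2 + (1 / 2) * ∑ i, ∑ j, A j i ^ 2 := by
    simp only [Finset.mul_sum, ← Finset.sum_add_distrib]
    refine Finset.sum_le_sum fun i _ => Finset.sum_le_sum fun j _ => ?_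
    nlinarith [sq_nonneg (A i j - A j i)]
  rw [hsw] at this
  linarith

/-- Symmetrisation does not increase the Frobenius norm, so the full difference of the matrices
bounds that of their symmetric parts. -/
lemma sum_sym_sq_le_two_mul_add (A G : Matrix (Fin d) (Fin d) ℝ) :
    ∑ i, ∑ j, ((1 / 2 : ℝ) * (A i j + A j i)) ^ 2 ≤
      2 * ∑ i, ∑ j, ((1 / 2 : ℝ) * (G i j + G j i)) ^ 2 +
        2 * ∑ i, ∑ j, (A i j - G i j) ^ 2 := by
  have h1 := sum_sq_le_two_mul_add (fun i j => (1 / 2 : ℝ) * (G i j + G j i))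
    (fun i j => (1 / 2 : ℝ) * (A i j + A j i))
  have h2 := sum_sym_sq_le (A - G)
  have e : ∑ i, ∑ j, ((1 / 2 : ℝ) * (G i j + G j i) - (1 / 2 : ℝ) * (A i j + A j i)) ^ 2 =
      ∑ i, ∑ j, ((1 / 2 : ℝ) * ((A - G) i j + (A - G) j i)) ^ 2 := by
    refine Finset.sum_congr rfl fun i _ => Finset.sum_congr rfl fun j _ => ?_
    simp only [Matrix.sub_apply]; ring
  simp only [Matrix.sub_apply] at h2
  simp only [Matrix.sub_apply] at e
  linarith

end Matrices

/-- **Discrete Korn inequality**, with a constant depending only on the dimension and on the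
regularity parameter of the mesh. -/
theorem discrete_korn {d : ℕ} (hd : d = 2 ∨ d = 3) {ρ : ℝ} (hρ : ρ ∈ Set.Ioo (0 : ℝ) 1) :
    ∃ C : ℝ, 0 < C ∧ ∀ (Ω : Set (Pt d)), IsPolytope Ω → ∀ (M : PolytopalMesh d Ω), M.IsRegular ρ →
      ∀ (D : M.Choices) (v : M.Dofs), v ∈ M.dofsZero →
        D.normOne v ^ 2 ≤ C * (l2Norm Ω (D.symGrad v) ^ 2 + D.stab v v) := by
  classical
  have hd1 : 1 ≤ d := by omega
  have hκ : ρ / 2 ∈ Set.Ioc (0 : ℝ) 1 := ⟨by linarith [hρ.1], by linarith [hρ.2]⟩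
  set κ := ρ / 2 with hκdef
  -- `N` bounds the number of simplices around a point and `N'` the number in a cell; both depend on
  -- `d` and `ρ` only.
  obtain ⟨N, hN⟩ := exists_nat_ge (κ ^ d)⁻¹
  obtain ⟨N', hN'⟩ := exists_nat_ge ((κ * ρ) ^ d)⁻¹
  set C₁ : ℝ := volume.real (Metric.ball (0 : Pt d) 1) * (d * (d + 1)) / κ ^ 2 with hC₁
  set C₂ : ℝ := (2 * N + 1) ^ 2 / (κ ^ N) ^ (d - 2) with hC₂
  set C₃ : ℝ := C₁ * (C₂ * (N * (d + 1) * N')) with hC₃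
  have hκ0 := hκ.1
  have hC₁0 : 0 ≤ C₁ := by positivity
  have hC₂0 : 0 ≤ C₂ := by positivity
  have hC₃0 : 0 ≤ C₃ := by positivity
  -- With Z the squared gradient error and S the stabilisation, |G|² ≤ 2|A|² + 2Z, |A|² ≤ 2|sym A|²
  -- and |sym A|² ≤ 2|sym G|² + 2Z give |G|² ≤ 8|sym G|² + 10Z. Here Z ≤ `C₃` S, and the norm adds
  -- one more S: 9 = 8 + 1.
  refine ⟨10 * C₃ + 9, by positivity, fun Ω hΩ M hM D v hv => ?_⟩
  obtain ⟨T, hT, hreg, hreg'⟩ := hM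
  have hsim := hT.isMesh.isSimplex
  have hcells : ∃ K, K ∈ M.cells := by
    obtain ⟨x, hx⟩ := hΩ.1.nonempty
    have := subset_closure hx
    rw [M.cells_cover] at this
    simp only [Set.mem_iUnion, exists_prop] at this
    obtain ⟨K, hK, -⟩ := this
    exact ⟨K, hK⟩
  have : Nonempty M.cells := let ⟨K, hK⟩ := hcells; ⟨⟨K, hK⟩⟩
  have hex : ∀ τ ∈ T, ∃ K : M.cells, openSimplex τ ⊆ K := fun τ hτ => by
    obtain ⟨K, ⟨hK, hKτ⟩, -⟩ := hT.simplex_subset_cell τ hτ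
    exact ⟨⟨K, hK⟩, hKτ⟩
  choose! cell hcell using hex
  have hb : ∀ τ ∈ T, HasInnerBall κ τ := fun τ hτ =>
    hasInnerBall_of_inradius hd1 (hsim τ hτ) hρ.1 (hreg τ hτ)
  obtain ⟨w, hw0, hw⟩ := hT.exists_conforming hd hΩ hκ hb hN hcell D hv
  set A : Finset (Pt d) → Matrix (Fin d) (Fin d) ℝ := fun τ => Matrix.of fun i j =>
    interpDeriv τ (fun p => w p i) (EuclideanSpace.single j 1) with hA
  set G : Finset (Pt d) → Matrix (Fin d) (Fin d) ℝ := fun τ => D.gradCell v (cell τ) with hG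
  have hkorn := hT.isMesh.korn_interp hΩ (w := w) (fun τ _ p _ hp => hw0 p hp) A
    fun τ _ i j => rfl
  have hS : 0 ≤ D.stab v v := Finset.sum_nonneg fun K _ => D.stabCell_nonneg v K
  -- the conforming approximation is controlled by the stabilisation
  have hZ : ∑ τ ∈ T, volume.real (openSimplex τ) * ∑ i, ∑ j, (A τ i j - G τ i j) ^ 2 ≤
      C₃ * D.stab v v := by
    calc _ ≤ ∑ τ ∈ T, C₁ * (C₂ * ∑ p ∈ τ, D.starStab v T cell p) := by
          refine Finset.sum_le_sum fun τ hτ => ?_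
          have h1 := (hb τ hτ).volume_mul_sum_interpDeriv_sq_le (by omega) hκ0 (hsim τ hτ)
            fun p => w p - D.dispCell v (cell τ) p
          have h2 : ∀ i j, A τ i j - G τ i j = interpDeriv τ
              (fun p => (w p - D.dispCell v (cell τ) p) i) (EuclideanSpace.single j 1) := by
            intro i j
            simp only [hA, hG, Matrix.of_apply, D.gradCell_eq_interpDeriv v (cell τ) (hsim τ hτ),
              interpDeriv, ← Finset.sum_sub_distrib]
            refine Finset.sum_congr rfl fun p _ => ?_
            rw [PiLp.sub_apply]; ring
          simp only [h2]
          refine h1.trans (mul_le_mul_of_nonneg_left ?_ hC₁0)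
          rw [Finset.mul_sum, Finset.mul_sum]
          exact Finset.sum_le_sum fun p hp => hw τ hτ p hp
      _ = C₁ * (C₂ * ∑ τ ∈ T, ∑ p ∈ τ, D.starStab v T cell p) := by
          simp only [Finset.mul_sum]
      _ ≤ C₁ * (C₂ * (N * (d + 1) * N' * D.stab v v)) := by
          gcongr
          refine D.sum_starStab_le v cell (fun τ hτ => (hsim τ hτ).1) (fun p => ?_) fun K => ?_
          · have h1 := hT.isMesh.card_star_mul_le hd1 hκ0 hb p
            have h2 := (le_div_iff₀ (pow_pos hκ0 d)).2 h1
            rw [one_div] at h2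
            refine le_trans (Finset.card_le_card fun τ hτ => ?_) (Nat.cast_le.1 (h2.trans hN))
            rw [Finset.mem_filter] at hτ ⊢
            exact ⟨hτ.1, mem_closedSimplex_of_mem hτ.2⟩
          · have h1 := hT.isMesh.card_cell_mul_le hd1 hκ0 hρ.1 hb
              (hΩ.isBounded.subset (M.cell_subset hΩ K.2)) (T.filter fun τ => cell τ = K)
              (Finset.filter_subset _ _) (fun τ hτ => by
                rw [Finset.mem_filter] at hτ
                have h2 : openSimplex τ ⊆ K := hτ.2 ▸ hcell τ hτ.1
                exact ⟨h2, hreg' τ hτ.1 K K.2 h2⟩)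
            have h2 := (le_div_iff₀ (pow_pos (mul_pos hκ0 hρ.1) d)).2 h1
            rw [one_div] at h2
            exact Nat.cast_le.1 (h2.trans hN')
      _ = C₃ * D.stab v v := by rw [hC₃]; ring
  have hX : ∑ τ ∈ T, volume.real (openSimplex τ) * ∑ i, ∑ j, G τ i j ^ 2 ≤
      2 * ∑ τ ∈ T, volume.real (openSimplex τ) * ∑ i, ∑ j, A τ i j ^ 2 +
      2 * ∑ τ ∈ T, volume.real (openSimplex τ) * ∑ i, ∑ j, (A τ i j - G τ i j) ^ 2 := by
    rw [Finset.mul_sum, Finset.mul_sum, ← Finset.sum_add_distrib]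
    refine Finset.sum_le_sum fun τ _ => ?_
    have := mul_le_mul_of_nonneg_left (sum_sq_le_two_mul_add (A τ) (G τ))
      (measureReal_nonneg (μ := volume) (s := openSimplex τ))
    linarith
  have hE : ∑ τ ∈ T, volume.real (openSimplex τ) *
        ∑ i, ∑ j, ((1 / 2 : ℝ) * (A τ i j + A τ j i)) ^ 2 ≤
      2 * ∑ τ ∈ T, volume.real (openSimplex τ) *
        ∑ i, ∑ j, ((1 / 2 : ℝ) * (G τ i j + G τ j i)) ^ 2 +
      2 * ∑ τ ∈ T, volume.real (openSimplex τ) * ∑ i, ∑ j, (A τ i j - G τ i j) ^ 2 := by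
    rw [Finset.mul_sum, Finset.mul_sum, ← Finset.sum_add_distrib]
    refine Finset.sum_le_sum fun τ _ => ?_
    have := mul_le_mul_of_nonneg_left (sum_sym_sq_le_two_mul_add (A τ) (G τ))
      (measureReal_nonneg (μ := volume) (s := openSimplex τ))
    linarith
  have hε := D.l2Norm_symGrad_sq v hΩ
  rw [hT.sum_cellMeasure_mul hΩ hcell fun K =>
    ∑ i, ∑ j, ((1 / 2 : ℝ) * (D.gradCell v K i j + D.gradCell v K j i)) ^ 2] at hε
  rw [D.normOne_sq, hT.sum_cellMeasure_mul hΩ hcell fun K => ∑ i, ∑ j, D.gradCell v K i j ^ 2]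
  have hε0 := sq_nonneg (l2Norm Ω (D.symGrad v))
  have hCε := mul_nonneg hC₃0 hε0
  simp only [hG] at hX hE hZ
  rw [← hε] at hE
  nlinarith

end DDR

/-- The constant of `discrete_korn` is chosen before the domain, so it serves for every `Ω`. -/
theorem mainTheorem3 (d : ℕ) (hd : d = 2 ∨ d = 3) (Ω : Set (DDR.Pt d)) (hΩ : DDR.IsPolytope Ω)
    (ρ : ℝ) (hρ : ρ ∈ Set.Ioo (0 : ℝ) 1) :
    ∃ C : ℝ, 0 < C ∧
      ∀ (M : DDR.PolytopalMesh d Ω), M.IsRegular ρ →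
      ∀ (D : M.Choices) (v : M.Dofs), v ∈ M.dofsZero →
        D.normOne v ^ 2 ≤ C * (DDR.l2Norm Ω (D.symGrad v) ^ 2 + D.stab v v) := by
  obtain ⟨C, hC, h⟩ := DDR.discrete_korn hd hρ
  exact ⟨C, hC, h Ω hΩ⟩
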